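/- Fix an integer $S\ge 1$. For $\beta\ge 0$, $D\in\mathbb R$, $h\ge 0$ and $N\ge 1$ consider the Ghatak--Sherrington Hamiltonian $$H_N(\sigma)=\frac{\beta}{\sqrt N}\sum_{1\le i<j\le N} g_{ij}\sigma_i\sigma_j+D\sum_{i=1}^N\sigma_i^2+h\sum_{i=1}^N\sigma_i ,\qquad \sigma\in\{0,\pm1,\dots,\pm S\}^N,$$ where $(g_{ij})_{i<j}$ are i.i.d. standard Gaussian random variables; let $\langle f\rangle=\sum_\sigma f(\sigma)e^{H_N(\sigma)}/\sum_\sigma e^{H_N(\sigma)}$ denote the thermal average and $\mathbb E$ the expectation over the $g_{ij}$. For $x,y\in\mathbb R$ put $$f_{\rm sh}(x,y)=\frac{\sum_{\gamma=1}^S 2\gamma\sinh(\gamma y)\,e^{\gamma^2x}}{1+\sum_{\gamma=1}^S 2\cosh(\gamma y)\,e^{\gamma^2x}},\qquad f_{\rm ch}(x,y)=\frac{\sum_{\gamma=1}^S 2\gamma^2\cosh(\gamma y)\,e^{\gamma^2x}}{1+\sum_{\gamma=1}^S 2\cosh(\gamma y)\,e^{\gamma^2x}} .$$ There are constants $K,\hat\beta>0$,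 depending only on $S$, such that for all $0\le\beta<\hat\beta$, $h\ge 0$ and $D\in\mathbb R$ the following holds. With $X$ a standard Gaussian random variable, the system $$p=\mathbb E\big[f_{\rm ch}(\Delta,\sqrt q\,\beta X+h)\big],\qquad q=\mathbb E\big[f_{\rm sh}(\Delta,\sqrt q\,\beta X+h)^2\big],\qquad \Delta=D+\tfrac{\beta^2}{2}(p-q),$$ has a unique solution $(p,q)\in\mathbb R\times[0,\infty)$; and for this solution and every $N\ge 1$, $$\mathbb E\Big[\big(\langle\sigma_N\rangle-f_{\rm sh}(\Delta,\beta\xi_N+h)\big)^2\Big]\le\frac{K}{\sqrt N},\qquad \mathbb E\Big[\big(\langle\sigma_N^2\rangle-f_{\rm ch}(\Delta,\beta\xi_N+h)\big)^2\Big]\le\frac{K}{\sqrt N},$$ where $$\xi_N=\frac{1}{\sqrt N}\sum_{i=1}^{N-1} g_{iN}\langle\sigma_i\rangle-\beta(p-q)\langle\sigma_N\rangle .$$ -/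

import Mathlib

open MeasureTheory ProbabilityTheory

noncomputable section

namespace GhatakSherrington

/-- The values `0, ±1, …, ±S` of a single spin. -/
abbrev Spin (S : ℕ) : Type := {s : ℤ // s ∈ Finset.Icc (-(S : ℤ)) (S : ℤ)}

/-- Configurations `σ = (σ_i)` of `N` spins. -/
abbrev Config (S N : ℕ) : Type := Fin N → Spin S

/-- The value of the spin at site `i`, as a real number. -/
def spin {S N : ℕ} (i : Fin N) (σ : Config S N) : ℝ := (((σ i : Spin S) : ℤ) : ℝ)

/-- The Hamiltonian
`(β / √N) ∑_{i < j} g_{ij} σ_i σ_j + D ∑_i σ_i ^ 2 + h ∑_i σ_i`. Only the entries `g i j` with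
`i < j` are used. -/
def hamiltonian {S N : ℕ} (β D h : ℝ) (g : Fin N → Fin N → ℝ) (σ : Config S N) : ℝ :=
  β / √(N : ℝ) * ∑ i : Fin N, ∑ j ∈ Finset.Ioi i, g i j * spin i σ * spin j σ
    + D * ∑ i : Fin N, spin i σ ^ 2 + h * ∑ i : Fin N, spin i σ

/-- The partition function. -/
def partitionFunction (S N : ℕ) (β D h : ℝ) (g : Fin N → Fin N → ℝ) : ℝ :=
  ∑ σ : Config S N, Real.exp (hamiltonian β D h g σ)

/-- The thermal average `⟨f⟩` of `f` under the Gibbs measure with weights `exp (H σ) / Z`. -/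
def gibbsAvg {S N : ℕ} (β D h : ℝ) (g : Fin N → Fin N → ℝ) (f : Config S N → ℝ) : ℝ :=
  ∑ σ : Config S N, f σ * (Real.exp (hamiltonian β D h g σ) / partitionFunction S N β D h g)

/-- The common denominator `1 + ∑_{γ=1}^S 2 ch(γ y) exp(γ² x)`. -/
def denom (S : ℕ) (x y : ℝ) : ℝ :=
  1 + ∑ γ ∈ Finset.Icc 1 S, 2 * Real.cosh ((γ : ℝ) * y) * Real.exp ((γ : ℝ) ^ 2 * x)

/-- `(∑_{γ=1}^S γ · 2 sh(γ y) exp(γ² x)) / (1 + ∑_{γ=1}^S 2 ch(γ y) exp(γ² x))`. -/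
def shRatio (S : ℕ) (x y : ℝ) : ℝ :=
  (∑ γ ∈ Finset.Icc 1 S, (γ : ℝ) * (2 * Real.sinh ((γ : ℝ) * y)) * Real.exp ((γ : ℝ) ^ 2 * x))
    / denom S x y

/-- `(∑_{γ=1}^S γ² · 2 ch(γ y) exp(γ² x)) / (1 + ∑_{γ=1}^S 2 ch(γ y) exp(γ² x))`. -/
def chRatio (S : ℕ) (x y : ℝ) : ℝ :=
  (∑ γ ∈ Finset.Icc 1 S,
      (γ : ℝ) ^ 2 * (2 * Real.cosh ((γ : ℝ) * y)) * Real.exp ((γ : ℝ) ^ 2 * x))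
    / denom S x y

/-- The shifted crystal field `Δ = D + β² (p - q) / 2`. -/
def shift (β D p q : ℝ) : ℝ := D + β ^ 2 / 2 * (p - q)

/-- `(p, q)` solves the two fixed point equations, the expectation being over a standard Gaussian
variable `X`. The integrands are bounded and continuous. The condition `0 ≤ q`, under which `√q`
has its usual meaning, also follows from the second equation. -/
def IsFixedPoint (S : ℕ) (β D h p q : ℝ) : Prop :=
  0 ≤ q ∧
  p = ∫ X : ℝ, chRatio S (shift β D p q) (√q * β * X + h) ∂(gaussianReal 0 1) ∧
  q = ∫ X : ℝ, shRatio S (shift β D p q) (√q * β * X + h) ^ 2 ∂(gaussianReal 0 1)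

/-- The couplings `g_{ij}`, `i < j`, are independent standard Gaussian random variables. -/
def IsGaussianDisorder {N : ℕ} {Ω : Type*} [MeasurableSpace Ω] (P : Measure Ω)
    (g : Ω → Fin N → Fin N → ℝ) : Prop :=
  (∀ i j : Fin N, i < j → HasLaw (fun ω => g ω i j) (gaussianReal 0 1) P) ∧
  iIndepFun (fun (e : {e : Fin N × Fin N // e.1 < e.2}) (ω : Ω) => g ω e.1.1 e.1.2) P

/-- The local field at the last site of a system of `N = n + 1` spins,
`ξ_N = (1 / √N) ∑_{i < N} g_{iN} ⟨σ_i⟩ - β (p - q) ⟨σ_N⟩`. -/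
def localField (S : ℕ) {n : ℕ} (β D h p q : ℝ) (g : Fin (n + 1) → Fin (n + 1) → ℝ) : ℝ :=
  1 / √((n + 1 : ℕ) : ℝ) *
      ∑ i : Fin n, g i.castSucc (Fin.last n) * gibbsAvg (S := S) β D h g (spin i.castSucc)
    - β * (p - q) * gibbsAvg (S := S) β D h g (spin (Fin.last n))

/-- The error in the first equation at the last site. -/
def tapError₁ (S : ℕ) {n : ℕ} (β D h p q : ℝ) (g : Fin (n + 1) → Fin (n + 1) → ℝ) : ℝ :=
  gibbsAvg (S := S) β D h g (spin (Fin.last n))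
    - shRatio S (shift β D p q) (β * localField S β D h p q g + h)

/-- The error in the second equation at the last site. -/
def tapError₂ (S : ℕ) {n : ℕ} (β D h p q : ℝ) (g : Fin (n + 1) → Fin (n + 1) → ℝ) : ℝ :=
  gibbsAvg (S := S) β D h g (fun σ => spin (Fin.last n) σ ^ 2)
    - chRatio S (shift β D p q) (β * localField S β D h p q g + h)

end GhatakSherrington

end

/-!
The last spin is compared with a single spin in the field created by the other `n` spins, and the
comparison rests on the concentration of the overlaps of those `n` spins.

*The fixed point.* The map `(p, q) ↦ (E f_ch, E (f_sh)²)` is a contraction for small `β`, uniformly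
in `D` and `h`. The only delicate point is the dependence on `√q`, which is not Lipschitz at `0`:
a Gaussian variable of variance `q'` is the sum of independent ones of variances `q` and `q' - q`,
and averaging over the second kills the first order term of the Taylor expansion, so that the change
is of order `β² (q' - q)` (`SmoothBound.gaussAvg_right`, `existsUnique_isFixedPoint`).

*Concentration of the overlaps.* Consider `n` spins with couplings of strength `β / √N`,
`N = n + 1`, and write `R₁₂ = ∑ i, σ i τ i` for the unnormalized overlap of two replicas. The system
is joined by a path to `n` independent sites with energy `Δ s² + (√q β z + h) s`. The two replicas
are coupled by the *positive* weight `exp ((lam / N) ((R₁₂ - N q)² + (R₁₁ - N p)² + (R₂₂ - N p)²))`,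
the strength `lam` decreasing along the path. Gaussian integration by parts turns the derivative of
the free energy of the coupled pair, minus twice that of a single system, into averages of squares
of centred overlaps: those with the wrong sign under the coupled measure are absorbed by the
decrease of `lam`, and what remains is an average under the uncoupled measure, which Jensen's
inequality bounds by the excess free energy itself. Gronwall's inequality then bounds the excess
free energy at the end of the path by its value at the start (`excessFree_pi_div_two_le`). There the
sites are independent, the fixed point equations say exactly that the overlaps are centred, and the
excess is bounded by a sub-Gaussian estimate (`excessFree_zero_le`). Hence the mean squared
deviations of the overlaps are of order `N`, uniformly in `D` and `h`
(`meanDeviation_pi_div_two_le`).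

*The cavity step.* Given the first `n` spins, the last one feels the cavity field
`N^{-1/2} ∑ g_i ⟨σ_i⟩⁻` plus a fluctuation `v · g`, where `v` is the centred configuration divided
by `√N` and `⟨·⟩⁻` is the Gibbs average of the first `n` spins alone. Averaging the fluctuation out
multiplies the weight of the spin value `s` by `U_s = ⟨exp (β s v · g)⟩⁻`. By the concentration of
the overlaps the vectors `v` of two replicas are nearly orthogonal and have squared length close to
`p - q`; since the couplings `g` are Gaussian and independent of `⟨·⟩⁻`, the second moment of
`U_s - exp (β² s² (p - q) / 2)` can be computed with two replicas and is of order `N^{-1/2}`. The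
factor `exp (β² s² (p - q) / 2)` is what turns `D` into `Δ`. The same computation for
`⟨v · g exp (β s v · g)⟩⁻`, which is close to `β s (p - q) U_s`, shows that the cavity field is close
to the local field: this is the origin of the term `β (p - q) ⟨σ_N⟩`. As `U_s ≥ 1` by Jensen's
inequality, the normalizations cost nothing (`localField_eq`, `sq_tapError_le`).
-/


noncomputable section

namespace GhatakSherrington

/-! ### Gibbs averages on a finite set -/

/-- The Gibbs average of `f` on a finite set with weights proportional to `exp (H a)`. -/
def gibbs {α : Type*} [Fintype α] (H f : α → ℝ) : ℝ :=
  (∑ a, f a * Real.exp (H a)) / ∑ a, Real.exp (H a)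

section Gibbs

variable {α β : Type*} [Fintype α] [Fintype β]

lemma sum_exp_pos [Nonempty α] (H : α → ℝ) : 0 < ∑ a, Real.exp (H a) :=
  Finset.sum_pos (fun _ _ => Real.exp_pos _) Finset.univ_nonempty

lemma gibbs_add (H f g : α → ℝ) : gibbs H (fun a => f a + g a) = gibbs H f + gibbs H g := by
  simp only [gibbs, add_mul, Finset.sum_add_distrib, add_div]

lemma gibbs_sub (H f g : α → ℝ) : gibbs H (fun a => f a - g a) = gibbs H f - gibbs H g := by
  simp only [gibbs, sub_mul, Finset.sum_sub_distrib, sub_div]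

lemma gibbs_const_mul (H f : α → ℝ) (c : ℝ) : gibbs H (fun a => c * f a) = c * gibbs H f := by
  simp only [gibbs, mul_assoc, ← Finset.mul_sum, mul_div_assoc]

lemma gibbs_mul_const (H f : α → ℝ) (c : ℝ) : gibbs H (fun a => f a * c) = gibbs H f * c := by
  simp only [mul_comm _ c, gibbs_const_mul]

lemma gibbs_const [Nonempty α] (H : α → ℝ) (c : ℝ) : gibbs H (fun _ => c) = c := by
  rw [gibbs, ← Finset.mul_sum, mul_div_assoc, div_self (sum_exp_pos H).ne', mul_one]

lemma gibbs_sum {κ : Type*} (H : α → ℝ) (s : Finset κ) (f : κ → α → ℝ) :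
    gibbs H (fun a => ∑ k ∈ s, f k a) = ∑ k ∈ s, gibbs H (f k) := by
  simp only [gibbs, Finset.sum_mul]
  rw [Finset.sum_comm, Finset.sum_div]

lemma gibbs_mono (H : α → ℝ) {f g : α → ℝ} (h : ∀ a, f a ≤ g a) : gibbs H f ≤ gibbs H g := by
  unfold gibbs
  gcongr with a
  exact h a

lemma gibbs_nonneg (H : α → ℝ) {f : α → ℝ} (h : ∀ a, 0 ≤ f a) : 0 ≤ gibbs H f :=
  div_nonneg (Finset.sum_nonneg fun a _ => mul_nonneg (h a) (Real.exp_pos _).le)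
    (Finset.sum_nonneg fun _ _ => (Real.exp_pos _).le)

lemma gibbs_le_of_le [Nonempty α] (H : α → ℝ) {f : α → ℝ} {C : ℝ} (h : ∀ a, f a ≤ C) :
    gibbs H f ≤ C :=
  (gibbs_mono H h).trans_eq (gibbs_const H C)

lemma le_gibbs_of_le [Nonempty α] (H : α → ℝ) {f : α → ℝ} {C : ℝ} (h : ∀ a, C ≤ f a) :
    C ≤ gibbs H f :=
  (gibbs_const H C).symm.trans_le (gibbs_mono H h)

lemma abs_gibbs_le [Nonempty α] (H : α → ℝ) {f : α → ℝ} {C : ℝ} (h : ∀ a, |f a| ≤ C) :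
    |gibbs H f| ≤ C :=
  abs_le.2 ⟨le_gibbs_of_le H fun a => (abs_le.1 (h a)).1,
    gibbs_le_of_le H fun a => (abs_le.1 (h a)).2⟩

lemma abs_gibbs_le_gibbs_abs (H f : α → ℝ) : |gibbs H f| ≤ gibbs H (fun a => |f a|) := by
  rw [abs_le]
  constructor
  · have := gibbs_mono H (fun a => neg_abs_le (f a))
    have h := gibbs_const_mul H (fun a => |f a|) (-1)
    simp only [neg_one_mul] at h
    linarith
  · exact gibbs_mono H fun a => le_abs_self (f a)

lemma gibbs_equiv (e : β ≃ α) (H f : α → ℝ) : gibbs (fun b => H (e b)) (fun b => f (e b))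
    = gibbs H f := by
  simp only [gibbs]
  rw [e.sum_comp (fun a => f a * Real.exp (H a)), e.sum_comp (fun a => Real.exp (H a))]

/-- The energy of a pair of configurations that do not interact. -/
def pairEnergy (H : α → ℝ) (H' : β → ℝ) (x : α × β) : ℝ := H x.1 + H' x.2

lemma sum_exp_pairEnergy (H : α → ℝ) (H' : β → ℝ) :
    ∑ x, Real.exp (pairEnergy H H' x) = (∑ a, Real.exp (H a)) * ∑ b, Real.exp (H' b) := by
  simp only [pairEnergy, Real.exp_add, Fintype.sum_prod_type, Finset.sum_mul_sum]

lemma gibbs_pair_mul (H : α → ℝ) (H' : β → ℝ) (f : α → ℝ) (g : β → ℝ) :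
    gibbs (pairEnergy H H') (fun x => f x.1 * g x.2) = gibbs H f * gibbs H' g := by
  rw [gibbs, sum_exp_pairEnergy, gibbs, gibbs, div_mul_div_comm]
  congr 1
  rw [Finset.sum_mul_sum, Fintype.sum_prod_type]
  refine Finset.sum_congr rfl fun a _ => ?_
  refine Finset.sum_congr rfl fun b _ => ?_
  simp only [pairEnergy, Real.exp_add]
  ring

lemma gibbs_pair_fst [Nonempty β] (H : α → ℝ) (H' : β → ℝ) (f : α → ℝ) :
    gibbs (pairEnergy H H') (fun x => f x.1) = gibbs H f := by
  have := gibbs_pair_mul H H' f (fun _ => 1)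
  simpa only [mul_one, gibbs_const] using this

lemma gibbs_pair_snd [Nonempty α] (H : α → ℝ) (H' : β → ℝ) (g : β → ℝ) :
    gibbs (pairEnergy H H') (fun x => g x.2) = gibbs H' g := by
  have := gibbs_pair_mul H H' (fun _ => 1) g
  simpa only [one_mul, gibbs_const] using this

lemma gibbs_pair (H : α → ℝ) (H' : β → ℝ) (f : α × β → ℝ) :
    gibbs (pairEnergy H H') f = gibbs H (fun a => gibbs H' (fun b => f (a, b))) := by
  rw [gibbs, sum_exp_pairEnergy, Fintype.sum_prod_type]
  simp only [gibbs, div_mul_eq_mul_div, pairEnergy, Real.exp_add, ← Finset.sum_div, div_div]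
  rw [mul_comm (∑ a, Real.exp (H a))]
  congr 1
  refine Finset.sum_congr rfl fun a _ => ?_
  rw [Finset.sum_mul]
  refine Finset.sum_congr rfl fun b _ => ?_
  ring

/-- Non-interacting sites: the Gibbs average of a product is a product of Gibbs averages. -/
lemma gibbs_pi {ι : Type*} [Fintype ι] [DecidableEq ι] (H f : ι → α → ℝ) :
    gibbs (fun σ : ι → α => ∑ i, H i (σ i)) (fun σ => ∏ i, f i (σ i)) = ∏ i, gibbs (H i) (f i) := by
  simp only [gibbs, Real.exp_sum, ← Finset.prod_mul_distrib, Finset.prod_div_distrib]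
  congr 1
  · exact (Fintype.prod_sum (fun i a => f i a * Real.exp (H i a))).symm
  · exact (Fintype.prod_sum (fun i a => Real.exp (H i a))).symm

/-- Jensen's inequality for the exponential. -/
lemma exp_gibbs_le [Nonempty α] (H f : α → ℝ) :
    Real.exp (gibbs H f) ≤ gibbs H (fun a => Real.exp (f a)) := by
  set m := gibbs H f with hm
  have h1 : gibbs H (fun a => Real.exp m * (f a - m + 1)) ≤ gibbs H (fun a => Real.exp (f a)) := by
    refine gibbs_mono H fun a => ?_
    calc Real.exp m * (f a - m + 1) ≤ Real.exp m * Real.exp (f a - m) := by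
          gcongr; exact Real.add_one_le_exp _
      _ = Real.exp (f a) := by rw [← Real.exp_add]; congr 1; ring
  rwa [gibbs_const_mul, gibbs_add, gibbs_sub, gibbs_const, gibbs_const, ← hm, sub_self, zero_add,
    mul_one] at h1

lemma log_sum_exp_add [Nonempty α] (H f : α → ℝ) :
    Real.log (∑ a, Real.exp (H a + f a))
      = Real.log (∑ a, Real.exp (H a)) + Real.log (gibbs H (fun a => Real.exp (f a))) := by
  have h0 := sum_exp_pos H
  have h1 : 0 < ∑ a, Real.exp (f a) * Real.exp (H a) :=
    Finset.sum_pos (fun _ _ => by positivity) Finset.univ_nonempty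
  rw [gibbs, Real.log_div h1.ne' h0.ne', add_sub_cancel]
  simp only [Real.exp_add, mul_comm]

lemma hasDerivAt_log_sum_exp [Nonempty α] {H : ℝ → α → ℝ} {H' : α → ℝ} {s : ℝ}
    (h : ∀ a, HasDerivAt (fun t => H t a) (H' a) s) :
    HasDerivAt (fun t => Real.log (∑ a, Real.exp (H t a))) (gibbs (H s) H') s := by
  have h1 : HasDerivAt (fun t => ∑ a, Real.exp (H t a)) (∑ a, Real.exp (H s a) * H' a) s :=
    HasDerivAt.fun_sum fun a _ => (h a).exp
  have := h1.log (sum_exp_pos (H s)).ne'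
  simpa only [gibbs, mul_comm] using this

/-- The derivative of a Gibbs average of a fixed function is a covariance. -/
lemma hasDerivAt_gibbs [Nonempty α] {H : ℝ → α → ℝ} {H' : α → ℝ} {s : ℝ} (f : α → ℝ)
    (h : ∀ a, HasDerivAt (fun t => H t a) (H' a) s) :
    HasDerivAt (fun t => gibbs (H t) f)
      (gibbs (H s) (fun a => f a * H' a) - gibbs (H s) f * gibbs (H s) H') s := by
  have h1 : HasDerivAt (fun t => ∑ a, Real.exp (H t a)) (∑ a, Real.exp (H s a) * H' a) s :=
    HasDerivAt.fun_sum fun a _ => (h a).exp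
  have h2 : HasDerivAt (fun t => ∑ a, f a * Real.exp (H t a))
      (∑ a, f a * (Real.exp (H s a) * H' a)) s :=
    HasDerivAt.fun_sum fun a _ => (h a).exp.const_mul (f a)
  have h0 := (sum_exp_pos (H s)).ne'
  refine (h2.div h1 h0).congr_deriv ?_
  have e1 : ∑ a, Real.exp (H s a) * H' a = ∑ a, H' a * Real.exp (H s a) := by simp only [mul_comm]
  have e2 : ∑ a, f a * (Real.exp (H s a) * H' a) = ∑ a, f a * H' a * Real.exp (H s a) :=
    Finset.sum_congr rfl fun a _ => by ring
  rw [e1, e2]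
  simp only [gibbs]
  field_simp

lemma continuous_gibbs [Nonempty α] {X : Type*} [TopologicalSpace X] {H : X → α → ℝ}
    {f : X → α → ℝ} (hH : ∀ a, Continuous fun x => H x a) (hf : ∀ a, Continuous fun x => f x a) :
    Continuous fun x => gibbs (H x) (f x) := by
  unfold gibbs
  refine Continuous.div ?_ ?_ fun x => (sum_exp_pos (H x)).ne'
  · exact continuous_finsetSum _ fun a _ => (hf a).mul (hH a).rexp
  · exact continuous_finsetSum _ fun a _ => (hH a).rexp

end Gibbs

/-! ### Standard Gaussian vectors -/

/-- The standard Gaussian measure on the line. -/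
abbrev stdGaussian : Measure ℝ := gaussianReal 0 1

/-- The law of a family of independent standard Gaussian variables. -/
abbrev gaussianPi (ι : Type*) [Fintype ι] : Measure (ι → ℝ) := Measure.pi fun _ => stdGaussian

/-- Gaussian integration by parts on the line. -/
lemma integral_mul_stdGaussian {f f' : ℝ → ℝ} (hf : ∀ x, HasDerivAt f (f' x) x)
    (hi : Integrable f stdGaussian) (hi' : Integrable f' stdGaussian)
    (hxi : Integrable (fun x => x * f x) stdGaussian) :
    ∫ x, x * f x ∂stdGaussian = ∫ x, f' x ∂stdGaussian := by
  have hpdf : ∀ x, HasDerivAt (gaussianPDFReal 0 1) (-(x * gaussianPDFReal 0 1 x)) x := by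
    intro x
    have h1 : HasDerivAt (fun y : ℝ => -y ^ 2 / 2) (-x) x := by
      refine (((hasDerivAt_pow 2 x).neg).div_const 2).congr_deriv ?_
      simp only [Nat.cast_ofNat, Nat.add_one_sub_one, pow_one]
      ring
    have h2 := (h1.exp).const_mul ((√(2 * Real.pi))⁻¹)
    have e : gaussianPDFReal 0 1 = fun y => (√(2 * Real.pi))⁻¹ * Real.exp (-y ^ 2 / 2) := by
      funext y; simp [gaussianPDFReal]
    rw [e]
    refine h2.congr_deriv ?_
    ring
  have key : ∀ g : ℝ → ℝ, Integrable g stdGaussian →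
      Integrable (fun x => gaussianPDFReal 0 1 x * g x) := by
    intro g hg
    rw [stdGaussian, gaussianReal_of_var_ne_zero 0 one_ne_zero,
      integrable_withDensity_iff_integrable_smul' (measurable_gaussianPDF 0 1)
        (Filter.Eventually.of_forall fun _ => gaussianPDF_lt_top)] at hg
    simpa only [toReal_gaussianPDF, smul_eq_mul] using hg
  have i1 := key _ hi
  have i2 := key _ hi'
  have i3 := key _ hxi
  have h0 := integral_eq_zero_of_hasDerivAt_of_integrable
    (f := fun x => gaussianPDFReal 0 1 x * f x)
    (f' := fun x => gaussianPDFReal 0 1 x * f' x - gaussianPDFReal 0 1 x * (x * f x))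
    (fun x => by
      refine ((hpdf x).mul (hf x)).congr_deriv ?_
      ring) (i2.sub i3) i1
  rw [integral_sub i2 i3] at h0
  rw [stdGaussian, integral_gaussianReal_eq_integral_smul one_ne_zero,
    integral_gaussianReal_eq_integral_smul one_ne_zero]
  simp only [smul_eq_mul]
  linarith

variable {ι : Type*} [Fintype ι]

/-- Resampling one coordinate of a standard Gaussian vector does not change its law. -/
lemma measurePreserving_update [DecidableEq ι] (e : ι) :
    MeasurePreserving (fun p : (ι → ℝ) × ℝ => Function.update p.1 e p.2)
      ((gaussianPi ι).prod stdGaussian) (gaussianPi ι) := by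
  have hm : Measurable fun p : (ι → ℝ) × ℝ => Function.update p.1 e p.2 := by
    refine measurable_pi_lambda _ fun i => ?_
    by_cases h : i = e
    · subst h; simpa using measurable_snd
    · simp only [Function.update_of_ne h]; fun_prop
  refine ⟨hm, (Measure.pi_eq fun s hs => ?_).symm⟩
  rw [Measure.map_apply hm (MeasurableSet.univ_pi hs)]
  have : (fun p : (ι → ℝ) × ℝ => Function.update p.1 e p.2) ⁻¹' Set.univ.pi s
      = (Set.univ.pi (Function.update s e Set.univ)) ×ˢ s e := by
    ext p
    simp only [Set.mem_preimage, Set.mem_univ_pi, Set.mem_prod]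
    constructor
    · intro h
      refine ⟨fun i => ?_, by simpa using h e⟩
      by_cases hi : i = e
      · subst hi; simp
      · simpa [Function.update_of_ne hi] using h i
    · rintro ⟨h1, h2⟩ i
      by_cases hi : i = e
      · subst hi; simpa using h2
      · simpa [Function.update_of_ne hi] using h1 i
  rw [this, Measure.prod_prod, Measure.pi_pi, ← Finset.mul_prod_erase _ _ (Finset.mem_univ e),
    ← Finset.mul_prod_erase (Finset.univ) (fun i => stdGaussian (s i)) (Finset.mem_univ e)]
  rw [Function.update_self, measure_univ, one_mul, mul_comm]
  congr 1
  refine Finset.prod_congr rfl fun i hi => ?_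
  rw [Function.update_of_ne (Finset.ne_of_mem_erase hi)]

/-- Gaussian integration by parts with respect to one coordinate. -/
lemma integral_mul_gaussianPi [DecidableEq ι] {F F' : (ι → ℝ) → ℝ} (e : ι)
    (hF : ∀ x, HasDerivAt (fun t => F (Function.update x e t)) (F' x) (x e))
    (hi : Integrable F (gaussianPi ι)) (hi' : Integrable F' (gaussianPi ι))
    (hxi : Integrable (fun x => x e * F x) (gaussianPi ι)) :
    ∫ x, x e * F x ∂gaussianPi ι = ∫ x, F' x ∂gaussianPi ι := by
  have mp := measurePreserving_update e
  have step : ∀ G : (ι → ℝ) → ℝ, Integrable G (gaussianPi ι) →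
      Integrable (fun p : (ι → ℝ) × ℝ => G (Function.update p.1 e p.2))
        ((gaussianPi ι).prod stdGaussian) ∧
      ∫ x, G x ∂gaussianPi ι
        = ∫ x, ∫ t, G (Function.update x e t) ∂stdGaussian ∂gaussianPi ι := by
    intro G hG
    have h1 : Integrable (fun p : (ι → ℝ) × ℝ => G (Function.update p.1 e p.2))
        ((gaussianPi ι).prod stdGaussian) := mp.integrable_comp_of_integrable hG
    refine ⟨h1, ?_⟩
    rw [← integral_prod _ h1]
    conv_lhs => rw [← mp.map_eq]
    exact integral_map mp.measurable.aemeasurable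
      (by rw [mp.map_eq]; exact hG.aestronglyMeasurable)
  obtain ⟨a1, -⟩ := step F hi
  obtain ⟨a2, b2⟩ := step F' hi'
  obtain ⟨a3, b3⟩ := step _ hxi
  rw [b2, b3]
  refine integral_congr_ae ?_
  filter_upwards [a1.prod_right_ae, a2.prod_right_ae, a3.prod_right_ae] with x h1 h2 h3
  simp only [Function.update_self] at h3 ⊢
  refine integral_mul_stdGaussian (fun t => ?_) h1 h2 h3
  simpa using hF (Function.update x e t)

lemma integrable_exp_linear (m : ι → ℝ) :
    Integrable (fun g : ι → ℝ => Real.exp (∑ i, m i * g i)) (gaussianPi ι) := by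
  simp only [Real.exp_sum]
  exact Integrable.fintype_prod (f := fun i x => Real.exp (m i * x))
    fun i => integrable_exp_mul_gaussianReal (m i)

lemma integral_exp_mul_stdGaussian (t : ℝ) :
    ∫ x, Real.exp (t * x) ∂stdGaussian = Real.exp (t ^ 2 / 2) := by
  have := congrFun (mgf_id_gaussianReal (μ := 0) (v := 1)) t
  simpa [mgf] using this

lemma integral_exp_linear (m : ι → ℝ) :
    ∫ g, Real.exp (∑ i, m i * g i) ∂gaussianPi ι = Real.exp ((∑ i, m i ^ 2) / 2) := by
  simp only [Real.exp_sum]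
  rw [integral_fintype_prod_eq_prod (fun i x => Real.exp (m i * x))]
  simp only [integral_exp_mul_stdGaussian, ← Real.exp_sum, Finset.sum_div]

lemma continuous_linear (m : ι → ℝ) : Continuous fun g : ι → ℝ => ∑ i, m i * g i :=
  continuous_finsetSum _ fun i _ => (continuous_apply i).const_mul _

lemma abs_le_exp_add_exp (x : ℝ) : |x| ≤ Real.exp x + Real.exp (-x) := by
  rw [abs_le]
  have h1 := Real.add_one_le_exp x
  have h2 := Real.add_one_le_exp (-x)
  have h3 := Real.exp_pos x
  have h4 := Real.exp_pos (-x)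
  constructor <;> linarith

lemma integrable_linear_mul_exp (u m : ι → ℝ) :
    Integrable (fun g : ι → ℝ => (∑ i, u i * g i) * Real.exp (∑ i, m i * g i))
      (gaussianPi ι) := by
  have hb := (integrable_exp_linear (u + m)).add (integrable_exp_linear (-u + m))
  refine hb.mono' (((continuous_linear u).mul (continuous_linear m).rexp).aestronglyMeasurable)
    (Filter.Eventually.of_forall fun g => ?_)
  rw [Real.norm_eq_abs, abs_mul, abs_of_pos (Real.exp_pos _)]
  calc |∑ i, u i * g i| * Real.exp (∑ i, m i * g i)
      ≤ (Real.exp (∑ i, u i * g i) + Real.exp (-∑ i, u i * g i))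
          * Real.exp (∑ i, m i * g i) := by
        gcongr; exact abs_le_exp_add_exp _
    _ = _ := by
        simp only [Pi.add_apply, Pi.neg_apply, add_mul, Finset.sum_add_distrib, ← Real.exp_add,
          neg_mul, Finset.sum_neg_distrib]

lemma integrable_linear_mul_linear_mul_exp (u v m : ι → ℝ) :
    Integrable (fun g : ι → ℝ =>
      (∑ i, u i * g i) * ((∑ i, v i * g i) * Real.exp (∑ i, m i * g i))) (gaussianPi ι) := by
  have hb := (integrable_linear_mul_exp v (u + m)).norm.add
    (integrable_linear_mul_exp v (-u + m)).norm
  refine hb.mono' (((continuous_linear u).mul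
    ((continuous_linear v).mul (continuous_linear m).rexp)).aestronglyMeasurable)
    (Filter.Eventually.of_forall fun g => ?_)
  rw [Real.norm_eq_abs, abs_mul]
  calc |∑ i, u i * g i| * |(∑ i, v i * g i) * Real.exp (∑ i, m i * g i)|
      ≤ (Real.exp (∑ i, u i * g i) + Real.exp (-∑ i, u i * g i))
          * |(∑ i, v i * g i) * Real.exp (∑ i, m i * g i)| := by
        gcongr; exact abs_le_exp_add_exp _
    _ = _ := by
        simp only [Pi.add_apply, Pi.neg_apply, add_mul, Finset.sum_add_distrib, Real.exp_add,
          neg_mul, Finset.sum_neg_distrib, Real.norm_eq_abs, abs_mul, Real.abs_exp]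
        ring

lemma hasDerivAt_linear_update [DecidableEq ι] (m x : ι → ℝ) (e : ι) :
    HasDerivAt (fun t => ∑ i, m i * Function.update x e t i) (m e) (x e) := by
  have h : ∀ i ∈ Finset.univ, HasDerivAt (fun t => m i * Function.update x e t i)
      (m i * if i = e then 1 else 0) (x e) := by
    intro i _
    refine HasDerivAt.const_mul _ ?_
    by_cases hi : i = e
    · subst hi; simpa using hasDerivAt_id' (x i)
    · simpa [Function.update_of_ne hi, hi] using hasDerivAt_const (x e) (x i)
  refine (HasDerivAt.fun_sum h).congr_deriv ?_
  simp

/-- First moment of a linear function under an exponentially tilted Gaussian vector. -/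
lemma integral_linear_mul_exp (u m : ι → ℝ) :
    ∫ g, (∑ i, u i * g i) * Real.exp (∑ i, m i * g i) ∂gaussianPi ι
      = (∑ i, u i * m i) * Real.exp ((∑ i, m i ^ 2) / 2) := by
  classical
  have hI : ∀ e : ι, Integrable (fun g : ι → ℝ => g e * Real.exp (∑ i, m i * g i))
      (gaussianPi ι) := fun e => by
    simpa [Pi.single_apply] using integrable_linear_mul_exp (Pi.single e 1) m
  have h1 : ∀ e : ι, ∫ g, g e * Real.exp (∑ i, m i * g i) ∂gaussianPi ι
      = m e * Real.exp ((∑ i, m i ^ 2) / 2) := by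
    intro e
    rw [integral_mul_gaussianPi (F' := fun g => m e * Real.exp (∑ i, m i * g i)) e (fun x => ?_)
      (integrable_exp_linear m) ((integrable_exp_linear m).const_mul _) (hI e),
      integral_const_mul, integral_exp_linear]
    refine (hasDerivAt_linear_update m x e).exp.congr_deriv ?_
    rw [Function.update_eq_self, mul_comm]
  simp only [Finset.sum_mul, mul_assoc]
  rw [integral_finsetSum _ fun e _ => (hI e).const_mul _]
  simp only [integral_const_mul, h1]

/-- Second moment of linear functions under an exponentially tilted Gaussian vector. -/
lemma integral_linear_mul_linear_mul_exp (u v m : ι → ℝ) :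
    ∫ g, (∑ i, u i * g i) * ((∑ i, v i * g i) * Real.exp (∑ i, m i * g i)) ∂gaussianPi ι
      = (∑ i, u i * v i + (∑ i, u i * m i) * (∑ i, v i * m i))
          * Real.exp ((∑ i, m i ^ 2) / 2) := by
  classical
  have hI : ∀ e : ι, Integrable (fun g : ι → ℝ =>
      g e * ((∑ i, v i * g i) * Real.exp (∑ i, m i * g i))) (gaussianPi ι) := fun e => by
    simpa [Pi.single_apply] using integrable_linear_mul_linear_mul_exp (Pi.single e 1) v m
  have h1 : ∀ e : ι, ∫ g, g e * ((∑ i, v i * g i) * Real.exp (∑ i, m i * g i)) ∂gaussianPi ι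
      = v e * Real.exp ((∑ i, m i ^ 2) / 2)
        + m e * ((∑ i, v i * m i) * Real.exp ((∑ i, m i ^ 2) / 2)) := by
    intro e
    have i1 := (integrable_exp_linear m).const_mul (v e)
    have i2 := (integrable_linear_mul_exp v m).const_mul (m e)
    rw [integral_mul_gaussianPi (F' := fun g => v e * Real.exp (∑ i, m i * g i)
      + m e * ((∑ i, v i * g i) * Real.exp (∑ i, m i * g i))) e (fun x => ?_)
      (integrable_linear_mul_exp v m) (i1.add i2) (hI e), integral_add i1 i2,
      integral_const_mul, integral_const_mul, integral_exp_linear, integral_linear_mul_exp]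
    refine ((hasDerivAt_linear_update v x e).mul
      (hasDerivAt_linear_update m x e).exp).congr_deriv ?_
    rw [Function.update_eq_self]
    ring
  have h2 : ∀ g : ι → ℝ,
      (∑ i, u i * g i) * ((∑ i, v i * g i) * Real.exp (∑ i, m i * g i))
        = ∑ e, u e * (g e * ((∑ i, v i * g i) * Real.exp (∑ i, m i * g i))) := fun g => by
    rw [Finset.sum_mul]
    exact Finset.sum_congr rfl fun e _ => mul_assoc _ _ _
  simp only [h2]
  rw [integral_finsetSum _ fun e _ => (hI e).const_mul _]
  simp only [integral_const_mul, h1]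
  generalize (∑ i, v i * m i) = c
  rw [add_mul, mul_assoc, Finset.sum_mul, Finset.sum_mul, ← Finset.sum_add_distrib]
  exact Finset.sum_congr rfl fun e _ => by ring

lemma integrable_eval (e : ι) : Integrable (fun g : ι → ℝ => g e) (gaussianPi ι) :=
  integrable_comp_eval (f := fun x => x)
    (memLp_id_gaussianReal (μ := 0) (v := 1) 1 |>.integrable (by simp))

/-! ### Gaussian interpolation of free energies -/

section Interpolation

variable {α ι : Type*} [Fintype ι]

/-- The energy `∑ i, c a i * g i + k a`, a Gaussian process indexed by `a` plus a deterministic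
term. -/
def gaussEnergy (c : α → ι → ℝ) (k : α → ℝ) (g : ι → ℝ) (a : α) : ℝ := ∑ i, c a i * g i + k a

lemma continuous_gaussEnergy (c : α → ι → ℝ) (k : α → ℝ) (a : α) :
    Continuous fun g => gaussEnergy c k g a := by
  unfold gaussEnergy
  exact (continuous_linear _).add continuous_const

lemma integrable_gaussEnergy (c : α → ι → ℝ) (k : α → ℝ) (a : α) :
    Integrable (fun g => gaussEnergy c k g a) (gaussianPi ι) :=
  (integrable_finsetSum _ fun i _ => (integrable_eval i).const_mul _).add (integrable_const _)

/-- The integrand of the derivative of a free energy along a path of Gaussian energies `(c, k)`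
with velocity `(c', k')`, after integration by parts. -/
def interpIntegrand [Fintype α] (c c' : α → ι → ℝ) (k k' : α → ℝ) (g : ι → ℝ) : ℝ :=
  gibbs (gaussEnergy c k g) k' +
    ∑ i, (gibbs (gaussEnergy c k g) (fun a => c' a i * c a i)
      - gibbs (gaussEnergy c k g) (fun a => c' a i) * gibbs (gaussEnergy c k g) (fun a => c a i))

/-- In terms of two replicas, the integrand compares the covariance on the diagonal with the
covariance between the replicas. -/
lemma interpIntegrand_eq [Fintype α] (c c' : α → ι → ℝ) (k k' : α → ℝ) (g : ι → ℝ) :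
    interpIntegrand c c' k k' g
      = gibbs (gaussEnergy c k g) (fun a => k' a + ∑ i, c' a i * c a i)
        - gibbs (pairEnergy (gaussEnergy c k g) (gaussEnergy c k g))
            (fun x => ∑ i, c' x.1 i * c x.2 i) := by
  unfold interpIntegrand
  rw [gibbs_add, gibbs_sum, gibbs_sum, Finset.sum_sub_distrib, ← add_sub_assoc]
  congr 1
  refine Finset.sum_congr rfl fun i _ => ?_
  rw [← gibbs_pair_mul]

variable [Fintype α]

/-- The free energy `E log ∑ exp H` of a Gaussian energy. -/
def freeEnergy (c : α → ι → ℝ) (k : α → ℝ) : ℝ :=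
  ∫ g, Real.log (∑ a, Real.exp (gaussEnergy c k g a)) ∂gaussianPi ι

variable [Nonempty α]

lemma abs_gibbs_le_sum (H f : α → ℝ) : |gibbs H f| ≤ ∑ a, |f a| :=
  abs_gibbs_le H fun a => Finset.single_le_sum (f := fun a => |f a|) (fun _ _ => abs_nonneg _)
    (Finset.mem_univ a)

lemma integrable_of_continuous_of_bounded {X : Type*} [TopologicalSpace X] [MeasurableSpace X]
    [OpensMeasurableSpace X] {μ : Measure X} [IsFiniteMeasure μ] {F : X → ℝ} (hF : Continuous F)
    (C : ℝ) (h : ∀ x, |F x| ≤ C) : Integrable F μ :=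
  Integrable.of_bound (hF.measurable.aestronglyMeasurable) C (Filter.Eventually.of_forall h)

lemma continuous_gibbs_gaussEnergy (c : α → ι → ℝ) (k f : α → ℝ) :
    Continuous fun g => gibbs (gaussEnergy c k g) f :=
  continuous_gibbs (f := fun _ => f) (continuous_gaussEnergy c k) fun _ => continuous_const

lemma integrable_gibbs (c : α → ι → ℝ) (k f : α → ℝ) :
    Integrable (fun g => gibbs (gaussEnergy c k g) f) (gaussianPi ι) :=
  integrable_of_continuous_of_bounded
    (continuous_gibbs_gaussEnergy c k f) _
    fun g => abs_gibbs_le_sum (gaussEnergy c k g) f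

lemma integrable_gibbs_mul_gibbs (c : α → ι → ℝ) (k f f' : α → ℝ) :
    Integrable (fun g => gibbs (gaussEnergy c k g) f * gibbs (gaussEnergy c k g) f')
      (gaussianPi ι) := by
  refine integrable_of_continuous_of_bounded
    ((continuous_gibbs_gaussEnergy c k f).mul (continuous_gibbs_gaussEnergy c k f'))
    ((∑ a, |f a|) * ∑ a, |f' a|) fun g => ?_
  rw [abs_mul]
  gcongr
  · exact abs_gibbs_le_sum (gaussEnergy c k g) f
  · exact abs_gibbs_le_sum (gaussEnergy c k g) f'

lemma integrable_eval_mul_gibbs (c : α → ι → ℝ) (k f : α → ℝ) (i : ι) :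
    Integrable (fun g => g i * gibbs (gaussEnergy c k g) f) (gaussianPi ι) :=
  (integrable_eval i).mul_bdd (c := ∑ a, |f a|)
    (continuous_gibbs_gaussEnergy c k f).measurable.aestronglyMeasurable
    (Filter.Eventually.of_forall fun g => abs_gibbs_le_sum (gaussEnergy c k g) f)

lemma continuous_log_sum_exp (c : α → ι → ℝ) (k : α → ℝ) :
    Continuous fun g => Real.log (∑ a, Real.exp (gaussEnergy c k g a)) :=
  (continuous_finsetSum _ fun a _ => (continuous_gaussEnergy c k a).rexp).log
    fun g => (sum_exp_pos (gaussEnergy c k g)).ne'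

lemma abs_log_sum_exp_le (H : α → ℝ) :
    |Real.log (∑ a, Real.exp (H a))| ≤ Real.log (Fintype.card α) + ∑ a, |H a| := by
  have hcard : (1 : ℝ) ≤ Fintype.card α := by exact_mod_cast Fintype.card_pos
  have hle : ∀ a, |H a| ≤ ∑ a, |H a| := fun a =>
    Finset.single_le_sum (f := fun a => |H a|) (fun _ _ => abs_nonneg _) (Finset.mem_univ a)
  rw [abs_le]
  constructor
  · obtain ⟨a⟩ := ‹Nonempty α›
    have h1 : Real.exp (H a) ≤ ∑ a, Real.exp (H a) :=
      Finset.single_le_sum (f := fun a => Real.exp (H a)) (fun _ _ => (Real.exp_pos _).le)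
        (Finset.mem_univ a)
    have h2 := Real.log_le_log (Real.exp_pos _) h1
    rw [Real.log_exp] at h2
    have h3 := Real.log_nonneg hcard
    have h4 := neg_abs_le (H a)
    have h5 := hle a
    linarith
  · rw [← Real.log_exp (∑ a, |H a|), ← Real.log_mul (by positivity) (Real.exp_pos _).ne']
    refine Real.log_le_log (sum_exp_pos H) ?_
    rw [← nsmul_eq_mul]
    refine Finset.sum_le_card_nsmul _ _ _ fun a _ => ?_
    exact Real.exp_le_exp.2 ((le_abs_self _).trans (hle a))

lemma integrable_log_sum_exp (c : α → ι → ℝ) (k : α → ℝ) :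
    Integrable (fun g => Real.log (∑ a, Real.exp (gaussEnergy c k g a))) (gaussianPi ι) :=
  Integrable.mono' ((integrable_const (Real.log (Fintype.card α))).add
    (integrable_finsetSum Finset.univ fun a _ => (integrable_gaussEnergy c k a).abs))
    (continuous_log_sum_exp c k).measurable.aestronglyMeasurable
    (Filter.Eventually.of_forall fun _ => abs_log_sum_exp_le _)

/-- Integration by parts for a Gibbs average. -/
lemma integral_eval_mul_gibbs (c : α → ι → ℝ) (k f : α → ℝ) (i : ι) :
    ∫ g, g i * gibbs (gaussEnergy c k g) f ∂gaussianPi ι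
      = ∫ g, (gibbs (gaussEnergy c k g) (fun a => f a * c a i)
          - gibbs (gaussEnergy c k g) f * gibbs (gaussEnergy c k g) (fun a => c a i))
          ∂gaussianPi ι := by
  classical
  refine integral_mul_gaussianPi i (fun x => ?_) (integrable_gibbs c k f)
    ((integrable_gibbs c k _).sub (integrable_gibbs_mul_gibbs c k f _))
    (integrable_eval_mul_gibbs c k f i)
  have h := hasDerivAt_gibbs (H := fun t => gaussEnergy c k (Function.update x i t))
    (H' := fun a => c a i) (s := x i) f
    (fun a => by
      unfold gaussEnergy
      exact (hasDerivAt_linear_update (c a) x i).add_const _)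
  simpa only [Function.update_eq_self] using h

lemma integrable_interpIntegrand (c c' : α → ι → ℝ) (k k' : α → ℝ) :
    Integrable (interpIntegrand c c' k k') (gaussianPi ι) :=
  (integrable_gibbs c k k').add (integrable_finsetSum _ fun _ _ =>
    (integrable_gibbs c k _).sub (integrable_gibbs_mul_gibbs c k _ _))

/-- The derivative of a free energy along a path of Gaussian energies. -/
lemma hasDerivAt_freeEnergy {c c' : ℝ → α → ι → ℝ} {k k' : ℝ → α → ℝ} {A : ℝ}
    (hc : ∀ s a i, HasDerivAt (fun t => c t a i) (c' s a i) s)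
    (hk : ∀ s a, HasDerivAt (fun t => k t a) (k' s a) s)
    (hA : ∀ s a i, |c' s a i| ≤ A) (hA' : ∀ s a, |k' s a| ≤ A) (s : ℝ) :
    HasDerivAt (fun t => freeEnergy (c t) (k t))
      (∫ g, interpIntegrand (c s) (c' s) (k s) (k' s) g ∂gaussianPi ι) s := by
  have hE : ∀ g s a, HasDerivAt (fun t => gaussEnergy (c t) (k t) g a)
      (gaussEnergy (c' s) (k' s) g a) s := fun g s a => by
    unfold gaussEnergy
    exact (HasDerivAt.fun_sum fun i _ => (hc s a i).mul_const (g i)).add (hk s a)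
  have main := hasDerivAt_integral_of_dominated_loc_of_deriv_le (μ := gaussianPi ι)
    (F := fun t g => Real.log (∑ a, Real.exp (gaussEnergy (c t) (k t) g a)))
    (F' := fun t g => gibbs (gaussEnergy (c t) (k t) g) (gaussEnergy (c' t) (k' t) g))
    (bound := fun g => ∑ i, A * |g i| + A) (x₀ := s) (s := Set.univ) Filter.univ_mem
    (Filter.Eventually.of_forall fun t =>
      (continuous_log_sum_exp (c t) (k t)).measurable.aestronglyMeasurable)
    (integrable_log_sum_exp _ _)
    (continuous_gibbs (continuous_gaussEnergy (c s) (k s))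
      (continuous_gaussEnergy (c' s) (k' s))).measurable.aestronglyMeasurable
    (Filter.Eventually.of_forall fun g t _ => by
      refine abs_gibbs_le _ fun a => ?_
      unfold gaussEnergy
      refine (abs_add_le _ _).trans (add_le_add ?_ (hA' t a))
      refine (Finset.abs_sum_le_sum_abs _ _).trans (Finset.sum_le_sum fun i _ => ?_)
      rw [abs_mul]
      gcongr
      exact hA t a i)
    ((integrable_finsetSum _ fun i _ => (integrable_eval i).abs.const_mul A).add
      (integrable_const A))
    (Filter.Eventually.of_forall fun g t _ => hasDerivAt_log_sum_exp (hE g t))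
  refine main.2.congr_deriv ?_
  have hsplit : ∀ g : ι → ℝ,
      gibbs (gaussEnergy (c s) (k s) g) (gaussEnergy (c' s) (k' s) g)
        = gibbs (gaussEnergy (c s) (k s) g) (k' s)
          + ∑ i, g i * gibbs (gaussEnergy (c s) (k s) g) (fun a => c' s a i) := by
    intro g
    have : gaussEnergy (c' s) (k' s) g = fun a => ∑ i, g i * c' s a i + k' s a := by
      funext a; simp only [gaussEnergy, mul_comm]
    rw [this, gibbs_add, gibbs_sum, add_comm]
    simp only [gibbs_const_mul]
  simp only [hsplit, interpIntegrand]
  have hd : ∀ i, Integrable (fun g =>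
      gibbs (gaussEnergy (c s) (k s) g) (fun a => c' s a i * c s a i)
      - gibbs (gaussEnergy (c s) (k s) g) (fun a => c' s a i)
        * gibbs (gaussEnergy (c s) (k s) g) (fun a => c s a i)) (gaussianPi ι) := fun i =>
    (integrable_gibbs _ _ _).sub (integrable_gibbs_mul_gibbs _ _ _ _)
  rw [integral_add (integrable_gibbs _ _ _)
      (integrable_finsetSum _ fun i _ => integrable_eval_mul_gibbs _ _ _ i),
    integral_add (integrable_gibbs _ _ _) (integrable_finsetSum _ fun i _ => hd i),
    integral_finsetSum _ fun i _ => integrable_eval_mul_gibbs _ _ _ i,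
    integral_finsetSum _ fun i _ => hd i]
  simp only [integral_eval_mul_gibbs]

end Interpolation

/-! ### A single spin -/

section SingleSpin

variable {S : ℕ}

/-- The value of a single spin as a real number. -/
def spinVal (s : Spin S) : ℝ := ((s : ℤ) : ℝ)

instance : Nonempty (Spin S) := ⟨⟨0, by simp⟩⟩

lemma abs_spinVal_le (s : Spin S) : |spinVal s| ≤ S := by
  obtain ⟨s, hs⟩ := s
  rw [Finset.mem_Icc] at hs
  rw [spinVal, abs_le]
  exact ⟨by exact_mod_cast hs.1, by exact_mod_cast hs.2⟩

/-- The energy `x s² + y s` of a single spin. -/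
def siteEnergy (x y : ℝ) (s : Spin S) : ℝ := x * spinVal s ^ 2 + y * spinVal s

lemma sum_Icc_neg_eq (G : ℤ → ℝ) (S : ℕ) :
    ∑ s ∈ Finset.Icc (-(S : ℤ)) S, G s = G 0 + ∑ γ ∈ Finset.Icc 1 S, (G γ + G (-γ)) := by
  induction S with
  | zero => simp
  | succ S ih =>
    have : Finset.Icc (-((S + 1 : ℕ) : ℤ)) ((S + 1 : ℕ) : ℤ)
        = insert ((S + 1 : ℕ) : ℤ) (insert (-((S + 1 : ℕ) : ℤ)) (Finset.Icc (-(S : ℤ)) S)) := by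
      ext s
      simp only [Finset.mem_Icc, Finset.mem_insert]
      push_cast
      omega
    rw [this, Finset.sum_insert, Finset.sum_insert, ih, Finset.sum_Icc_succ_top (by omega)]
    · ring
    · simp only [Finset.mem_Icc]; push_cast; omega
    · simp only [Finset.mem_insert, Finset.mem_Icc]; push_cast; omega

lemma sum_spin (G : ℝ → ℝ) :
    ∑ s : Spin S, G (spinVal s)
      = G 0 + ∑ γ ∈ Finset.Icc 1 S, (G γ + G (-γ)) := by
  have h := sum_Icc_neg_eq (fun s => G (s : ℝ)) S
  have h2 := Finset.sum_coe_sort (Finset.Icc (-(S : ℤ)) (S : ℤ)) (fun s : ℤ => G (s : ℝ))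
  push_cast at h
  rw [← h, ← h2]
  rfl

lemma sum_exp_siteEnergy (x y : ℝ) :
    ∑ s : Spin S, Real.exp (siteEnergy x y s) = denom S x y := by
  have := sum_spin (S := S) (fun s => Real.exp (x * s ^ 2 + y * s))
  unfold siteEnergy
  rw [this, denom]
  simp only [ne_eq, OfNat.ofNat_ne_zero, not_false_eq_true, zero_pow, mul_zero, add_zero,
    Real.exp_zero]
  congr 1
  refine Finset.sum_congr rfl fun γ _ => ?_
  rw [Real.cosh_eq, neg_sq, Real.exp_add, Real.exp_add]
  ring_nf

/-- `shRatio` is the mean of a single spin. -/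
lemma shRatio_eq_gibbs (x y : ℝ) : shRatio S x y = gibbs (siteEnergy (S := S) x y) spinVal := by
  rw [gibbs, sum_exp_siteEnergy, shRatio]
  congr 1
  have := sum_spin (S := S) (fun s => s * Real.exp (x * s ^ 2 + y * s))
  unfold siteEnergy
  rw [this, zero_mul, zero_add]
  refine Finset.sum_congr rfl fun γ _ => ?_
  rw [Real.sinh_eq, neg_sq, Real.exp_add, Real.exp_add]
  ring_nf

/-- `chRatio` is the second moment of a single spin. -/
lemma chRatio_eq_gibbs (x y : ℝ) :
    chRatio S x y = gibbs (siteEnergy (S := S) x y) (fun s => spinVal s ^ 2) := by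
  rw [gibbs, sum_exp_siteEnergy, chRatio]
  congr 1
  have := sum_spin (S := S) (fun s => s ^ 2 * Real.exp (x * s ^ 2 + y * s))
  unfold siteEnergy
  rw [this, zero_pow two_ne_zero, zero_mul, zero_add]
  refine Finset.sum_congr rfl fun γ _ => ?_
  rw [Real.cosh_eq, neg_sq, Real.exp_add, Real.exp_add]
  ring_nf

/-- The moments of a single spin with energy `x s² + y s`. -/
def spinMoment (S k : ℕ) (x y : ℝ) : ℝ := gibbs (siteEnergy (S := S) x y) (fun s => spinVal s ^ k)

lemma shRatio_eq_spinMoment (x y : ℝ) : shRatio S x y = spinMoment S 1 x y := by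
  rw [shRatio_eq_gibbs, spinMoment]
  simp only [pow_one]

lemma chRatio_eq_spinMoment (x y : ℝ) : chRatio S x y = spinMoment S 2 x y := chRatio_eq_gibbs x y

lemma abs_spinMoment_le (k : ℕ) (x y : ℝ) : |spinMoment S k x y| ≤ (S : ℝ) ^ k := by
  refine abs_gibbs_le _ fun s => ?_
  rw [abs_pow]
  exact pow_le_pow_left₀ (abs_nonneg _) (abs_spinVal_le s) k

lemma continuous_spinMoment (k : ℕ) : Continuous fun z : ℝ × ℝ => spinMoment S k z.1 z.2 := by
  unfold spinMoment
  refine continuous_gibbs (fun s => ?_) fun s => continuous_const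
  unfold siteEnergy
  fun_prop

lemma hasDerivAt_spinMoment_left (k : ℕ) (x y : ℝ) :
    HasDerivAt (fun x => spinMoment S k x y)
      (spinMoment S (k + 2) x y - spinMoment S k x y * spinMoment S 2 x y) x := by
  have := hasDerivAt_gibbs (H := fun x => siteEnergy (S := S) x y)
    (H' := fun s => spinVal s ^ 2) (s := x) (fun s => spinVal s ^ k)
    (fun s => by
      unfold siteEnergy
      simpa using ((hasDerivAt_id' x).mul_const (spinVal s ^ 2)).add_const (y * spinVal s))
  simpa only [spinMoment, pow_add] using this

lemma hasDerivAt_spinMoment_right (k : ℕ) (x y : ℝ) :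
    HasDerivAt (fun y => spinMoment S k x y)
      (spinMoment S (k + 1) x y - spinMoment S k x y * spinMoment S 1 x y) y := by
  have := hasDerivAt_gibbs (H := fun y => siteEnergy (S := S) x y)
    (H' := fun s => spinVal s) (s := y) (fun s => spinVal s ^ k)
    (fun s => by
      unfold siteEnergy
      simpa using ((hasDerivAt_id' y).mul_const (spinVal s)).const_add (x * spinVal s ^ 2))
  simpa only [spinMoment, pow_succ, pow_zero, one_mul] using this

lemma abs_sub_le_of_hasDerivAt {f f' : ℝ → ℝ} {C : ℝ} (hf : ∀ x, HasDerivAt f (f' x) x)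
    (hC : ∀ x, |f' x| ≤ C) (x y : ℝ) : |f y - f x| ≤ C * |y - x| :=
  Convex.norm_image_sub_le_of_norm_hasDerivWithin_le (s := Set.univ)
    (fun x _ => (hf x).hasDerivWithinAt) (fun x _ => hC x) convex_univ (Set.mem_univ x)
    (Set.mem_univ y)

lemma abs_shRatio_sub_le (x y y' : ℝ) :
    |shRatio S x y' - shRatio S x y| ≤ 2 * (S : ℝ) ^ 2 * |y' - y| := by
  simp only [shRatio_eq_spinMoment]
  refine abs_sub_le_of_hasDerivAt (hasDerivAt_spinMoment_right 1 x) (fun y => ?_) y y'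
  have h1 := abs_spinMoment_le (S := S) 1 x y
  have h2 := abs_spinMoment_le (S := S) 2 x y
  calc _ ≤ _ := abs_sub _ _
    _ ≤ (S : ℝ) ^ 2 + (S : ℝ) ^ 1 * (S : ℝ) ^ 1 := by rw [abs_mul]; gcongr
    _ = _ := by ring

lemma abs_chRatio_sub_le (x y y' : ℝ) :
    |chRatio S x y' - chRatio S x y| ≤ 2 * (S : ℝ) ^ 3 * |y' - y| := by
  simp only [chRatio_eq_spinMoment]
  refine abs_sub_le_of_hasDerivAt (hasDerivAt_spinMoment_right 2 x) (fun y => ?_) y y'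
  have h1 := abs_spinMoment_le (S := S) 1 x y
  have h2 := abs_spinMoment_le (S := S) 2 x y
  have h3 := abs_spinMoment_le (S := S) 3 x y
  calc _ ≤ _ := abs_sub _ _
    _ ≤ (S : ℝ) ^ 3 + (S : ℝ) ^ 2 * (S : ℝ) ^ 1 := by rw [abs_mul]; gcongr
    _ = _ := by ring

lemma abs_shRatio_le (x y : ℝ) : |shRatio S x y| ≤ S := by
  rw [shRatio_eq_spinMoment]
  simpa using abs_spinMoment_le (S := S) 1 x y

lemma abs_chRatio_le (x y : ℝ) : |chRatio S x y| ≤ (S : ℝ) ^ 2 := by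
  rw [chRatio_eq_spinMoment]
  exact abs_spinMoment_le (S := S) 2 x y

lemma continuous_shRatio : Continuous fun z : ℝ × ℝ => shRatio S z.1 z.2 := by
  simp only [shRatio_eq_spinMoment]
  exact continuous_spinMoment 1

lemma continuous_chRatio : Continuous fun z : ℝ × ℝ => chRatio S z.1 z.2 := by
  simp only [chRatio_eq_spinMoment]
  exact continuous_spinMoment 2

/-! ### Gaussian averages and the fixed point -/

/-- A function of two variables that is bounded and Lipschitz in the first, and has a bounded
second derivative in the second. -/
structure SmoothBound (L : ℝ) (F : ℝ → ℝ → ℝ) : Prop where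
  cont : Continuous fun z : ℝ × ℝ => F z.1 z.2
  bdd : ∀ x y, |F x y| ≤ L
  lip : ∀ x x' y, |F x' y - F x y| ≤ L * |x' - x|
  taylor : ∀ x y, ∃ d : ℝ, ∀ v, |F x (y + v) - F x y - d * v| ≤ L * v ^ 2

lemma taylor_of_hasDerivAt {f f' f'' : ℝ → ℝ} {C : ℝ} (hf : ∀ x, HasDerivAt f (f' x) x)
    (hf' : ∀ x, HasDerivAt f' (f'' x) x) (hC : ∀ x, |f'' x| ≤ C) (x v : ℝ) :
    |f (x + v) - f x - f' x * v| ≤ C * v ^ 2 := by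
  have hC0 : 0 ≤ C := (abs_nonneg _).trans (hC 0)
  have h := Convex.norm_image_sub_le_of_norm_hasDerivWithin_le (s := Set.uIcc x (x + v))
    (f := fun t => f t - f' x * t) (f' := fun t => f' t - f' x) (C := C * |v|)
    (x := x) (y := x + v)
    (fun t _ => ((hf t).sub (by simpa using (hasDerivAt_id' t).const_mul (f' x))).hasDerivWithinAt)
    (fun t ht => by
      refine (abs_sub_le_of_hasDerivAt hf' hC x t).trans ?_
      refine mul_le_mul_of_nonneg_left ?_ hC0
      have := Set.abs_sub_left_of_mem_uIcc ht
      simpa using this)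
    (convex_uIcc _ _) Set.left_mem_uIcc Set.right_mem_uIcc
  simp only [Real.norm_eq_abs, add_sub_cancel_left] at h
  calc |f (x + v) - f x - f' x * v| = |f (x + v) - f' x * (x + v) - (f x - f' x * x)| := by
        congr 1; ring
    _ ≤ C * |v| * |v| := h
    _ = C * v ^ 2 := by rw [mul_assoc, abs_mul_abs_self, sq]

lemma smoothBound_chRatio (hS : 1 ≤ S) : SmoothBound (20 * (S : ℝ) ^ 4) (chRatio S) := by
  have hS' : (1 : ℝ) ≤ S := by exact_mod_cast hS
  refine ⟨continuous_chRatio, fun x y => ?_, fun x x' y => ?_, fun x y => ?_⟩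
  · refine (abs_chRatio_le x y).trans ?_
    have := pow_le_pow_right₀ hS' (show 2 ≤ 4 by norm_num)
    have : 0 ≤ (S : ℝ) ^ 4 := by positivity
    linarith
  · simp only [chRatio_eq_spinMoment]
    refine abs_sub_le_of_hasDerivAt (fun x => hasDerivAt_spinMoment_left 2 x y) (fun x => ?_) x x'
    have h2 := abs_spinMoment_le (S := S) 2 x y
    have h4 := abs_spinMoment_le (S := S) 4 x y
    calc _ ≤ _ := abs_sub _ _
      _ ≤ (S : ℝ) ^ 4 + (S : ℝ) ^ 2 * (S : ℝ) ^ 2 := by rw [abs_mul]; gcongr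
      _ ≤ _ := by nlinarith [pow_pos (zero_lt_one.trans_le hS') 4]
  · simp only [chRatio_eq_spinMoment]
    refine ⟨_, taylor_of_hasDerivAt (hasDerivAt_spinMoment_right 2 x)
      (fun y => (hasDerivAt_spinMoment_right 3 x y).sub
        ((hasDerivAt_spinMoment_right 2 x y).mul (hasDerivAt_spinMoment_right 1 x y)))
      (fun y => ?_) y⟩
    have h1 := abs_spinMoment_le (S := S) 1 x y
    have h2 := abs_spinMoment_le (S := S) 2 x y
    have h3 := abs_spinMoment_le (S := S) 3 x y
    have h4 := abs_spinMoment_le (S := S) 4 x y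
    norm_num only at h1 h2 h3 h4 ⊢
    generalize spinMoment S 1 x y = m1 at *
    generalize spinMoment S 2 x y = m2 at *
    generalize spinMoment S 3 x y = m3 at *
    generalize spinMoment S 4 x y = m4 at *
    calc |m4 - m3 * m1 - ((m3 - m2 * m1) * m1 + m2 * (m2 - m1 * m1))|
        ≤ |m4| + |m3| * |m1| + ((|m3| + |m2| * |m1|) * |m1| + |m2| * (|m2| + |m1| * |m1|)) := by
          simp only [← abs_mul]
          refine (abs_sub _ _).trans (add_le_add (abs_sub _ _) ((abs_add_le _ _).trans ?_))
          rw [abs_mul _ m1, abs_mul m2 (_ - _)]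
          gcongr <;> exact abs_sub _ _
      _ ≤ (S : ℝ) ^ 4 + (S : ℝ) ^ 3 * (S : ℝ) ^ 1 + (((S : ℝ) ^ 3 + (S : ℝ) ^ 2 * (S : ℝ) ^ 1)
          * (S : ℝ) ^ 1 + (S : ℝ) ^ 2 * ((S : ℝ) ^ 2 + (S : ℝ) ^ 1 * (S : ℝ) ^ 1)) := by gcongr
      _ ≤ _ := by nlinarith [pow_pos (zero_lt_one.trans_le hS') 4]

lemma smoothBound_shRatio_sq (hS : 1 ≤ S) :
    SmoothBound (20 * (S : ℝ) ^ 4) (fun x y => shRatio S x y ^ 2) := by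
  have hS' : (1 : ℝ) ≤ S := by exact_mod_cast hS
  refine ⟨continuous_shRatio.pow 2, fun x y => ?_, fun x x' y => ?_, fun x y => ?_⟩
  · rw [abs_pow]
    refine (pow_le_pow_left₀ (abs_nonneg _) (abs_shRatio_le x y) 2).trans ?_
    have := pow_le_pow_right₀ hS' (show 2 ≤ 4 by norm_num)
    have : 0 ≤ (S : ℝ) ^ 4 := by positivity
    linarith
  · simp only [shRatio_eq_spinMoment]
    refine abs_sub_le_of_hasDerivAt (fun x => (hasDerivAt_spinMoment_left 1 x y).pow 2)
      (fun x => ?_) x x'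
    have h1 := abs_spinMoment_le (S := S) 1 x y
    have h2 := abs_spinMoment_le (S := S) 2 x y
    have h3 := abs_spinMoment_le (S := S) 3 x y
    norm_num only at h1 h2 h3 ⊢
    generalize spinMoment S 1 x y = m1 at *
    generalize spinMoment S 2 x y = m2 at *
    generalize spinMoment S 3 x y = m3 at *
    calc |2 * m1 ^ 1 * (m3 - m1 * m2)| ≤ 2 * |m1| * (|m3| + |m1| * |m2|) := by
          rw [abs_mul, pow_one, abs_mul, abs_two, ← abs_mul m1 m2]
          gcongr
          exact abs_sub _ _
      _ ≤ 2 * (S : ℝ) ^ 1 * ((S : ℝ) ^ 3 + (S : ℝ) ^ 1 * (S : ℝ) ^ 2) := by gcongr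
      _ ≤ _ := by nlinarith [pow_pos (zero_lt_one.trans_le hS') 4]
  · simp only [shRatio_eq_spinMoment]
    have hd : ∀ y, HasDerivAt (fun y => spinMoment S 1 x y ^ 2)
        (2 * spinMoment S 1 x y * (spinMoment S 2 x y - spinMoment S 1 x y * spinMoment S 1 x y))
        y := fun y => by simpa using (hasDerivAt_spinMoment_right 1 x y).fun_pow 2
    refine ⟨_, taylor_of_hasDerivAt hd
      (fun y => ((hasDerivAt_spinMoment_right 1 x y).const_mul 2).mul
        ((hasDerivAt_spinMoment_right 2 x y).sub
        ((hasDerivAt_spinMoment_right 1 x y).mul (hasDerivAt_spinMoment_right 1 x y))))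
      (fun y => ?_) y⟩
    have h1 := abs_spinMoment_le (S := S) 1 x y
    have h2 := abs_spinMoment_le (S := S) 2 x y
    have h3 := abs_spinMoment_le (S := S) 3 x y
    norm_num only at h1 h2 h3 ⊢
    generalize spinMoment S 1 x y = m1 at *
    generalize spinMoment S 2 x y = m2 at *
    generalize spinMoment S 3 x y = m3 at *
    have ha : |m2 - m1 * m1| ≤ 2 * (S : ℝ) ^ 2 :=
      calc _ ≤ |m2| + |m1| * |m1| := by rw [← abs_mul]; exact abs_sub _ _
        _ ≤ (S : ℝ) ^ 2 + (S : ℝ) ^ 1 * (S : ℝ) ^ 1 := by gcongr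
        _ = _ := by ring
    have hb : |m3 - m2 * m1| ≤ 2 * (S : ℝ) ^ 3 :=
      calc _ ≤ |m3| + |m2| * |m1| := by rw [← abs_mul]; exact abs_sub _ _
        _ ≤ (S : ℝ) ^ 3 + (S : ℝ) ^ 2 * (S : ℝ) ^ 1 := by gcongr
        _ = _ := by ring
    generalize m2 - m1 * m1 = a at *
    generalize m3 - m2 * m1 = b at *
    calc |2 * a * a + 2 * m1 * (b - (a * m1 + m1 * a))|
        = |2 * (a * a) + 2 * (m1 * b) - 4 * (m1 * m1 * a)| := by congr 1; ring
      _ ≤ 2 * (|a| * |a|) + 2 * (|m1| * |b|) + 4 * (|m1| * |m1| * |a|) := by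
          refine (abs_sub _ _).trans (add_le_add ((abs_add_le _ _).trans (le_of_eq ?_))
            (le_of_eq ?_)) <;> simp only [abs_mul] <;> norm_num
      _ ≤ 2 * ((2 * (S : ℝ) ^ 2) * (2 * (S : ℝ) ^ 2)) + 2 * ((S : ℝ) ^ 1 * (2 * (S : ℝ) ^ 3))
          + 4 * ((S : ℝ) ^ 1 * (S : ℝ) ^ 1 * (2 * (S : ℝ) ^ 2)) := by gcongr
      _ ≤ _ := by nlinarith [pow_pos (zero_lt_one.trans_le hS') 4]

end SingleSpin

section FixedPoint

/-- The Gaussian average `E F(x, √q β X + h)`. -/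
def gaussAvg (F : ℝ → ℝ → ℝ) (β h x q : ℝ) : ℝ := ∫ X : ℝ, F x (√q * β * X + h) ∂stdGaussian

variable {L : ℝ} {F : ℝ → ℝ → ℝ}

lemma SmoothBound.nonneg (hF : SmoothBound L F) : 0 ≤ L := (abs_nonneg _).trans (hF.bdd 0 0)

lemma SmoothBound.integrable (hF : SmoothBound L F) {X : Type*} [TopologicalSpace X]
    [MeasurableSpace X] [OpensMeasurableSpace X] {μ : Measure X} [IsFiniteMeasure μ]
    {φ ψ : X → ℝ} (hφ : Continuous φ) (hψ : Continuous ψ) :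
    Integrable (fun z => F (φ z) (ψ z)) μ :=
  integrable_of_continuous_of_bounded (hF.cont.comp (hφ.prodMk hψ)) L fun _ => hF.bdd _ _

lemma abs_integral_sub_le {X : Type*} [MeasurableSpace X] {μ : Measure X} [IsProbabilityMeasure μ]
    {f g : X → ℝ} (hf : Integrable f μ) (hg : Integrable g μ) {C : ℝ} (h : ∀ x, |f x - g x| ≤ C) :
    |∫ x, f x ∂μ - ∫ x, g x ∂μ| ≤ C := by
  rw [← integral_sub hf hg]
  have := norm_integral_le_of_norm_le_const (μ := μ) (f := fun x => f x - g x)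
    (Filter.Eventually.of_forall h)
  simpa using this

lemma SmoothBound.gaussAvg_left (hF : SmoothBound L F) (β h x x' q : ℝ) :
    |gaussAvg F β h x' q - gaussAvg F β h x q| ≤ L * |x' - x| :=
  abs_integral_sub_le (hF.integrable continuous_const (by fun_prop))
    (hF.integrable continuous_const (by fun_prop)) fun _ => hF.lip _ _ _

lemma integral_sq_stdGaussian : ∫ x, x ^ 2 ∂stdGaussian = 1 := by
  have h := variance_fun_id_gaussianReal (μ := 0) (v := 1)
  rw [variance_eq_integral (by fun_prop)] at h
  simpa using h

lemma integrable_sq_stdGaussian : Integrable (fun x : ℝ => x ^ 2) stdGaussian :=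
  (memLp_id_gaussianReal (μ := 0) (v := 1) 2).integrable_sq

lemma integrable_id_stdGaussian : Integrable (fun x : ℝ => x) stdGaussian :=
  (memLp_id_gaussianReal (μ := 0) (v := 1) 1).integrable (by simp)

/-- Averaging over a centred Gaussian perturbation kills the first order term. -/
lemma SmoothBound.integral_add_mul (hF : SmoothBound L F) (x y v : ℝ) :
    |∫ X, F x (y + v * X) ∂stdGaussian - F x y| ≤ L * v ^ 2 := by
  obtain ⟨d, hd⟩ := hF.taylor x y
  have i1 : Integrable (fun X => F x (y + v * X)) stdGaussian :=
    hF.integrable continuous_const (by fun_prop)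
  have i2 : Integrable (fun X : ℝ => d * (v * X)) stdGaussian :=
    (integrable_id_stdGaussian.const_mul v).const_mul d
  have i3 : Integrable (fun X : ℝ => L * (v * X) ^ 2) stdGaussian := by
    simp only [mul_pow]
    exact (integrable_sq_stdGaussian.const_mul _).const_mul _
  have e1 : ∫ X, (F x (y + v * X) - F x y - d * (v * X)) ∂stdGaussian
      = ∫ X, F x (y + v * X) ∂stdGaussian - F x y := by
    have i4 : Integrable (fun X => F x (y + v * X) - F x y) stdGaussian :=
      i1.sub (integrable_const _)
    rw [integral_sub i4 i2, integral_sub i1 (integrable_const _),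
      integral_const_mul, integral_const_mul, integral_id_gaussianReal]
    simp
  have e2 : ∫ X : ℝ, L * (v * X) ^ 2 ∂stdGaussian = L * v ^ 2 := by
    simp only [mul_pow]
    rw [integral_const_mul, integral_const_mul, integral_sq_stdGaussian, mul_one]
  rw [← e1, ← e2]
  exact norm_integral_le_of_norm_le (f := fun X => F x (y + v * X) - F x y - d * (v * X)) i3
    (Filter.Eventually.of_forall fun X => hd (v * X))

/-- A centred Gaussian of variance `q'` is a sum of independent ones of variances `q`, `q' - q`. -/
lemma integral_gaussian_split {q q' : ℝ} (hq : 0 ≤ q) (hqq : q ≤ q') {f : ℝ → ℝ}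
    (hf : Continuous f) (C : ℝ) (hC : ∀ x, |f x| ≤ C) :
    ∫ X, f (√q' * X) ∂stdGaussian
      = ∫ X, ∫ Y, f (√q * X + √(q' - q) * Y) ∂stdGaussian ∂stdGaussian := by
  have hmap : ∀ r : ℝ, 0 ≤ r → stdGaussian.map (fun x => √r * x) = gaussianReal 0 r.toNNReal := by
    intro r hr
    rw [stdGaussian, gaussianReal_map_const_mul]
    congr 1
    · simp
    · ext; simp [Real.sq_sqrt hr, hr]
  have hconv : gaussianReal 0 q'.toNNReal
      = (stdGaussian.map (fun x => √q * x)) ∗ (stdGaussian.map (fun x => √(q' - q) * x)) := by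
    rw [hmap q hq, hmap _ (sub_nonneg.2 hqq), gaussianReal_conv_gaussianReal]
    congr 1
    · simp
    · rw [← Real.toNNReal_add hq (sub_nonneg.2 hqq), add_sub_cancel]
  have h1 : ∫ X, f (√q' * X) ∂stdGaussian = ∫ y, f y ∂gaussianReal 0 q'.toNNReal := by
    rw [← hmap q' (hq.trans hqq), integral_map (by fun_prop) hf.aestronglyMeasurable]
  have hm : Measurable fun p : ℝ × ℝ => p.1 + p.2 := by fun_prop
  rw [h1, hconv, Measure.conv,
    Measure.map_prod_map _ _ (by fun_prop : Measurable fun x : ℝ => √q * x)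
      (by fun_prop : Measurable fun x : ℝ => √(q' - q) * x),
    integral_map (by fun_prop) hf.aestronglyMeasurable,
    integral_map (by fun_prop) (by fun_prop)]
  rw [integral_prod]
  · rfl
  · exact integrable_of_continuous_of_bounded (by simp only [Prod.map]; fun_prop) C fun _ => hC _

/-- The Gaussian average depends in a Lipschitz way on the variance, although the square root does
not: the second derivative controls the change. -/
lemma SmoothBound.gaussAvg_right (hF : SmoothBound L F) (β h x : ℝ) {q q' : ℝ} (hq : 0 ≤ q)
    (hq' : 0 ≤ q') : |gaussAvg F β h x q' - gaussAvg F β h x q| ≤ L * β ^ 2 * |q' - q| := by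
  wlog hqq : q ≤ q' generalizing q q'
  · rw [abs_sub_comm, abs_sub_comm q' q]
    exact this hq' hq (le_of_not_ge hqq)
  have hc : Continuous fun z => F x (β * z + h) :=
    hF.cont.comp (continuous_const.prodMk (by fun_prop))
  have e : gaussAvg F β h x q' = ∫ X, ∫ Y, F x (√q * β * X + h + β * √(q' - q) * Y)
      ∂stdGaussian ∂stdGaussian := by
    have := integral_gaussian_split hq hqq hc L fun _ => hF.bdd _ _
    rw [gaussAvg]
    have e1 : ∀ X, √q' * β * X + h = β * (√q' * X) + h := fun X => by ring
    have e2 : ∀ X Y, √q * β * X + h + β * √(q' - q) * Y = β * (√q * X + √(q' - q) * Y) + h :=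
      fun X Y => by ring
    simp only [e1, e2]
    exact this
  rw [e, gaussAvg]
  refine abs_integral_sub_le ?_ (hF.integrable continuous_const (by fun_prop)) fun X => ?_
  · have : Integrable (fun z : ℝ × ℝ => F x (√q * β * z.1 + h + β * √(q' - q) * z.2))
        (stdGaussian.prod stdGaussian) := hF.integrable continuous_const (by fun_prop)
    exact this.integral_prod_left
  · refine (hF.integral_add_mul x _ (β * √(q' - q))).trans_eq ?_
    rw [mul_pow, Real.sq_sqrt (sub_nonneg.2 hqq), abs_of_nonneg (sub_nonneg.2 hqq), mul_assoc]

/-- The map whose fixed points are the solutions `(p, q)`, extended to negative `q`. -/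
def fixedPointMap (S : ℕ) (β D h : ℝ) (z : ℝ × ℝ) : ℝ × ℝ :=
  (gaussAvg (chRatio S) β h (shift β D z.1 (max z.2 0)) (max z.2 0),
    gaussAvg (fun x y => shRatio S x y ^ 2) β h (shift β D z.1 (max z.2 0)) (max z.2 0))

lemma isFixedPoint_iff (S : ℕ) (β D h : ℝ) (z : ℝ × ℝ) :
    IsFixedPoint S β D h z.1 z.2 ↔ Function.IsFixedPt (fixedPointMap S β D h) z := by
  have key : 0 ≤ z.2 →
      (IsFixedPoint S β D h z.1 z.2 ↔ Function.IsFixedPt (fixedPointMap S β D h) z) := by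
    intro hz
    simp only [IsFixedPoint, Function.IsFixedPt, fixedPointMap, gaussAvg, max_eq_left hz, hz,
      true_and, Prod.ext_iff]
    constructor <;> rintro ⟨h1, h2⟩ <;> exact ⟨h1.symm, h2.symm⟩
  constructor
  · intro hz
    exact (key hz.1).1 hz
  · intro hz
    refine (key ?_).2 hz
    have h2 : _ = z.2 := congrArg Prod.snd hz
    rw [← h2]
    exact integral_nonneg fun X => sq_nonneg _

lemma SmoothBound.gaussAvg_shift (hF : SmoothBound L F) (β D h : ℝ) (hβ : L * β ^ 2 ≤ 1 / 4)
    (z z' : ℝ × ℝ) :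
    |gaussAvg F β h (shift β D z'.1 (max z'.2 0)) (max z'.2 0)
      - gaussAvg F β h (shift β D z.1 (max z.2 0)) (max z.2 0)| ≤ 1 / 2 * dist z' z := by
  have h1 : |z'.1 - z.1| ≤ dist z' z := le_max_left _ _
  have h2 : |max z'.2 0 - max z.2 0| ≤ dist z' z :=
    (abs_max_sub_max_le_abs _ _ _).trans (le_max_right _ _)
  have hd : (0 : ℝ) ≤ dist z' z := dist_nonneg
  have a1 := hF.gaussAvg_left β h (shift β D z.1 (max z.2 0)) (shift β D z'.1 (max z'.2 0))
    (max z'.2 0)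
  have a2 := hF.gaussAvg_right β h (shift β D z.1 (max z.2 0)) (le_max_right z.2 0)
    (le_max_right z'.2 0)
  have a3 : |shift β D z'.1 (max z'.2 0) - shift β D z.1 (max z.2 0)| ≤ β ^ 2 * dist z' z := by
    have : shift β D z'.1 (max z'.2 0) - shift β D z.1 (max z.2 0)
        = β ^ 2 / 2 * ((z'.1 - z.1) - (max z'.2 0 - max z.2 0)) := by
      unfold shift; ring
    rw [this, abs_mul, abs_of_nonneg (by positivity : 0 ≤ β ^ 2 / 2)]
    have := abs_sub (z'.1 - z.1) (max z'.2 0 - max z.2 0)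
    calc _ ≤ β ^ 2 / 2 * (dist z' z + dist z' z) := by gcongr; linarith
      _ = _ := by ring
  have hL := hF.nonneg
  calc _ ≤ _ := abs_sub_le _ (gaussAvg F β h (shift β D z.1 (max z.2 0)) (max z'.2 0)) _
    _ ≤ L * (β ^ 2 * dist z' z) + L * β ^ 2 * dist z' z :=
        add_le_add (a1.trans (by gcongr)) (a2.trans (by gcongr))
    _ = 2 * (L * β ^ 2) * dist z' z := by ring
    _ ≤ 2 * (1 / 4) * dist z' z := by gcongr
    _ = _ := by ring

/-- For small `β` the system has exactly one solution, by contraction. -/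
lemma existsUnique_isFixedPoint {S : ℕ} (hS : 1 ≤ S) {β : ℝ} (hβ : 20 * (S : ℝ) ^ 4 * β ^ 2 ≤ 1 / 4)
    (D h : ℝ) : ∃! pq : ℝ × ℝ, IsFixedPoint S β D h pq.1 pq.2 := by
  have hc : ContractingWith (1 / 2) (fixedPointMap S β D h) := by
    refine ⟨by rw [← NNReal.coe_lt_coe]; norm_num, LipschitzWith.of_dist_le_mul fun z' z => ?_⟩
    refine max_le ?_ ?_
    · simpa [fixedPointMap, Real.dist_eq] using
        (smoothBound_chRatio hS).gaussAvg_shift β D h hβ z z'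
    · simpa [fixedPointMap, Real.dist_eq] using
        (smoothBound_shRatio_sq hS).gaussAvg_shift β D h hβ z z'
  simp only [isFixedPoint_iff]
  exact ⟨hc.fixedPoint, hc.fixedPoint_isFixedPt, fun z hz => hc.fixedPoint_unique hz⟩

lemma IsFixedPoint.abs_le {S : ℕ} {β D h p q : ℝ} (hpq : IsFixedPoint S β D h p q) :
    |p| ≤ (S : ℝ) ^ 2 ∧ |q| ≤ (S : ℝ) ^ 2 := by
  obtain ⟨-, hp, hq⟩ := hpq
  constructor
  · rw [hp]
    have := norm_integral_le_of_norm_le_const (μ := stdGaussian)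
      (f := fun X => chRatio S (shift β D p q) (√q * β * X + h))
      (Filter.Eventually.of_forall fun X => abs_chRatio_le _ _)
    simpa using this
  · rw [hq]
    have := norm_integral_le_of_norm_le_const (μ := stdGaussian)
      (f := fun X => shRatio S (shift β D p q) (√q * β * X + h) ^ 2)
      (C := (S : ℝ) ^ 2)
      (Filter.Eventually.of_forall fun X => by
        rw [Real.norm_eq_abs, abs_pow]
        exact pow_le_pow_left₀ (abs_nonneg _) (abs_shRatio_le _ _) 2)
    simpa using this

end FixedPoint

/-! ### Exponential moments for independent sites -/

section ExpMoment

/-- The chord bound behind Hoeffding's inequality. -/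
lemma exp_mul_le_cosh_add {x b : ℝ} (hb : 0 < b) (hx : |x| ≤ b) (u : ℝ) :
    Real.exp (u * x) ≤ Real.cosh (u * b) + x * (Real.sinh (u * b) / b) := by
  rw [abs_le] at hx
  have h := convexOn_exp.2 (Set.mem_univ (u * b)) (Set.mem_univ (-(u * b)))
    (div_nonneg (by linarith : 0 ≤ b + x) (by linarith : 0 ≤ 2 * b))
    (div_nonneg (by linarith : 0 ≤ b - x) (by linarith : 0 ≤ 2 * b))
    (by field_simp; ring)
  simp only [smul_eq_mul] at h
  rw [Real.cosh_eq, Real.sinh_eq]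
  calc Real.exp (u * x)
      = Real.exp ((b + x) / (2 * b) * (u * b) + (b - x) / (2 * b) * -(u * b)) := by
        congr 1; field_simp; ring
    _ ≤ _ := h
    _ = _ := by field_simp; ring

variable {A E ι : Type*} [Fintype A] [Nonempty A] [Fintype E] [Fintype ι] [DecidableEq ι]
  {e : ℝ → A → ℝ} {ψ : A → ℝ} {b : ℝ}

/-- Hoeffding's lemma for a centred observable of one site in a random field. -/
lemma integral_gibbs_exp_le (he : ∀ a, Continuous fun z => e z a) (hb : 0 < b)
    (hψ : ∀ a, |ψ a| ≤ b) (hc : ∫ z, gibbs (e z) ψ ∂stdGaussian = 0) (u : ℝ) :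
    ∫ z, gibbs (e z) (fun a => Real.exp (u * ψ a)) ∂stdGaussian
      ≤ Real.exp (u ^ 2 * b ^ 2 / 2) := by
  have hint : ∀ f : A → ℝ, Integrable (fun z => gibbs (e z) f) stdGaussian := fun f =>
    integrable_of_continuous_of_bounded (continuous_gibbs he fun _ => continuous_const) _
      fun z => abs_gibbs_le_sum (e z) f
  calc ∫ z, gibbs (e z) (fun a => Real.exp (u * ψ a)) ∂stdGaussian
      ≤ ∫ z, (Real.cosh (u * b) + gibbs (e z) ψ * (Real.sinh (u * b) / b)) ∂stdGaussian := by
        refine integral_mono (hint _) ((integrable_const _).add ((hint _).mul_const _)) fun z => ?_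
        have := gibbs_mono (e z) fun a => exp_mul_le_cosh_add hb (hψ a) u
        rwa [gibbs_add, gibbs_const, gibbs_mul_const] at this
    _ = Real.cosh (u * b) := by
        rw [integral_add (integrable_const _) ((hint _).mul_const _), integral_mul_const, hc]
        simp
    _ ≤ _ := by
        refine (Real.cosh_le_exp_half_sq _).trans_eq ?_
        rw [mul_pow]

/-- Independent centred sites: the Laplace transform of a sum is sub-Gaussian. -/
lemma integral_gibbs_exp_sum_le (he : ∀ a, Continuous fun z => e z a) (hb : 0 < b)
    (hψ : ∀ a, |ψ a| ≤ b) (hc : ∫ z, gibbs (e z) ψ ∂stdGaussian = 0) (u : ℝ) :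
    ∫ g, gibbs (fun σ : ι → A => ∑ i, e (g (Sum.inr i)) (σ i))
        (fun σ => Real.exp (u * ∑ i, ψ (σ i))) ∂gaussianPi (E ⊕ ι)
      ≤ Real.exp (u ^ 2 * b ^ 2 / 2 * Fintype.card ι) := by
  have h1 : ∀ g : E ⊕ ι → ℝ, gibbs (fun σ : ι → A => ∑ i, e (g (Sum.inr i)) (σ i))
      (fun σ => Real.exp (u * ∑ i, ψ (σ i)))
      = ∏ j, (Sum.elim (fun _ _ => 1) (fun _ z => gibbs (e z) (fun a => Real.exp (u * ψ a)))
          : E ⊕ ι → ℝ → ℝ) j (g j) := by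
    intro g
    rw [Fintype.prod_sum_type]
    simp only [Sum.elim_inl, Sum.elim_inr, Finset.prod_const_one, one_mul, Finset.mul_sum,
      Real.exp_sum]
    exact gibbs_pi (fun i a => e (g (Sum.inr i)) a) (fun _ a => Real.exp (u * ψ a))
  simp only [h1]
  rw [integral_fintype_prod_eq_prod, Fintype.prod_sum_type]
  simp only [Sum.elim_inl, Sum.elim_inr, integral_const, probReal_univ, smul_eq_mul, mul_one,
    Finset.prod_const_one, one_mul, Finset.prod_const, Finset.card_univ]
  rw [mul_comm _ (Fintype.card ι : ℝ), Real.exp_nat_mul]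
  exact pow_le_pow_left₀ (integral_nonneg fun z => gibbs_nonneg _ fun _ => (Real.exp_pos _).le)
    (integral_gibbs_exp_le he hb hψ hc u) _

lemma integral_exp_sq_div_four : Integrable (fun x : ℝ => Real.exp (x ^ 2 / 4)) stdGaussian ∧
    ∫ x, Real.exp (x ^ 2 / 4) ∂stdGaussian ≤ 2 := by
  have hpdf : ∀ x : ℝ, gaussianPDFReal 0 1 x * Real.exp (x ^ 2 / 4)
      = (√(2 * Real.pi))⁻¹ * Real.exp (-(1 / 4) * x ^ 2) := by
    intro x
    simp only [gaussianPDFReal, NNReal.coe_one, mul_one, sub_zero]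
    rw [mul_assoc, ← Real.exp_add]
    congr 2
    ring
  constructor
  · rw [stdGaussian, gaussianReal_of_var_ne_zero 0 one_ne_zero,
      integrable_withDensity_iff_integrable_smul' (measurable_gaussianPDF 0 1)
        (Filter.Eventually.of_forall fun _ => gaussianPDF_lt_top)]
    simp only [toReal_gaussianPDF, smul_eq_mul, hpdf]
    exact (integrable_exp_neg_mul_sq (by norm_num)).const_mul _
  · rw [stdGaussian, integral_gaussianReal_eq_integral_smul one_ne_zero]
    simp only [smul_eq_mul, hpdf]
    rw [integral_const_mul, integral_gaussian, inv_mul_eq_div,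
      div_le_iff₀ (Real.sqrt_pos.2 (by positivity)), Real.sqrt_le_left (by positivity), mul_pow,
      Real.sq_sqrt (by positivity)]
    have := Real.pi_pos
    rw [div_le_iff₀ (by norm_num)]
    linarith

/-- Independent centred sites: the square of a sum, divided by the number of sites, has a bounded
exponential moment. The square is linearized by `exp (a X²) = E exp (√(2a) G X)` with `G`
standard Gaussian. -/
lemma integral_gibbs_exp_sq_sum_le (he : ∀ a, Continuous fun z => e z a) (hb : 0 < b)
    (hψ : ∀ a, |ψ a| ≤ b) (hc : ∫ z, gibbs (e z) ψ ∂stdGaussian = 0) {a : ℝ} (ha : 0 ≤ a)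
    (hab : a * b ^ 2 * Fintype.card ι ≤ 1 / 4) :
    ∫ g, gibbs (fun σ : ι → A => ∑ i, e (g (Sum.inr i)) (σ i))
        (fun σ => Real.exp (a * (∑ i, ψ (σ i)) ^ 2)) ∂gaussianPi (E ⊕ ι) ≤ 2 := by
  set En : (E ⊕ ι → ℝ) → (ι → A) → ℝ := fun g σ => ∑ i, e (g (Sum.inr i)) (σ i) with hEn
  have hcE : ∀ σ, Continuous fun g => En g σ := fun σ =>
    continuous_finsetSum _ fun i _ => (he (σ i)).comp (continuous_apply _)
  have hsum : ∀ σ : ι → A, |∑ i, ψ (σ i)| ≤ b * Fintype.card ι := fun σ => by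
    calc |∑ i, ψ (σ i)| ≤ ∑ i, |ψ (σ i)| := Finset.abs_sum_le_sum_abs _ _
      _ ≤ ∑ _i : ι, b := Finset.sum_le_sum fun i _ => hψ _
      _ = _ := by simp [mul_comm]
  set w := √(2 * a) with hw
  have hw2 : w ^ 2 = 2 * a := Real.sq_sqrt (by positivity)
  set M := w * (b * Fintype.card ι) with hM
  have hM0 : 0 ≤ M := by positivity
  have hlin : ∀ g, gibbs (En g) (fun σ => Real.exp (a * (∑ i, ψ (σ i)) ^ 2))
      = ∫ G, gibbs (En g) (fun σ => Real.exp (w * G * ∑ i, ψ (σ i))) ∂stdGaussian := by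
    intro g
    have hI : ∀ σ : ι → A, Integrable (fun G => Real.exp (w * G * ∑ i, ψ (σ i))) stdGaussian :=
      fun σ => by
        have := integrable_exp_mul_gaussianReal (μ := 0) (v := 1) (w * ∑ i, ψ (σ i))
        simpa only [mul_right_comm] using this
    simp only [gibbs]
    rw [integral_div, integral_finsetSum _ fun σ _ => (hI σ).mul_const _]
    congr 1
    refine Finset.sum_congr rfl fun σ _ => ?_
    rw [integral_mul_const]
    congr 1
    have := integral_exp_mul_stdGaussian (w * ∑ i, ψ (σ i))
    have e1 : ∀ G, w * G * ∑ i, ψ (σ i) = w * (∑ i, ψ (σ i)) * G := fun G => by ring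
    simp only [e1]
    rw [this, mul_pow, hw2]
    congr 1; ring
  have hbound : ∀ g G, |gibbs (En g) (fun σ => Real.exp (w * G * ∑ i, ψ (σ i)))|
      ≤ Real.exp (M * G) + Real.exp (-M * G) := by
    intro g G
    refine abs_gibbs_le _ fun σ => ?_
    rw [Real.abs_exp]
    have h1 : w * G * ∑ i, ψ (σ i) ≤ |M * G| := by
      refine (le_abs_self _).trans ?_
      rw [mul_right_comm, abs_mul, abs_mul M, abs_of_nonneg hM0, abs_mul,
        abs_of_nonneg (Real.sqrt_nonneg _ : 0 ≤ w), hM]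
      gcongr
      exact hsum σ
    rcases abs_cases (M * G) with h | h
    · rw [h.1] at h1
      linarith [Real.exp_le_exp.2 h1, Real.exp_pos (-M * G)]
    · rw [h.1, ← neg_mul] at h1
      linarith [Real.exp_le_exp.2 h1, Real.exp_pos (M * G)]
  have hswap : Integrable (Function.uncurry fun g G =>
      gibbs (En g) (fun σ => Real.exp (w * G * ∑ i, ψ (σ i))))
      ((gaussianPi (E ⊕ ι)).prod stdGaussian) := by
    have hB : Integrable (fun z : (E ⊕ ι → ℝ) × ℝ => Real.exp (M * z.2) + Real.exp (-M * z.2))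
        ((gaussianPi (E ⊕ ι)).prod stdGaussian) :=
      ((integrable_exp_mul_gaussianReal M).add (integrable_exp_mul_gaussianReal (-M))).comp_snd _
    refine hB.mono' ?_ (Filter.Eventually.of_forall fun z => hbound z.1 z.2)
    refine (continuous_gibbs (fun σ => (hcE σ).comp continuous_fst)
      fun σ => ?_).measurable.aestronglyMeasurable
    fun_prop
  refine (integral_congr_ae (Filter.Eventually.of_forall hlin)).trans_le ?_
  rw [integral_integral_swap hswap]
  refine le_trans ?_ integral_exp_sq_div_four.2
  refine integral_mono hswap.integral_prod_right integral_exp_sq_div_four.1 fun G => ?_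
  refine (integral_gibbs_exp_sum_le he hb hψ hc (w * G)).trans (Real.exp_le_exp.2 ?_)
  rw [mul_pow, hw2]
  have := mul_le_mul_of_nonneg_left hab (sq_nonneg G)
  linarith

end ExpMoment

/-! ### The interpolating energies -/

section Path

variable {S n : ℕ}

/-- The pairs `i < j` of sites. -/
abbrev Edge (n : ℕ) : Type := {e : Fin n × Fin n // e.1 < e.2}

/-- The (unnormalized) overlap `∑ i, σ i τ i`. -/
def overlap (σ τ : Config S n) : ℝ := ∑ i, spin i σ * spin i τ

lemma overlap_comm (σ τ : Config S n) : overlap σ τ = overlap τ σ := by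
  simp only [overlap, mul_comm]

lemma sum_edge_mul (a : Fin n → ℝ) :
    ∑ e : Edge n, a e.1.1 * a e.1.2 = ((∑ i, a i) ^ 2 - ∑ i, a i ^ 2) / 2 := by
  have h1 : ∑ e : Edge n, a e.1.1 * a e.1.2
      = ∑ x : Fin n × Fin n, if x.1 < x.2 then a x.1 * a x.2 else 0 := by
    rw [← Finset.sum_filter]
    exact (Finset.sum_subtype (p := fun x : Fin n × Fin n => x.1 < x.2)
      (Finset.univ.filter fun x : Fin n × Fin n => x.1 < x.2) (by simp)
      (fun x : Fin n × Fin n => a x.1 * a x.2)).symm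
  have h2 : ∑ x : Fin n × Fin n, (if x.1 < x.2 then a x.1 * a x.2 else 0)
      = ∑ x : Fin n × Fin n, if x.2 < x.1 then a x.1 * a x.2 else 0 := by
    rw [← (Equiv.prodComm (Fin n) (Fin n)).sum_comp]
    simp [mul_comm]
  have h3 : ∑ i, a i ^ 2 = ∑ x : Fin n × Fin n, if x.1 = x.2 then a x.1 * a x.2 else 0 := by
    rw [Fintype.sum_prod_type]
    simp [sq]
  have h4 : (∑ i, a i) ^ 2 = ∑ x : Fin n × Fin n, a x.1 * a x.2 := by
    rw [sq, Finset.sum_mul_sum, Fintype.sum_prod_type]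
  have h5 : ∑ x : Fin n × Fin n, a x.1 * a x.2
      = ∑ x : Fin n × Fin n, (if x.1 < x.2 then a x.1 * a x.2 else 0)
        + ∑ x : Fin n × Fin n, (if x.2 < x.1 then a x.1 * a x.2 else 0)
        + ∑ x : Fin n × Fin n, (if x.1 = x.2 then a x.1 * a x.2 else 0) := by
    rw [← Finset.sum_add_distrib, ← Finset.sum_add_distrib]
    refine Finset.sum_congr rfl fun x _ => ?_
    rcases lt_trichotomy x.1 x.2 with h | h | h
    · simp [h, h.not_gt, h.ne]
    · simp [h]
    · simp [h, h.not_gt, h.ne']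
  rw [h1, h4, h5, ← h2, h3]
  ring

/-- The diagonal correction to the covariance of the couplings. -/
def diagTerm (N β : ℝ) (σ τ : Config S n) : ℝ :=
  β ^ 2 / (2 * N) * ∑ i, (spin i σ * spin i τ) ^ 2

lemma abs_spin_le (i : Fin n) (σ : Config S n) : |spin i σ| ≤ S := abs_spinVal_le (σ i)

lemma abs_spin_mul_spin_le (i j : Fin n) (σ τ : Config S n) :
    |spin i σ * spin j τ| ≤ (S : ℝ) ^ 2 := by
  rw [abs_mul, sq]
  exact mul_le_mul (abs_spin_le i σ) (abs_spin_le j τ) (abs_nonneg _) (Nat.cast_nonneg _)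

lemma diagTerm_nonneg {N : ℝ} (hN : 0 < N) (β : ℝ) (σ τ : Config S n) :
    0 ≤ diagTerm N β σ τ :=
  mul_nonneg (by positivity) (Finset.sum_nonneg fun _ _ => sq_nonneg _)

lemma diagTerm_le {N : ℝ} (hN : 0 < N) (hnN : (n : ℝ) ≤ N) (β : ℝ) (σ τ : Config S n) :
    diagTerm N β σ τ ≤ β ^ 2 * (S : ℝ) ^ 4 / 2 := by
  have h : ∑ i, (spin i σ * spin i τ) ^ 2 ≤ N * (S : ℝ) ^ 4 := by
    calc ∑ i, (spin i σ * spin i τ) ^ 2 ≤ ∑ _i : Fin n, (S : ℝ) ^ 4 := by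
          refine Finset.sum_le_sum fun i _ => ?_
          rw [← sq_abs]
          calc |spin i σ * spin i τ| ^ 2 ≤ ((S : ℝ) ^ 2) ^ 2 :=
                pow_le_pow_left₀ (abs_nonneg _) (abs_spin_mul_spin_le i i σ τ) 2
            _ = _ := by ring
      _ = n * (S : ℝ) ^ 4 := by simp
      _ ≤ _ := by gcongr
  calc diagTerm N β σ τ ≤ β ^ 2 / (2 * N) * (N * (S : ℝ) ^ 4) := by unfold diagTerm; gcongr
    _ = _ := by field_simp

/-- Gaussian coefficients along the path: at angle `θ` the couplings are multiplied by `sin θ` and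
independent random fields of strength `β √q` by `cos θ`. -/
def pathCoef (N β q θ : ℝ) (σ : Config S n) : Edge n ⊕ Fin n → ℝ :=
  Sum.elim (fun e => Real.sin θ * (β / √N * (spin e.1.1 σ * spin e.1.2 σ)))
    (fun i => Real.cos θ * (β * √q * spin i σ))

/-- The velocity of `pathCoef`. -/
def pathCoefDeriv (N β q θ : ℝ) (σ : Config S n) : Edge n ⊕ Fin n → ℝ :=
  Sum.elim (fun e => Real.cos θ * (β / √N * (spin e.1.1 σ * spin e.1.2 σ)))
    (fun i => -Real.sin θ * (β * √q * spin i σ))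

/-- The deterministic part of the energy along the path. -/
def pathField (β D h p q θ : ℝ) (σ : Config S n) : ℝ :=
  D * ∑ i, spin i σ ^ 2 + h * ∑ i, spin i σ
    + Real.cos θ ^ 2 * (β ^ 2 / 2 * (p - q) * overlap σ σ)

/-- The velocity of `pathField`. -/
def pathFieldDeriv (β p q θ : ℝ) (σ : Config S n) : ℝ :=
  -(Real.sin θ * Real.cos θ * (β ^ 2 * (p - q) * overlap σ σ))

lemma hasDerivAt_pathCoef (N β q θ : ℝ) (σ : Config S n) (i : Edge n ⊕ Fin n) :
    HasDerivAt (fun t => pathCoef N β q t σ i) (pathCoefDeriv N β q θ σ i) θ := by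
  rcases i with e | i
  · exact (Real.hasDerivAt_sin θ).mul_const _
  · exact (Real.hasDerivAt_cos θ).mul_const _

lemma hasDerivAt_pathField (β D h p q θ : ℝ) (σ : Config S n) :
    HasDerivAt (fun t => pathField β D h p q t σ) (pathFieldDeriv β p q θ σ) θ := by
  unfold pathField
  refine ((((Real.hasDerivAt_cos θ).fun_pow 2).mul_const _).const_add _).congr_deriv ?_
  unfold pathFieldDeriv
  simp only [Nat.cast_ofNat, Nat.add_one_sub_one, pow_one]
  ring

/-- The covariance of the velocity and the position of the path is half the derivative of the
covariance; up to the diagonal correction it is a complete square of the centred overlap. -/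
lemma sum_pathCoefDeriv_mul {N q : ℝ} (hN : 0 < N) (hq : 0 ≤ q) (β θ : ℝ) (σ τ : Config S n) :
    ∑ i, pathCoefDeriv N β q θ σ i * pathCoef N β q θ τ i
      = Real.sin θ * Real.cos θ * (β ^ 2 / (2 * N) * ((overlap σ τ - N * q) ^ 2 - N ^ 2 * q ^ 2)
          - diagTerm N β σ τ) := by
  rw [Fintype.sum_sum_type]
  simp only [pathCoef, pathCoefDeriv, Sum.elim_inl, Sum.elim_inr]
  have h1 : ∑ e : Edge n, Real.cos θ * (β / √N * (spin e.1.1 σ * spin e.1.2 σ))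
        * (Real.sin θ * (β / √N * (spin e.1.1 τ * spin e.1.2 τ)))
      = Real.sin θ * Real.cos θ * (β ^ 2 / N) * ∑ e : Edge n,
        (spin e.1.1 σ * spin e.1.1 τ) * (spin e.1.2 σ * spin e.1.2 τ) := by
    rw [Finset.mul_sum]
    refine Finset.sum_congr rfl fun e _ => ?_
    have : β ^ 2 / N = (β / √N) * (β / √N) := by
      rw [div_mul_div_comm, Real.mul_self_sqrt hN.le, sq]
    rw [this]
    ring
  have h2 : ∑ i, -Real.sin θ * (β * √q * spin i σ) * (Real.cos θ * (β * √q * spin i τ))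
      = -(Real.sin θ * Real.cos θ * (β ^ 2 * q * overlap σ τ)) := by
    rw [overlap, Finset.mul_sum, Finset.mul_sum, ← Finset.sum_neg_distrib]
    refine Finset.sum_congr rfl fun i _ => ?_
    have : β ^ 2 * q = (β * √q) * (β * √q) := by
      rw [mul_mul_mul_comm, Real.mul_self_sqrt hq, sq]
    rw [this]
    ring
  rw [h1, h2, sum_edge_mul fun i => spin i σ * spin i τ, diagTerm, ← overlap]
  field_simp
  ring

/-- On the diagonal the drift of the deterministic part recentres the self-overlap at `N p`. -/
lemma pathFieldDeriv_add {N q : ℝ} (hN : 0 < N) (hq : 0 ≤ q) (β p θ : ℝ) (σ : Config S n) :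
    pathFieldDeriv β p q θ σ + ∑ i, pathCoefDeriv N β q θ σ i * pathCoef N β q θ σ i
      = Real.sin θ * Real.cos θ * (β ^ 2 / (2 * N) * ((overlap σ σ - N * p) ^ 2 - N ^ 2 * p ^ 2)
          - diagTerm N β σ σ) := by
  rw [sum_pathCoefDeriv_mul hN hq, pathFieldDeriv]
  field_simp
  ring

/-- The energy of one replica along the path. -/
def pathEnergy (N β D h p q θ : ℝ) (g : Edge n ⊕ Fin n → ℝ) : Config S n → ℝ :=
  gaussEnergy (pathCoef N β q θ) (pathField β D h p q θ) g

/-- The sum of the squared deviations of the three overlaps of a pair of replicas. -/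
def deviation (N p q : ℝ) (x : Config S n × Config S n) : ℝ :=
  (overlap x.1 x.2 - N * q) ^ 2 + (overlap x.1 x.1 - N * p) ^ 2 + (overlap x.2 x.2 - N * p) ^ 2

lemma deviation_nonneg (N p q : ℝ) (x : Config S n × Config S n) : 0 ≤ deviation N p q x := by
  unfold deviation; positivity

/-- The strength of the quadratic coupling of the two replicas along the path. It decreases just
fast enough to compensate the squares of the overlaps that the couplings produce. -/
def couplingStrength (lam β θ : ℝ) : ℝ := lam - β ^ 2 / 2 * Real.sin θ ^ 2

/-- The deterministic part of the energy of two quadratically coupled replicas. -/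
def pairField (N β D h p q lam θ : ℝ) (x : Config S n × Config S n) : ℝ :=
  pathField β D h p q θ x.1 + pathField β D h p q θ x.2
    + couplingStrength lam β θ / N * deviation N p q x

/-- The velocity of `pairField`. -/
def pairFieldDeriv (N β p q θ : ℝ) (x : Config S n × Config S n) : ℝ :=
  pathFieldDeriv β p q θ x.1 + pathFieldDeriv β p q θ x.2
    - Real.sin θ * Real.cos θ * (β ^ 2 / N * deviation N p q x)

/-- The Gaussian coefficients of a pair of replicas. -/
def pairCoef (N β q θ : ℝ) (x : Config S n × Config S n) (i : Edge n ⊕ Fin n) : ℝ :=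
  pathCoef N β q θ x.1 i + pathCoef N β q θ x.2 i

/-- The velocity of `pairCoef`. -/
def pairCoefDeriv (N β q θ : ℝ) (x : Config S n × Config S n) (i : Edge n ⊕ Fin n) : ℝ :=
  pathCoefDeriv N β q θ x.1 i + pathCoefDeriv N β q θ x.2 i

lemma hasDerivAt_pairField (N β D h p q lam θ : ℝ) (x : Config S n × Config S n) :
    HasDerivAt (fun t => pairField N β D h p q lam t x) (pairFieldDeriv N β p q θ x) θ := by
  unfold pairField couplingStrength
  have h1 := (((((Real.hasDerivAt_sin θ).fun_pow 2).const_mul (β ^ 2 / 2)).const_sub lam).div_const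
    N).mul_const (deviation N p q x)
  refine (((hasDerivAt_pathField β D h p q θ x.1).add
    (hasDerivAt_pathField β D h p q θ x.2)).add h1).congr_deriv ?_
  unfold pairFieldDeriv
  simp only [Nat.cast_ofNat, Nat.add_one_sub_one, pow_one]
  ring

lemma pairEnergy_add_deviation (N β D h p q lam θ : ℝ) (g : Edge n ⊕ Fin n → ℝ)
    (x : Config S n × Config S n) :
    gaussEnergy (pairCoef N β q θ) (pairField N β D h p q lam θ) g x
      = pairEnergy (pathEnergy N β D h p q θ g) (pathEnergy N β D h p q θ g) x
        + couplingStrength lam β θ / N * deviation N p q x := by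
  simp only [gaussEnergy, pairCoef, pairField, pairEnergy, pathEnergy, add_mul,
    Finset.sum_add_distrib]
  ring

/-- The cross covariance of two pairs of replicas, bounded below by dropping the squares. -/
lemma le_sum_pairCoefDeriv_mul {N q : ℝ} (hN : 0 < N) (hnN : (n : ℝ) ≤ N) (hq : 0 ≤ q) (β : ℝ)
    {θ : ℝ} (hθ : 0 ≤ Real.sin θ * Real.cos θ) (x y : Config S n × Config S n) :
    Real.sin θ * Real.cos θ * (-(2 * β ^ 2 * N * q ^ 2) - 2 * β ^ 2 * (S : ℝ) ^ 4)
      ≤ ∑ i, pairCoefDeriv N β q θ x i * pairCoef N β q θ y i := by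
  have hsplit : ∑ i, pairCoefDeriv N β q θ x i * pairCoef N β q θ y i
      = ∑ i, pathCoefDeriv N β q θ x.1 i * pathCoef N β q θ y.1 i
        + ∑ i, pathCoefDeriv N β q θ x.1 i * pathCoef N β q θ y.2 i
        + ∑ i, pathCoefDeriv N β q θ x.2 i * pathCoef N β q θ y.1 i
        + ∑ i, pathCoefDeriv N β q θ x.2 i * pathCoef N β q θ y.2 i := by
    simp only [← Finset.sum_add_distrib]
    refine Finset.sum_congr rfl fun i _ => ?_
    simp only [pairCoef, pairCoefDeriv]
    ring
  have hb : ∀ σ τ : Config S n,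
      Real.sin θ * Real.cos θ * (-(β ^ 2 * N * q ^ 2 / 2) - β ^ 2 * (S : ℝ) ^ 4 / 2)
        ≤ ∑ i, pathCoefDeriv N β q θ σ i * pathCoef N β q θ τ i := by
    intro σ τ
    rw [sum_pathCoefDeriv_mul hN hq]
    refine mul_le_mul_of_nonneg_left ?_ hθ
    have h1 := diagTerm_le hN hnN β σ τ
    have h2 : 0 ≤ β ^ 2 / (2 * N) * (overlap σ τ - N * q) ^ 2 := by positivity
    have h3 : β ^ 2 / (2 * N) * (N ^ 2 * q ^ 2) = β ^ 2 * N * q ^ 2 / 2 := by field_simp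
    rw [mul_sub, h3]
    linarith
  rw [hsplit]
  linarith [hb x.1 y.1, hb x.1 y.2, hb x.2 y.1, hb x.2 y.2]

/-- The diagonal term of two coupled replicas: the decrease of the coupling strength pays for all
the squares. -/
lemma pairFieldDeriv_add_le {N q : ℝ} (hN : 0 < N) (hq : 0 ≤ q) (β p : ℝ)
    {θ : ℝ} (hθ : 0 ≤ Real.sin θ * Real.cos θ) (x : Config S n × Config S n) :
    pairFieldDeriv N β p q θ x + ∑ i, pairCoefDeriv N β q θ x i * pairCoef N β q θ x i
      ≤ Real.sin θ * Real.cos θ * (-(β ^ 2 * N * p ^ 2) - β ^ 2 * N * q ^ 2) := by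
  have hsplit : pairFieldDeriv N β p q θ x + ∑ i, pairCoefDeriv N β q θ x i * pairCoef N β q θ x i
      = (pathFieldDeriv β p q θ x.1
          + ∑ i, pathCoefDeriv N β q θ x.1 i * pathCoef N β q θ x.1 i)
        + (pathFieldDeriv β p q θ x.2
          + ∑ i, pathCoefDeriv N β q θ x.2 i * pathCoef N β q θ x.2 i)
        + ∑ i, pathCoefDeriv N β q θ x.1 i * pathCoef N β q θ x.2 i
        + ∑ i, pathCoefDeriv N β q θ x.2 i * pathCoef N β q θ x.1 i
        - Real.sin θ * Real.cos θ * (β ^ 2 / N * deviation N p q x) := by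
    have : ∑ i, pairCoefDeriv N β q θ x i * pairCoef N β q θ x i
      = ∑ i, pathCoefDeriv N β q θ x.1 i * pathCoef N β q θ x.1 i
        + ∑ i, pathCoefDeriv N β q θ x.2 i * pathCoef N β q θ x.2 i
        + ∑ i, pathCoefDeriv N β q θ x.1 i * pathCoef N β q θ x.2 i
        + ∑ i, pathCoefDeriv N β q θ x.2 i * pathCoef N β q θ x.1 i := by
      simp only [← Finset.sum_add_distrib]
      refine Finset.sum_congr rfl fun i _ => ?_
      simp only [pairCoef, pairCoefDeriv]
      ring
    rw [this, pairFieldDeriv]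
    ring
  rw [hsplit, pathFieldDeriv_add hN hq, pathFieldDeriv_add hN hq, sum_pathCoefDeriv_mul hN hq,
    sum_pathCoefDeriv_mul hN hq, overlap_comm x.2 x.1]
  simp only [← mul_add, ← mul_sub]
  refine mul_le_mul_of_nonneg_left ?_ hθ
  have d1 := diagTerm_nonneg hN β x.1 x.1
  have d2 := diagTerm_nonneg hN β x.2 x.2
  have d3 := diagTerm_nonneg hN β x.1 x.2
  have d4 := diagTerm_nonneg hN β x.2 x.1
  have e1 : 0 ≤ β ^ 2 / (2 * N) * (overlap x.1 x.1 - N * p) ^ 2 := by positivity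
  have e2 : 0 ≤ β ^ 2 / (2 * N) * (overlap x.2 x.2 - N * p) ^ 2 := by positivity
  have hp : ∀ r : ℝ, β ^ 2 / (2 * N) * (N ^ 2 * r ^ 2) = β ^ 2 * N * r ^ 2 / 2 := fun r => by
    field_simp
  have hd : β ^ 2 / N = 2 * (β ^ 2 / (2 * N)) := by field_simp
  simp only [deviation, hd, mul_sub, hp]
  linarith

/-- The derivative of the free energy of one replica is bounded below. -/
lemma le_interpIntegrand {N q : ℝ} (hN : 0 < N) (hnN : (n : ℝ) ≤ N) (hq : 0 ≤ q) (β D h p : ℝ)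
    {θ : ℝ} (hθ : 0 ≤ Real.sin θ * Real.cos θ) (g : Edge n ⊕ Fin n → ℝ) :
    Real.sin θ * Real.cos θ * (-(β ^ 2 * N * p ^ 2 / 2) - β ^ 2 * (S : ℝ) ^ 4 / 2
        + β ^ 2 * N * q ^ 2 / 2 - β ^ 2 / (2 * N) *
          gibbs (pairEnergy (pathEnergy (S := S) N β D h p q θ g) (pathEnergy N β D h p q θ g))
            (fun x => (overlap x.1 x.2 - N * q) ^ 2))
      ≤ interpIntegrand (pathCoef (S := S) N β q θ) (pathCoefDeriv N β q θ)
          (pathField β D h p q θ) (pathFieldDeriv β p q θ) g := by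
  rw [interpIntegrand_eq]
  set E := pathEnergy (S := S) N β D h p q θ g with hE
  have hr : ∀ r : ℝ, β ^ 2 / (2 * N) * (N ^ 2 * r ^ 2) = β ^ 2 * N * r ^ 2 / 2 := fun r => by
    field_simp
  have h1 : Real.sin θ * Real.cos θ * (-(β ^ 2 * N * p ^ 2 / 2) - β ^ 2 * (S : ℝ) ^ 4 / 2)
      ≤ gibbs E (fun σ => pathFieldDeriv β p q θ σ
        + ∑ i, pathCoefDeriv N β q θ σ i * pathCoef N β q θ σ i) := by
    refine le_gibbs_of_le _ fun σ => ?_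
    rw [pathFieldDeriv_add hN hq]
    refine mul_le_mul_of_nonneg_left ?_ hθ
    have := diagTerm_le hN hnN β σ σ
    have : 0 ≤ β ^ 2 / (2 * N) * (overlap σ σ - N * p) ^ 2 := by positivity
    rw [mul_sub, hr]
    linarith
  have h2 : gibbs (pairEnergy E E)
        (fun x => ∑ i, pathCoefDeriv N β q θ x.1 i * pathCoef N β q θ x.2 i)
      ≤ Real.sin θ * Real.cos θ * (β ^ 2 / (2 * N) *
          gibbs (pairEnergy E E) (fun x => (overlap x.1 x.2 - N * q) ^ 2)
          - β ^ 2 * N * q ^ 2 / 2) := by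
    have := gibbs_mono (pairEnergy E E)
      (f := fun x => ∑ i, pathCoefDeriv N β q θ x.1 i * pathCoef N β q θ x.2 i)
      (g := fun x => Real.sin θ * Real.cos θ * (β ^ 2 / (2 * N) * (overlap x.1 x.2 - N * q) ^ 2
          - β ^ 2 * N * q ^ 2 / 2)) fun x => by
      rw [sum_pathCoefDeriv_mul hN hq]
      refine mul_le_mul_of_nonneg_left ?_ hθ
      have := diagTerm_nonneg hN β x.1 x.2
      rw [mul_sub, hr]
      linarith
    rwa [gibbs_const_mul, gibbs_sub, gibbs_const_mul, gibbs_const] at this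
  refine le_trans (le_of_eq ?_) (sub_le_sub h1 h2)
  ring

/-- The derivative of the free energy of two coupled replicas is bounded above. -/
lemma interpIntegrand_pair_le {N q : ℝ} (hN : 0 < N) (hnN : (n : ℝ) ≤ N) (hq : 0 ≤ q)
    (β D h p lam : ℝ) {θ : ℝ} (hθ : 0 ≤ Real.sin θ * Real.cos θ) (g : Edge n ⊕ Fin n → ℝ) :
    interpIntegrand (pairCoef (S := S) N β q θ) (pairCoefDeriv N β q θ)
        (pairField N β D h p q lam θ) (pairFieldDeriv N β p q θ) g
      ≤ Real.sin θ * Real.cos θ * (-(β ^ 2 * N * p ^ 2) + β ^ 2 * N * q ^ 2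
          + 2 * β ^ 2 * (S : ℝ) ^ 4) := by
  rw [interpIntegrand_eq]
  have h1 := gibbs_le_of_le (gaussEnergy (pairCoef (S := S) N β q θ)
    (pairField N β D h p q lam θ) g) fun x => pairFieldDeriv_add_le hN hq β p hθ x
  have h2 := le_gibbs_of_le (pairEnergy (gaussEnergy (pairCoef (S := S) N β q θ)
    (pairField N β D h p q lam θ) g) (gaussEnergy (pairCoef (S := S) N β q θ)
    (pairField N β D h p q lam θ) g))
    fun x => le_sum_pairCoefDeriv_mul hN hnN hq β hθ x.1 x.2
  refine (sub_le_sub h1 h2).trans (le_of_eq ?_)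
  ring

end Path

/-! ### Concentration of the overlaps -/

section Overlap

variable {S n : ℕ}

/-- The excess free energy of two quadratically coupled replicas over two independent ones. -/
def excessFree (S n : ℕ) (N β D h p q lam θ : ℝ) : ℝ :=
  freeEnergy (pairCoef (S := S) (n := n) N β q θ) (pairField N β D h p q lam θ)
    - 2 * freeEnergy (pathCoef (S := S) (n := n) N β q θ) (pathField β D h p q θ)

/-- The disorder average of the deviation of the overlaps of two independent replicas. -/
def meanDeviation (S n : ℕ) (N β D h p q θ : ℝ) : ℝ :=
  ∫ g, gibbs (pairEnergy (pathEnergy (S := S) (n := n) N β D h p q θ g)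
    (pathEnergy N β D h p q θ g)) (deviation N p q) ∂gaussianPi (Edge n ⊕ Fin n)

lemma exists_uniform_bound {κ : Type*} [Fintype κ] {f : ℝ → κ → ℝ}
    (h : ∀ a, ∃ C, ∀ s, |f s a| ≤ C) : ∃ C, ∀ s a, |f s a| ≤ C := by
  choose C hC using h
  refine ⟨∑ a, C a, fun s a => (hC a s).trans ?_⟩
  exact Finset.single_le_sum (fun a _ => (abs_nonneg _).trans (hC a 0)) (Finset.mem_univ a)

/-- `hasDerivAt_freeEnergy` for velocities which are bounded in time. -/
lemma hasDerivAt_freeEnergy_of_bounded {α ι : Type*} [Fintype α] [Nonempty α] [Fintype ι]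
    {c c' : ℝ → α → ι → ℝ} {k k' : ℝ → α → ℝ}
    (hc : ∀ s a i, HasDerivAt (fun t => c t a i) (c' s a i) s)
    (hk : ∀ s a, HasDerivAt (fun t => k t a) (k' s a) s)
    (hA : ∀ a i, ∃ C, ∀ s, |c' s a i| ≤ C) (hA' : ∀ a, ∃ C, ∀ s, |k' s a| ≤ C) (s : ℝ) :
    HasDerivAt (fun t => freeEnergy (c t) (k t))
      (∫ g, interpIntegrand (c s) (c' s) (k s) (k' s) g ∂gaussianPi ι) s := by
  obtain ⟨A, hA⟩ := exists_uniform_bound (f := fun s (x : α × ι) => c' s x.1 x.2)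
    fun x => hA x.1 x.2
  obtain ⟨A', hA'⟩ := exists_uniform_bound hA'
  exact hasDerivAt_freeEnergy (A := max A A') hc hk
    (fun s a i => (hA s (a, i)).trans (le_max_left _ _))
    (fun s a => (hA' s a).trans (le_max_right _ _)) s

lemma exists_abs_pathCoefDeriv_le (N β q : ℝ) (σ : Config S n) (i : Edge n ⊕ Fin n) :
    ∃ C, ∀ s, |pathCoefDeriv N β q s σ i| ≤ C := by
  rcases i with e | i
  · refine ⟨|β / √N * (spin e.1.1 σ * spin e.1.2 σ)|, fun s => ?_⟩
    rw [pathCoefDeriv, Sum.elim_inl, abs_mul]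
    exact mul_le_of_le_one_left (abs_nonneg _) (Real.abs_cos_le_one s)
  · refine ⟨|β * √q * spin i σ|, fun s => ?_⟩
    rw [pathCoefDeriv, Sum.elim_inr, abs_mul, abs_neg]
    exact mul_le_of_le_one_left (abs_nonneg _) (Real.abs_sin_le_one s)

lemma abs_sin_mul_cos_mul_le (s x : ℝ) : |Real.sin s * Real.cos s * x| ≤ |x| := by
  rw [abs_mul, abs_mul]
  exact mul_le_of_le_one_left (abs_nonneg _)
    (mul_le_one₀ (Real.abs_sin_le_one s) (abs_nonneg _) (Real.abs_cos_le_one s))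

lemma exists_abs_pathFieldDeriv_le (β p q : ℝ) (σ : Config S n) :
    ∃ C, ∀ s, |pathFieldDeriv β p q s σ| ≤ C := by
  refine ⟨|β ^ 2 * (p - q) * overlap σ σ|, fun s => ?_⟩
  rw [pathFieldDeriv, abs_neg]
  exact abs_sin_mul_cos_mul_le _ _

lemma hasDerivAt_excessFree (N β D h p q lam θ : ℝ) :
    HasDerivAt (excessFree S n N β D h p q lam)
      (∫ g, (interpIntegrand (pairCoef (S := S) N β q θ) (pairCoefDeriv N β q θ)
            (pairField N β D h p q lam θ) (pairFieldDeriv N β p q θ) g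
          - 2 * interpIntegrand (pathCoef (S := S) N β q θ) (pathCoefDeriv N β q θ)
            (pathField β D h p q θ) (pathFieldDeriv β p q θ) g)
        ∂gaussianPi (Edge n ⊕ Fin n)) θ := by
  rw [integral_sub (integrable_interpIntegrand _ _ _ _)
    ((integrable_interpIntegrand _ _ _ _).const_mul 2), integral_const_mul]
  refine HasDerivAt.sub ?_ (HasDerivAt.const_mul 2 ?_)
  · refine hasDerivAt_freeEnergy_of_bounded (c := fun t => pairCoef (S := S) N β q t)
      (c' := fun t => pairCoefDeriv N β q t) (k := fun t => pairField N β D h p q lam t)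
      (k' := fun t => pairFieldDeriv N β p q t)
      (fun s x i => (hasDerivAt_pathCoef N β q s x.1 i).add (hasDerivAt_pathCoef N β q s x.2 i))
      (fun s x => hasDerivAt_pairField N β D h p q lam s x) (fun x i => ?_) (fun x => ?_) θ
    · obtain ⟨C, hC⟩ := exists_abs_pathCoefDeriv_le N β q x.1 i
      obtain ⟨C', hC'⟩ := exists_abs_pathCoefDeriv_le N β q x.2 i
      exact ⟨C + C', fun s => (abs_add_le _ _).trans (add_le_add (hC s) (hC' s))⟩
    · obtain ⟨C, hC⟩ := exists_abs_pathFieldDeriv_le β p q x.1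
      obtain ⟨C', hC'⟩ := exists_abs_pathFieldDeriv_le β p q x.2
      exact ⟨C + C' + |β ^ 2 / N * deviation N p q x|, fun s =>
        (abs_sub _ _).trans (add_le_add ((abs_add_le _ _).trans (add_le_add (hC s) (hC' s)))
          (abs_sin_mul_cos_mul_le _ _))⟩
  · exact hasDerivAt_freeEnergy_of_bounded (c := fun t => pathCoef (S := S) N β q t)
      (c' := fun t => pathCoefDeriv N β q t) (k := fun t => pathField β D h p q t)
      (k' := fun t => pathFieldDeriv β p q t)
      (fun s σ i => hasDerivAt_pathCoef N β q s σ i)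
      (fun s σ => hasDerivAt_pathField β D h p q s σ)
      (exists_abs_pathCoefDeriv_le N β q) (exists_abs_pathFieldDeriv_le β p q) θ

lemma continuous_gibbs_pairEnergy (N β D h p q θ : ℝ) (f : Config S n × Config S n → ℝ) :
    Continuous fun g => gibbs (pairEnergy (pathEnergy N β D h p q θ g)
      (pathEnergy N β D h p q θ g)) f := by
  refine continuous_gibbs (f := fun _ => f) (fun x => ?_) fun _ => continuous_const
  exact (continuous_gaussEnergy _ _ _).add (continuous_gaussEnergy _ _ _)

lemma integrable_gibbs_pairEnergy (N β D h p q θ : ℝ) (f : Config S n × Config S n → ℝ) :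
    Integrable (fun g => gibbs (pairEnergy (pathEnergy N β D h p q θ g)
      (pathEnergy N β D h p q θ g)) f) (gaussianPi (Edge n ⊕ Fin n)) :=
  integrable_of_continuous_of_bounded (continuous_gibbs_pairEnergy N β D h p q θ f) _
    fun _ => abs_gibbs_le_sum _ f

/-- The excess free energy at fixed disorder. -/
lemma log_sum_exp_pair_sub (N β D h p q lam θ : ℝ) (g : Edge n ⊕ Fin n → ℝ) :
    Real.log (∑ x, Real.exp (gaussEnergy (pairCoef (S := S) N β q θ)
        (pairField N β D h p q lam θ) g x))
      - 2 * Real.log (∑ σ, Real.exp (pathEnergy (S := S) N β D h p q θ g σ))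
      = Real.log (gibbs (pairEnergy (pathEnergy (S := S) N β D h p q θ g)
          (pathEnergy N β D h p q θ g))
          (fun x => Real.exp (couplingStrength lam β θ / N * deviation N p q x))) := by
  simp only [pairEnergy_add_deviation]
  rw [log_sum_exp_add, sum_exp_pairEnergy, Real.log_mul (sum_exp_pos _).ne' (sum_exp_pos _).ne']
  ring

lemma excessFree_eq_integral (N β D h p q lam θ : ℝ) :
    excessFree S n N β D h p q lam θ
      = ∫ g, Real.log (gibbs (pairEnergy (pathEnergy (S := S) (n := n) N β D h p q θ g)
          (pathEnergy N β D h p q θ g))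
          (fun x => Real.exp (couplingStrength lam β θ / N * deviation N p q x)))
          ∂gaussianPi (Edge n ⊕ Fin n) ∧
    Integrable (fun g => Real.log (gibbs (pairEnergy
      (pathEnergy (S := S) (n := n) N β D h p q θ g) (pathEnergy N β D h p q θ g))
          (fun x => Real.exp (couplingStrength lam β θ / N * deviation N p q x))))
          (gaussianPi (Edge n ⊕ Fin n)) := by
  have i1 := integrable_log_sum_exp (pairCoef (S := S) (n := n) N β q θ)
    (pairField N β D h p q lam θ)
  have i2 := (integrable_log_sum_exp (pathCoef (S := S) (n := n) N β q θ)
    (pathField β D h p q θ)).const_mul 2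
  have e := fun g => log_sum_exp_pair_sub (S := S) (n := n) N β D h p q lam θ g
  simp only [← e]
  refine ⟨?_, i1.sub i2⟩
  have := integral_sub i1 i2
  rw [integral_const_mul] at this
  exact this.symm

/-- By Jensen's inequality the excess free energy controls the deviation. -/
lemma meanDeviation_le_excessFree (N β D h p q lam θ : ℝ) :
    couplingStrength lam β θ / N * meanDeviation S n N β D h p q θ
      ≤ excessFree S n N β D h p q lam θ := by
  obtain ⟨e, i⟩ := excessFree_eq_integral (S := S) (n := n) N β D h p q lam θ
  rw [e, meanDeviation, ← integral_const_mul]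
  refine integral_mono ((integrable_gibbs_pairEnergy N β D h p q θ _).const_mul _) i fun g => ?_
  have := Real.log_le_log (Real.exp_pos _) (exp_gibbs_le (pairEnergy
      (pathEnergy (S := S) (n := n) N β D h p q θ g) (pathEnergy N β D h p q θ g))
          (fun x => couplingStrength lam β θ / N * deviation N p q x))
  rwa [Real.log_exp, gibbs_const_mul] at this

/-- The derivative of the excess free energy is bounded by the deviation of the overlap of two
uncoupled replicas. -/
lemma excessFree_deriv_le {N q : ℝ} (hN : 0 < N) (hnN : (n : ℝ) ≤ N) (hq : 0 ≤ q)
    (β D h p lam : ℝ) {θ : ℝ} (hθ : 0 ≤ Real.sin θ * Real.cos θ) :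
    ∫ g, (interpIntegrand (pairCoef (S := S) N β q θ) (pairCoefDeriv N β q θ)
            (pairField N β D h p q lam θ) (pairFieldDeriv N β p q θ) g
          - 2 * interpIntegrand (pathCoef (S := S) N β q θ) (pathCoefDeriv N β q θ)
            (pathField β D h p q θ) (pathFieldDeriv β p q θ) g) ∂gaussianPi (Edge n ⊕ Fin n)
      ≤ Real.sin θ * Real.cos θ * (β ^ 2 / N * meanDeviation S n N β D h p q θ
          + 3 * β ^ 2 * (S : ℝ) ^ 4) := by
  have i1 := integrable_interpIntegrand (pairCoef (S := S) (n := n) N β q θ)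
    (pairCoefDeriv N β q θ) (pairField N β D h p q lam θ) (pairFieldDeriv N β p q θ)
  have i2 := integrable_interpIntegrand (pathCoef (S := S) (n := n) N β q θ)
    (pathCoefDeriv N β q θ) (pathField β D h p q θ) (pathFieldDeriv β p q θ)
  have i3 := integrable_gibbs_pairEnergy (S := S) (n := n) N β D h p q θ (deviation N p q)
  have e : Real.sin θ * Real.cos θ * (β ^ 2 / N * meanDeviation S n N β D h p q θ
          + 3 * β ^ 2 * (S : ℝ) ^ 4)
      = ∫ g, Real.sin θ * Real.cos θ * (β ^ 2 / N * gibbs (pairEnergy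
          (pathEnergy (S := S) (n := n) N β D h p q θ g) (pathEnergy N β D h p q θ g))
          (deviation N p q) + 3 * β ^ 2 * (S : ℝ) ^ 4) ∂gaussianPi (Edge n ⊕ Fin n) := by
    rw [integral_const_mul, integral_add (i3.const_mul _) (integrable_const _),
      integral_const_mul, meanDeviation]
    simp
  rw [e]
  refine integral_mono (i1.sub (i2.const_mul 2))
    (((i3.const_mul _).add (integrable_const _)).const_mul _) fun g => ?_
  have h1 := interpIntegrand_pair_le (S := S) hN hnN hq β D h p lam hθ g
  have h2 := le_interpIntegrand (S := S) hN hnN hq β D h p hθ g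
  have h3 : Real.sin θ * Real.cos θ * (β ^ 2 / N *
        gibbs (pairEnergy (pathEnergy (S := S) N β D h p q θ g) (pathEnergy N β D h p q θ g))
          (fun x => (overlap x.1 x.2 - N * q) ^ 2))
      ≤ Real.sin θ * Real.cos θ * (β ^ 2 / N *
        gibbs (pairEnergy (pathEnergy (S := S) N β D h p q θ g) (pathEnergy N β D h p q θ g))
          (deviation N p q)) := by
    gcongr
    refine gibbs_mono _ fun x => ?_
    unfold deviation
    linarith [sq_nonneg (overlap x.1 x.1 - N * p), sq_nonneg (overlap x.2 x.2 - N * p)]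
  have e2 : β ^ 2 / (2 * N) = β ^ 2 / N / 2 := by field_simp
  rw [e2] at h2
  simp only at h1 h2 h3 ⊢
  linarith

/-- Gronwall's inequality along the path. -/
lemma excessFree_pi_div_two_le {N q : ℝ} (hN : 0 < N) (hnN : (n : ℝ) ≤ N) (hq : 0 ≤ q)
    {β lam : ℝ} (hβ : β ^ 2 ≤ 1) (hβlam : β ^ 2 ≤ lam) (D h p : ℝ) :
    excessFree S n N β D h p q lam (Real.pi / 2)
      ≤ 3 * (excessFree S n N β D h p q lam 0 + 2 * (S : ℝ) ^ 4) := by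
  set F := excessFree S n N β D h p q lam with hF
  have hdev : ∀ θ, 0 ≤ meanDeviation S n N β D h p q θ := fun θ =>
    integral_nonneg fun g => gibbs_nonneg _ fun x => deviation_nonneg N p q x
  have hcoup : ∀ θ, β ^ 2 ≤ 2 * couplingStrength lam β θ := fun θ => by
    unfold couplingStrength
    nlinarith [Real.sin_sq_le_one θ, sq_nonneg β]
  -- The derivative of `F` is at most `sin θ cos θ (2 F + 3 S ^ 4)`, so the integrating factor is
  -- the exponential of `-sin ^ 2`.
  have hanti : AntitoneOn (fun θ => (F θ + 2 * (S : ℝ) ^ 4) * Real.exp (-Real.sin θ ^ 2))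
      (Set.Icc 0 (Real.pi / 2)) := by
    have hd := fun θ => ((hasDerivAt_excessFree (S := S) (n := n) N β D h p q lam θ).add_const
      (2 * (S : ℝ) ^ 4)).mul (((Real.hasDerivAt_sin θ).fun_pow 2).fun_neg.exp)
    refine antitoneOn_of_deriv_nonpos (convex_Icc _ _)
      (fun θ _ => (hd θ).continuousAt.continuousWithinAt)
      (fun θ _ => (hd θ).differentiableAt.differentiableWithinAt) fun θ hθ => ?_
    rw [interior_Icc] at hθ
    have hsc : 0 ≤ Real.sin θ * Real.cos θ :=
      mul_nonneg (Real.sin_nonneg_of_nonneg_of_le_pi hθ.1.le (by linarith [hθ.2, Real.pi_pos]))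
        (Real.cos_nonneg_of_neg_pi_div_two_le_of_le (by linarith [hθ.1, Real.pi_pos]) hθ.2.le)
    refine (hd θ).deriv.trans_le ?_
    have h1 := excessFree_deriv_le (S := S) hN hnN hq β D h p lam hsc
    have h2 := meanDeviation_le_excessFree (S := S) (n := n) N β D h p q lam θ
    have h3 : β ^ 2 / N * meanDeviation S n N β D h p q θ + 3 * β ^ 2 * (S : ℝ) ^ 4
        ≤ 2 * F θ + 3 * (S : ℝ) ^ 4 := by
      have a1 : β ^ 2 / N * meanDeviation S n N β D h p q θ
          ≤ 2 * couplingStrength lam β θ / N * meanDeviation S n N β D h p q θ := by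
        have := hcoup θ
        have := hdev θ
        gcongr
      have a2 : 3 * β ^ 2 * (S : ℝ) ^ 4 ≤ 3 * 1 * (S : ℝ) ^ 4 := by gcongr
      have a3 : 2 * couplingStrength lam β θ / N * meanDeviation S n N β D h p q θ
          = 2 * (couplingStrength lam β θ / N * meanDeviation S n N β D h p q θ) := by ring
      linarith
    have h4 := h1.trans (mul_le_mul_of_nonneg_left h3 hsc)
    have h5 : 0 ≤ Real.sin θ * Real.cos θ * (S : ℝ) ^ 4 := by positivity
    have hexp := Real.exp_pos (-Real.sin θ ^ 2)
    simp only [Nat.cast_ofNat, Nat.add_one_sub_one, pow_one]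
    refine (show _ = Real.exp (-Real.sin θ ^ 2) * (_ - (F θ + 2 * (S : ℝ) ^ 4)
      * (2 * Real.sin θ * Real.cos θ)) by ring).trans_le
      (mul_nonpos_of_nonneg_of_nonpos hexp.le ?_)
    linarith
  have hle := hanti (Set.left_mem_Icc.2 (by positivity)) (Set.right_mem_Icc.2 (by positivity))
    (by positivity)
  simp only [Real.sin_zero, Real.sin_pi_div_two] at hle
  norm_num at hle
  have h0 : 0 ≤ F 0 := by
    refine le_trans ?_ (meanDeviation_le_excessFree (S := S) (n := n) N β D h p q lam 0)
    have := hcoup 0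
    have := hdev 0
    have : 0 ≤ couplingStrength lam β 0 := by nlinarith [sq_nonneg β]
    positivity
  rw [Real.exp_neg, ← div_eq_mul_inv, div_le_iff₀ (Real.exp_pos 1)] at hle
  have h3 := Real.exp_one_lt_three
  have hS4 : 0 ≤ (S : ℝ) ^ 4 := by positivity
  nlinarith

end Overlap

/-! ### The start of the path -/

section Initial

variable {S n : ℕ}

/-- The energy of a single site at the start of the path, as a function of its Gaussian field. -/
def startEnergy (β D h p q z : ℝ) : Spin S → ℝ :=
  siteEnergy (shift β D p q) (√q * β * z + h)

lemma continuous_startEnergy (β D h p q : ℝ) (s : Spin S) :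
    Continuous fun z => startEnergy β D h p q z s := by
  unfold startEnergy siteEnergy
  fun_prop

/-- At the start of the path the sites do not interact. -/
lemma pathEnergy_zero (N β D h p q : ℝ) (g : Edge n ⊕ Fin n → ℝ) (σ : Config S n) :
    pathEnergy N β D h p q 0 g σ = ∑ i, startEnergy β D h p q (g (Sum.inr i)) (σ i) := by
  simp only [pathEnergy, gaussEnergy, pathCoef, pathField, Fintype.sum_sum_type, Sum.elim_inl,
    Sum.elim_inr, Real.sin_zero, Real.cos_zero, zero_mul, Finset.sum_const_zero, zero_add, one_pow,
    one_mul, startEnergy, siteEnergy, shift, overlap, Finset.mul_sum, ← Finset.sum_add_distrib]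
  refine Finset.sum_congr rfl fun i _ => ?_
  simp only [spin, spinVal]
  ring

lemma continuous_comp_uncurry {X : Type*} [TopologicalSpace X] {F : ℝ → ℝ → ℝ}
    (hF : Continuous fun z : ℝ × ℝ => F z.1 z.2) {φ ψ : X → ℝ} (hφ : Continuous φ)
    (hψ : Continuous ψ) : Continuous fun x => F (φ x) (ψ x) := hF.comp (hφ.prodMk hψ)

/-- The first fixed point equation centres the squares of the spins at the start of the path. -/
lemma integral_gibbs_startEnergy_sq {β D h p q : ℝ} (hpq : IsFixedPoint S β D h p q) :
    ∫ z, gibbs (startEnergy (S := S) β D h p q z) (fun s => spinVal s ^ 2 - p) ∂stdGaussian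
      = 0 := by
  have e : ∀ z, gibbs (startEnergy (S := S) β D h p q z) (fun s => spinVal s ^ 2 - p)
      = chRatio S (shift β D p q) (√q * β * z + h) - p := fun z => by
    rw [gibbs_sub, gibbs_const, chRatio_eq_gibbs]; rfl
  simp only [e]
  rw [integral_sub _ (integrable_const _), ← hpq.2.1]
  · simp
  · have hc : Continuous fun z : ℝ => chRatio S (shift β D p q) (√q * β * z + h) :=
      continuous_comp_uncurry (F := chRatio S) continuous_chRatio continuous_const (by fun_prop)
    exact integrable_of_continuous_of_bounded hc _ fun z => abs_chRatio_le _ _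

/-- The second fixed point equation centres the products of the spins of two replicas. -/
lemma integral_gibbs_startEnergy_mul {β D h p q : ℝ} (hpq : IsFixedPoint S β D h p q) :
    ∫ z, gibbs (pairEnergy (startEnergy (S := S) β D h p q z) (startEnergy (S := S) β D h p q z))
      (fun x => spinVal x.1 * spinVal x.2 - q) ∂stdGaussian = 0 := by
  have e : ∀ z, gibbs (pairEnergy (startEnergy (S := S) β D h p q z)
      (startEnergy (S := S) β D h p q z)) (fun x => spinVal x.1 * spinVal x.2 - q)
      = shRatio S (shift β D p q) (√q * β * z + h) ^ 2 - q := fun z => by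
    rw [gibbs_sub, gibbs_const, gibbs_pair_mul, shRatio_eq_gibbs, sq]; rfl
  simp only [e]
  rw [integral_sub _ (integrable_const _), ← hpq.2.2]
  · simp
  · have hc : Continuous fun z : ℝ => shRatio S (shift β D p q) (√q * β * z + h) :=
      continuous_comp_uncurry (F := shRatio S) continuous_shRatio continuous_const (by fun_prop)
    refine integrable_of_continuous_of_bounded (hc.pow 2) ((S : ℝ) ^ 2) fun z => ?_
    rw [abs_pow]
    exact pow_le_pow_left₀ (abs_nonneg _) (abs_shRatio_le _ _) 2

lemma exp_add_add_le (x y z : ℝ) :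
    Real.exp (x + y + z) ≤ (Real.exp (3 * x) + Real.exp (3 * y) + Real.exp (3 * z)) / 3 := by
  have e : ∀ x : ℝ, Real.exp (3 * x) = Real.exp x ^ 3 := fun x => by
    rw [← Real.exp_nat_mul]; norm_num
  rw [e, e, e, Real.exp_add, Real.exp_add]
  have hx := Real.exp_pos x
  have hy := Real.exp_pos y
  have hz := Real.exp_pos z
  generalize Real.exp x = a at *
  generalize Real.exp y = b at *
  generalize Real.exp z = c at *
  nlinarith [mul_nonneg (add_pos (add_pos hx hy) hz).le
    (add_nonneg (add_nonneg (sq_nonneg (a - b)) (sq_nonneg (b - c))) (sq_nonneg (a - c)))]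

/-- A shift by a bounded constant costs a bounded factor in the exponential moment of a square. -/
lemma exp_sub_sq_le {lam N x r : ℝ} (hlam : 0 ≤ lam) (hN : 1 ≤ N) (hr : 6 * lam * r ^ 2 ≤ 1) :
    Real.exp (3 * (lam / N * (x - r) ^ 2)) ≤ 3 * Real.exp (6 * lam / N * x ^ 2) := by
  have hN0 : 0 < N := by linarith
  have h1 : 3 * (lam / N * (x - r) ^ 2) ≤ 1 + 6 * lam / N * x ^ 2 := by
    have a1 : (x - r) ^ 2 ≤ 2 * x ^ 2 + 2 * r ^ 2 := by nlinarith [sq_nonneg (x + r)]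
    have a2 : lam / N * (x - r) ^ 2 ≤ lam / N * (2 * x ^ 2 + 2 * r ^ 2) := by gcongr
    have a3 : 6 * lam * r ^ 2 / N ≤ 1 := by
      rw [div_le_one hN0]; linarith
    have a4 : 3 * (lam / N * (2 * x ^ 2 + 2 * r ^ 2))
        = 6 * lam * r ^ 2 / N + 6 * lam / N * x ^ 2 := by ring
    linarith
  refine (Real.exp_le_exp.2 h1).trans ?_
  rw [Real.exp_add]
  gcongr
  exact Real.exp_one_lt_three.le

/-- The exponential moment of the squared deviation of the overlap of two replicas at the start of
the path. The value of `lam` is the largest for which `integral_gibbs_exp_sq_sum_le` applies to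
`6 lam / N` and observables of a site bounded by `2 S²`. -/
lemma integral_gibbs_pair_exp_le {N β D h p q lam : ℝ} (hS : 1 ≤ S) (hN : N = n + 1)
    (hlam : lam = 1 / (96 * (S : ℝ) ^ 4)) (hpq : IsFixedPoint S β D h p q) :
    ∫ g, gibbs (pairEnergy (pathEnergy (S := S) (n := n) N β D h p q 0 g)
          (pathEnergy N β D h p q 0 g))
        (fun x => Real.exp (3 * (lam / N * (overlap x.1 x.2 - N * q) ^ 2)))
        ∂gaussianPi (Edge n ⊕ Fin n) ≤ 6 := by
  have hS0 : (0 : ℝ) < S := by exact_mod_cast hS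
  have hN1 : 1 ≤ N := by rw [hN]; linarith [Nat.cast_nonneg (α := ℝ) n]
  have hN0 : 0 < N := by linarith
  have hlam0 : 0 ≤ lam := by rw [hlam]; positivity
  have hlS : lam * (S : ℝ) ^ 4 = 1 / 96 := by rw [hlam]; field_simp
  have hq2 : q ^ 2 ≤ (S : ℝ) ^ 4 := by
    rw [← sq_abs]
    calc |q| ^ 2 ≤ ((S : ℝ) ^ 2) ^ 2 := pow_le_pow_left₀ (abs_nonneg _) hpq.abs_le.2 2
      _ = _ := by ring
  have hq1 : 6 * lam * q ^ 2 ≤ 1 := by nlinarith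
  have hψ : ∀ x : Spin S × Spin S, |spinVal x.1 * spinVal x.2 - q| ≤ 2 * (S : ℝ) ^ 2 := by
    intro x
    refine (abs_sub _ _).trans ?_
    rw [abs_mul]
    have h1 := mul_le_mul (abs_spinVal_le x.1) (abs_spinVal_le x.2) (abs_nonneg _) hS0.le
    linarith [hpq.abs_le.2]
  have key := integral_gibbs_exp_sq_sum_le (E := Edge n) (ι := Fin n)
    (e := fun z => pairEnergy (startEnergy (S := S) β D h p q z) (startEnergy β D h p q z))
    (fun x => (continuous_startEnergy β D h p q x.1).add (continuous_startEnergy β D h p q x.2))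
    (by positivity) hψ (integral_gibbs_startEnergy_mul hpq) (a := 6 * lam / N) (by positivity)
    (by
      rw [Fintype.card_fin]
      have : 6 * lam / N * (2 * (S : ℝ) ^ 2) ^ 2 * n = 24 * (lam * (S : ℝ) ^ 4) * (n / N) := by
        ring
      rw [this, hlS]
      have : (n : ℝ) / N ≤ 1 := by rw [div_le_one hN0, hN]; linarith
      linarith)
  have hequiv : ∀ g : Edge n ⊕ Fin n → ℝ,
      gibbs (fun σ : Fin n → Spin S × Spin S => ∑ i,
          pairEnergy (startEnergy β D h p q (g (Sum.inr i)))
            (startEnergy β D h p q (g (Sum.inr i))) (σ i))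
        (fun σ => Real.exp (6 * lam / N * (∑ i, (spinVal (σ i).1 * spinVal (σ i).2 - q)) ^ 2))
      = gibbs (pairEnergy (pathEnergy (S := S) (n := n) N β D h p q 0 g)
          (pathEnergy N β D h p q 0 g))
        (fun x => Real.exp (6 * lam / N * (overlap x.1 x.2 - n * q) ^ 2)) := by
    intro g
    rw [← gibbs_equiv (Equiv.arrowProdEquivProdArrow (Fin n) (fun _ => Spin S) fun _ => Spin S)]
    congr 1
    · funext σ
      simp only [pairEnergy, pathEnergy_zero, Finset.sum_add_distrib]
      rfl
    · funext σ
      congr 3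
      rw [Finset.sum_sub_distrib]
      simp [overlap, spin, spinVal]
  have hint : ∀ f, Integrable (fun g => gibbs (pairEnergy
      (pathEnergy (S := S) (n := n) N β D h p q 0 g) (pathEnergy N β D h p q 0 g)) f)
      (gaussianPi (Edge n ⊕ Fin n)) := fun f => integrable_gibbs_pairEnergy N β D h p q 0 f
  simp only [hequiv] at key
  calc _ ≤ ∫ g, 3 * gibbs (pairEnergy (pathEnergy (S := S) (n := n) N β D h p q 0 g)
          (pathEnergy N β D h p q 0 g))
        (fun x => Real.exp (6 * lam / N * (overlap x.1 x.2 - n * q) ^ 2))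
        ∂gaussianPi (Edge n ⊕ Fin n) := by
        refine integral_mono (hint _) ((hint _).const_mul 3) fun g => ?_
        simp only
        rw [← gibbs_const_mul]
        refine gibbs_mono _ fun x => ?_
        have := exp_sub_sq_le (x := overlap x.1 x.2 - n * q) hlam0 hN1 hq1
        refine le_trans (le_of_eq ?_) this
        rw [hN]
        congr 4
        ring
    _ ≤ 6 := by rw [integral_const_mul]; linarith

/-- The same for the self-overlap. -/
lemma integral_gibbs_exp_le_six {N β D h p q lam : ℝ} (hS : 1 ≤ S) (hN : N = n + 1)
    (hlam : lam = 1 / (96 * (S : ℝ) ^ 4)) (hpq : IsFixedPoint S β D h p q) :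
    ∫ g, gibbs (pathEnergy (S := S) (n := n) N β D h p q 0 g)
        (fun σ => Real.exp (3 * (lam / N * (overlap σ σ - N * p) ^ 2)))
        ∂gaussianPi (Edge n ⊕ Fin n) ≤ 6 := by
  have hS0 : (0 : ℝ) < S := by exact_mod_cast hS
  have hN1 : 1 ≤ N := by rw [hN]; linarith [Nat.cast_nonneg (α := ℝ) n]
  have hN0 : 0 < N := by linarith
  have hlam0 : 0 ≤ lam := by rw [hlam]; positivity
  have hlS : lam * (S : ℝ) ^ 4 = 1 / 96 := by rw [hlam]; field_simp
  have hp2 : p ^ 2 ≤ (S : ℝ) ^ 4 := by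
    rw [← sq_abs]
    calc |p| ^ 2 ≤ ((S : ℝ) ^ 2) ^ 2 := pow_le_pow_left₀ (abs_nonneg _) hpq.abs_le.1 2
      _ = _ := by ring
  have hp1 : 6 * lam * p ^ 2 ≤ 1 := by nlinarith
  have hψ : ∀ x : Spin S, |spinVal x ^ 2 - p| ≤ 2 * (S : ℝ) ^ 2 := by
    intro x
    refine (abs_sub _ _).trans ?_
    rw [abs_pow]
    have h1 := pow_le_pow_left₀ (abs_nonneg _) (abs_spinVal_le x) 2
    linarith [hpq.abs_le.1]
  have key := integral_gibbs_exp_sq_sum_le (E := Edge n) (ι := Fin n)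
    (e := fun z => startEnergy (S := S) β D h p q z)
    (fun x => continuous_startEnergy β D h p q x)
    (by positivity) hψ (integral_gibbs_startEnergy_sq hpq) (a := 6 * lam / N) (by positivity)
    (by
      rw [Fintype.card_fin]
      have : 6 * lam / N * (2 * (S : ℝ) ^ 2) ^ 2 * n = 24 * (lam * (S : ℝ) ^ 4) * (n / N) := by
        ring
      rw [this, hlS]
      have : (n : ℝ) / N ≤ 1 := by rw [div_le_one hN0, hN]; linarith
      linarith)
  have hequiv : ∀ g : Edge n ⊕ Fin n → ℝ,
      gibbs (fun σ : Fin n → Spin S => ∑ i, startEnergy β D h p q (g (Sum.inr i)) (σ i))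
        (fun σ => Real.exp (6 * lam / N * (∑ i, (spinVal (σ i) ^ 2 - p)) ^ 2))
      = gibbs (pathEnergy (S := S) (n := n) N β D h p q 0 g)
        (fun σ => Real.exp (6 * lam / N * (overlap σ σ - n * p) ^ 2)) := by
    intro g
    congr 1
    · funext σ
      rw [pathEnergy_zero]
    · funext σ
      congr 3
      rw [Finset.sum_sub_distrib]
      simp [overlap, spin, spinVal, sq]
  have hint : ∀ f, Integrable (fun g => gibbs (pathEnergy (S := S) (n := n) N β D h p q 0 g) f)
      (gaussianPi (Edge n ⊕ Fin n)) := fun f => integrable_gibbs _ _ f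
  simp only [hequiv] at key
  calc _ ≤ ∫ g, 3 * gibbs (pathEnergy (S := S) (n := n) N β D h p q 0 g)
        (fun σ => Real.exp (6 * lam / N * (overlap σ σ - n * p) ^ 2))
        ∂gaussianPi (Edge n ⊕ Fin n) := by
        refine integral_mono (hint _) ((hint _).const_mul 3) fun g => ?_
        simp only
        rw [← gibbs_const_mul]
        refine gibbs_mono _ fun σ => ?_
        have := exp_sub_sq_le (x := overlap σ σ - n * p) hlam0 hN1 hp1
        refine le_trans (le_of_eq ?_) this
        rw [hN]
        congr 4
        ring
    _ ≤ 6 := by rw [integral_const_mul]; linarith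

/-- At the start of the path the excess free energy is bounded, since the overlaps are sums of
independent variables which the fixed point equations centre. -/
lemma excessFree_zero_le {N β D h p q lam : ℝ} (hS : 1 ≤ S) (hN : N = n + 1)
    (hlam : lam = 1 / (96 * (S : ℝ) ^ 4)) (hpq : IsFixedPoint S β D h p q) :
    excessFree S n N β D h p q lam 0 ≤ 6 := by
  obtain ⟨e, i⟩ := excessFree_eq_integral (S := S) (n := n) N β D h p q lam 0
  have hint : ∀ f, Integrable (fun g => gibbs (pairEnergy
      (pathEnergy (S := S) (n := n) N β D h p q 0 g) (pathEnergy N β D h p q 0 g)) f)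
      (gaussianPi (Edge n ⊕ Fin n)) := fun f => integrable_gibbs_pairEnergy N β D h p q 0 f
  have hint' : ∀ f, Integrable (fun g => gibbs (pathEnergy (S := S) (n := n) N β D h p q 0 g) f)
      (gaussianPi (Edge n ⊕ Fin n)) := fun f => integrable_gibbs _ _ f
  have b1 := integral_gibbs_pair_exp_le (n := n) hS hN hlam hpq
  have b2 := integral_gibbs_exp_le_six (n := n) hS hN hlam hpq
  rw [e]
  calc _ ≤ ∫ g, (gibbs (pairEnergy (pathEnergy (S := S) (n := n) N β D h p q 0 g)
          (pathEnergy N β D h p q 0 g))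
        (fun x => Real.exp (3 * (lam / N * (overlap x.1 x.2 - N * q) ^ 2)))
        + 2 * gibbs (pathEnergy (S := S) (n := n) N β D h p q 0 g)
        (fun σ => Real.exp (3 * (lam / N * (overlap σ σ - N * p) ^ 2)))) / 3
        ∂gaussianPi (Edge n ⊕ Fin n) := by
        refine integral_mono i (((hint _).add ((hint' _).const_mul 2)).div_const 3) fun g => ?_
        simp only
        set E := pathEnergy (S := S) (n := n) N β D h p q 0 g
        have hpos : 0 < gibbs (pairEnergy E E) (fun x =>
            Real.exp (couplingStrength lam β 0 / N * deviation N p q x)) :=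
          (Real.exp_pos _).trans_le (exp_gibbs_le _ _)
        refine (Real.log_le_sub_one_of_pos hpos).trans ?_
        -- The three squares in the exponent are separated by the inequality of arithmetic and
        -- geometric means.
        have h1 := gibbs_mono (pairEnergy E E)
          (f := fun x => Real.exp (couplingStrength lam β 0 / N * deviation N p q x))
          (g := fun x => (Real.exp (3 * (lam / N * (overlap x.1 x.2 - N * q) ^ 2))
            + Real.exp (3 * (lam / N * (overlap x.1 x.1 - N * p) ^ 2))
            + Real.exp (3 * (lam / N * (overlap x.2 x.2 - N * p) ^ 2))) * (1 / 3)) fun x => by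
          refine le_trans (le_of_eq ?_) ((exp_add_add_le _ _ _).trans_eq (div_eq_mul_one_div _ _))
          unfold deviation couplingStrength
          rw [Real.sin_zero]
          congr 1
          ring
        rw [gibbs_mul_const, gibbs_add, gibbs_add,
          gibbs_pair_fst E E (fun σ => Real.exp (3 * (lam / N * (overlap σ σ - N * p) ^ 2))),
          gibbs_pair_snd E E (fun σ => Real.exp (3 * (lam / N * (overlap σ σ - N * p) ^ 2)))] at h1
        linarith
    _ ≤ 6 := by
        rw [integral_div, integral_add (hint _) ((hint' _).const_mul 2), integral_const_mul]
        linarith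

/-- The overlaps of the system at the end of the path concentrate, uniformly in `D` and `h`. -/
lemma meanDeviation_pi_div_two_le {N β D h p q : ℝ} (hS : 1 ≤ S) (hN : N = n + 1)
    (hβ : β ^ 2 ≤ 1 / (96 * (S : ℝ) ^ 4)) (hpq : IsFixedPoint S β D h p q) :
    meanDeviation S n N β D h p q (Real.pi / 2)
      ≤ 576 * (S : ℝ) ^ 4 * (6 + 2 * (S : ℝ) ^ 4) * N := by
  have hS1 : (1 : ℝ) ≤ S := by exact_mod_cast hS
  have hS0 : (0 : ℝ) < S := by linarith
  have hN1 : 1 ≤ N := by rw [hN]; linarith [Nat.cast_nonneg (α := ℝ) n]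
  have hN0 : 0 < N := by linarith
  set lam := 1 / (96 * (S : ℝ) ^ 4) with hlam
  have hlam0 : 0 < lam := by positivity
  have hlam1 : lam ≤ 1 := by
    rw [hlam, div_le_one (by positivity)]
    have := one_le_pow₀ hS1 (n := 4)
    linarith
  have h1 := excessFree_pi_div_two_le (S := S) (n := n) hN0 (by rw [hN]; linarith) hpq.1
    (hβ.trans hlam1) hβ D h p
  have h2 := excessFree_zero_le (n := n) hS hN hlam hpq
  have h3 := meanDeviation_le_excessFree (S := S) (n := n) N β D h p q lam (Real.pi / 2)
  have h4 : lam / 2 ≤ couplingStrength lam β (Real.pi / 2) := by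
    unfold couplingStrength
    rw [Real.sin_pi_div_two]
    linarith
  have h5 : 0 ≤ meanDeviation S n N β D h p q (Real.pi / 2) :=
    integral_nonneg fun g => gibbs_nonneg _ fun x => deviation_nonneg N p q x
  have h6 : lam / 2 / N * meanDeviation S n N β D h p q (Real.pi / 2)
      ≤ 3 * (6 + 2 * (S : ℝ) ^ 4) := by
    refine le_trans ?_ (h3.trans (h1.trans (by linarith)))
    gcongr
  have h7 : meanDeviation S n N β D h p q (Real.pi / 2)
      = 192 * (S : ℝ) ^ 4 * N * (lam / 2 / N * meanDeviation S n N β D h p q (Real.pi / 2)) := by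
    rw [hlam]; field_simp; ring
  rw [h7]
  calc _ ≤ 192 * (S : ℝ) ^ 4 * N * (3 * (6 + 2 * (S : ℝ) ^ 4)) := by gcongr
    _ = _ := by ring

end Initial

/-! ### Gaussian projections of a Gibbs measure -/

section Cavity

variable {α ι : Type*} [Fintype α] [Fintype ι]

lemma integral_gibbs {X : Type*} [MeasurableSpace X] {μ : Measure X} (H : α → ℝ) {f : X → α → ℝ}
    (hf : ∀ a, Integrable (fun x => f x a) μ) :
    ∫ x, gibbs H (f x) ∂μ = gibbs H (fun a => ∫ x, f x a ∂μ) := by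
  simp only [gibbs]
  rw [integral_div, integral_finsetSum _ fun a _ => (hf a).mul_const _]
  simp only [integral_mul_const]

lemma integrable_gibbs_of_integrable {X : Type*} [MeasurableSpace X] {μ : Measure X} (H : α → ℝ)
    {f : X → α → ℝ} (hf : ∀ a, Integrable (fun x => f x a) μ) :
    Integrable (fun x => gibbs H (f x)) μ := by
  simp only [gibbs]
  exact (integrable_finsetSum _ fun a _ => (hf a).mul_const _).div_const _

/-- The scalar product. -/
def dot (u v : ι → ℝ) : ℝ := ∑ i, u i * v i

/-- The exponential moment `⟨exp (t v·g)⟩` of a Gaussian projection. -/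
def expMoment (H : α → ℝ) (v : α → ι → ℝ) (t : ℝ) (g : ι → ℝ) : ℝ :=
  gibbs H (fun a => Real.exp (t * dot (v a) g))

/-- The tilted mean `⟨v·g exp (t v·g)⟩` of a Gaussian projection. -/
def tiltedMean (H : α → ℝ) (v : α → ι → ℝ) (t : ℝ) (g : ι → ℝ) : ℝ :=
  gibbs H (fun a => dot (v a) g * Real.exp (t * dot (v a) g))

lemma gibbs_mul_self (H f : α → ℝ) :
    gibbs H f ^ 2 = gibbs (pairEnergy H H) (fun x => f x.1 * f x.2) := by
  rw [gibbs_pair_mul, sq]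

lemma exp_mul_dot (t : ℝ) (v g : ι → ℝ) :
    Real.exp (t * dot v g) = Real.exp (∑ i, (t * v i) * g i) := by
  rw [dot, Finset.mul_sum]; simp only [mul_assoc]

lemma exp_mul_dot_mul (t : ℝ) (v w g : ι → ℝ) :
    Real.exp (t * dot v g) * Real.exp (t * dot w g)
      = Real.exp (∑ i, (t * (v i + w i)) * g i) := by
  rw [← Real.exp_add, dot, dot, ← mul_add, ← Finset.sum_add_distrib, Finset.mul_sum]
  congr 1
  exact Finset.sum_congr rfl fun i _ => by ring

lemma sum_sq_mul_add (t : ℝ) (v w : ι → ℝ) :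
    ∑ i, (t * (v i + w i)) ^ 2 = t ^ 2 * (dot v v + dot w w + 2 * dot v w) := by
  simp only [dot, Finset.mul_sum, ← Finset.sum_add_distrib]
  exact Finset.sum_congr rfl fun i _ => by ring

lemma sum_mul_mul_add (t : ℝ) (u v w : ι → ℝ) :
    ∑ i, u i * (t * (v i + w i)) = t * (dot u v + dot u w) := by
  simp only [dot, Finset.mul_sum, ← Finset.sum_add_distrib]
  exact Finset.sum_congr rfl fun i _ => by ring

lemma integrable_exp_mul_dot (t : ℝ) (v : ι → ℝ) :
    Integrable (fun g => Real.exp (t * dot v g)) (gaussianPi ι) := by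
  simp only [exp_mul_dot]
  exact integrable_exp_linear _

lemma integral_exp_mul_dot (t : ℝ) (v : ι → ℝ) :
    ∫ g, Real.exp (t * dot v g) ∂gaussianPi ι = Real.exp (t ^ 2 / 2 * dot v v) := by
  simp only [exp_mul_dot]
  rw [integral_exp_linear]
  congr 1
  rw [Finset.sum_div]
  exact Finset.sum_congr rfl fun i _ => by ring

/-- The two-replica formula for the deviation of an exponential moment from a constant. -/
lemma integral_expMoment_sub_sq [Nonempty α] (H : α → ℝ) (v : α → ι → ℝ) (t V : ℝ) :
    Integrable (fun g => (expMoment H v t g - V) ^ 2) (gaussianPi ι) ∧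
    ∫ g, (expMoment H v t g - V) ^ 2 ∂gaussianPi ι
      = gibbs (pairEnergy H H) (fun x =>
          Real.exp (t ^ 2 / 2 * (dot (v x.1) (v x.1) + dot (v x.2) (v x.2)
            + 2 * dot (v x.1) (v x.2)))
          - V * Real.exp (t ^ 2 / 2 * dot (v x.1) (v x.1))
          - V * Real.exp (t ^ 2 / 2 * dot (v x.2) (v x.2)) + V ^ 2) := by
  have e : ∀ g, (expMoment H v t g - V) ^ 2 = gibbs (pairEnergy H H) (fun x =>
      Real.exp (∑ i, (t * (v x.1 i + v x.2 i)) * g i) - V * Real.exp (t * dot (v x.1) g)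
        - V * Real.exp (t * dot (v x.2) g) + V ^ 2) := by
    intro g
    rw [expMoment, ← gibbs_const H V, ← gibbs_sub, gibbs_mul_self]
    congr 1
    funext x
    rw [gibbs_const, ← exp_mul_dot_mul]
    ring
  have i1 : ∀ x : α × α, Integrable (fun g : ι → ℝ =>
      Real.exp (∑ i, (t * (v x.1 i + v x.2 i)) * g i)) (gaussianPi ι) := fun x =>
    integrable_exp_linear _
  have i2 := fun a => (integrable_exp_mul_dot t (v a)).const_mul V
  have i3 := fun x : α × α => (((i1 x).sub (i2 x.1)).sub (i2 x.2)).add (integrable_const (V ^ 2))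
  simp only [e]
  refine ⟨integrable_gibbs_of_integrable _ i3, ?_⟩
  refine (integral_gibbs _ i3).trans ?_
  congr 1
  funext x
  refine (integral_add (((i1 x).sub (i2 x.1)).sub (i2 x.2)) (integrable_const _)).trans ?_
  refine congrArg₂ _ ((integral_sub ((i1 x).sub (i2 x.1)) (i2 x.2)).trans
    (congrArg₂ _ ((integral_sub (i1 x) (i2 x.1)).trans (congrArg₂ _ ?_ ?_)) ?_)) ?_
  · rw [integral_exp_linear, sum_sq_mul_add]
    congr 1; ring
  · rw [integral_const_mul, integral_exp_mul_dot]
  · rw [integral_const_mul, integral_exp_mul_dot]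
  · simp

/-- The two-replica formula for the deviation of a tilted mean from `t r` times the exponential
moment. -/
lemma integral_tiltedMean_sub_sq (H : α → ℝ) (v : α → ι → ℝ) (t r : ℝ) :
    Integrable (fun g => (tiltedMean H v t g - t * r * expMoment H v t g) ^ 2) (gaussianPi ι) ∧
    ∫ g, (tiltedMean H v t g - t * r * expMoment H v t g) ^ 2 ∂gaussianPi ι
      = gibbs (pairEnergy H H) (fun x =>
          (dot (v x.1) (v x.2) + t ^ 2 * (dot (v x.1) (v x.1) + dot (v x.1) (v x.2) - r)
            * (dot (v x.2) (v x.2) + dot (v x.1) (v x.2) - r))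
          * Real.exp (t ^ 2 / 2 * (dot (v x.1) (v x.1) + dot (v x.2) (v x.2)
            + 2 * dot (v x.1) (v x.2)))) := by
  set m : α × α → ι → ℝ := fun x i => t * (v x.1 i + v x.2 i) with hm
  have e : ∀ g, (tiltedMean H v t g - t * r * expMoment H v t g) ^ 2
      = gibbs (pairEnergy H H) (fun x =>
        (∑ i, v x.1 i * g i) * ((∑ i, v x.2 i * g i) * Real.exp (∑ i, m x i * g i))
        - t * r * ((∑ i, v x.1 i * g i) * Real.exp (∑ i, m x i * g i))
        - t * r * ((∑ i, v x.2 i * g i) * Real.exp (∑ i, m x i * g i))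
        + (t * r) ^ 2 * Real.exp (∑ i, m x i * g i)) := by
    intro g
    rw [tiltedMean, expMoment, ← gibbs_const_mul, ← gibbs_sub, gibbs_mul_self]
    congr 1
    funext x
    rw [hm, ← exp_mul_dot_mul]
    simp only [dot]
    ring
  have i1 : ∀ x : α × α, Integrable (fun g : ι → ℝ =>
      (∑ i, v x.1 i * g i) * ((∑ i, v x.2 i * g i) * Real.exp (∑ i, m x i * g i)))
      (gaussianPi ι) := fun x => integrable_linear_mul_linear_mul_exp _ _ _
  have i2 : ∀ (x : α × α) (a : α), Integrable (fun g : ι → ℝ =>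
      t * r * ((∑ i, v a i * g i) * Real.exp (∑ i, m x i * g i))) (gaussianPi ι) := fun x a =>
    (integrable_linear_mul_exp _ _).const_mul _
  have i3 : ∀ x : α × α, Integrable (fun g : ι → ℝ =>
      (t * r) ^ 2 * Real.exp (∑ i, m x i * g i)) (gaussianPi ι) := fun x =>
    (integrable_exp_linear _).const_mul _
  have i4 := fun x : α × α => (((i1 x).sub (i2 x x.1)).sub (i2 x x.2)).add (i3 x)
  simp only [e]
  refine ⟨integrable_gibbs_of_integrable _ i4, ?_⟩
  refine (integral_gibbs _ i4).trans ?_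
  congr 1
  funext x
  refine (integral_add (((i1 x).sub (i2 x x.1)).sub (i2 x x.2)) (i3 x)).trans ?_
  refine (congrArg₂ _ ((integral_sub ((i1 x).sub (i2 x x.1)) (i2 x x.2)).trans
    (congrArg₂ _ (integral_sub (i1 x) (i2 x x.1)) rfl)) rfl).trans ?_
  rw [integral_linear_mul_linear_mul_exp, integral_const_mul, integral_const_mul,
    integral_const_mul, integral_linear_mul_exp, integral_linear_mul_exp, integral_exp_linear]
  simp only [hm, sum_sq_mul_add, sum_mul_mul_add]
  have hc : dot (v x.2) (v x.1) = dot (v x.1) (v x.2) := by simp only [dot, mul_comm]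
  have hc' : ∑ i, v x.1 i * v x.2 i = dot (v x.1) (v x.2) := rfl
  rw [hc, hc', div_mul_eq_mul_div]
  ring

lemma abs_exp_sub_exp_le {x y C : ℝ} (hx : x ≤ C) (hy : y ≤ C) :
    |Real.exp x - Real.exp y| ≤ Real.exp C * |x - y| := by
  wlog hxy : y ≤ x generalizing x y
  · rw [abs_sub_comm, abs_sub_comm x y]
    exact this hy hx (le_of_not_ge hxy)
  rw [abs_of_nonneg (sub_nonneg.2 (Real.exp_le_exp.2 hxy)), abs_of_nonneg (sub_nonneg.2 hxy)]
  have h1 : Real.exp x * (y - x + 1) ≤ Real.exp y := by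
    calc _ ≤ Real.exp x * Real.exp (y - x) := by gcongr; exact Real.add_one_le_exp _
      _ = Real.exp y := by rw [← Real.exp_add]; congr 1; ring
  calc Real.exp x - Real.exp y ≤ Real.exp x * (x - y) := by linarith
    _ ≤ _ := by
      have := sub_nonneg.2 hxy
      gcongr

/-- The integrand of the two-replica formula for the exponential moment is small when the
projections have variance close to `r` and are nearly uncorrelated. -/
lemma expMoment_integrand_le {s t A A' B r : ℝ} (ht : t ^ 2 ≤ s) (hA : |A| ≤ 4 * s)
    (hA' : |A'| ≤ 4 * s) (hB : |B| ≤ 4 * s) (hr : |r| ≤ 2 * s) :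
    Real.exp (t ^ 2 / 2 * (A + A' + 2 * B))
        - Real.exp (t ^ 2 / 2 * r) * Real.exp (t ^ 2 / 2 * A)
        - Real.exp (t ^ 2 / 2 * r) * Real.exp (t ^ 2 / 2 * A') + Real.exp (t ^ 2 / 2 * r) ^ 2
      ≤ s * Real.exp (8 * s ^ 2) * (|B| + |A - r|) := by
  have ht0 := sq_nonneg t
  have hs : 0 ≤ s := ht0.trans ht
  have hb : ∀ {x c : ℝ}, |x| ≤ c → t ^ 2 * x ≤ s * c := fun {x c} hx => by
    calc t ^ 2 * x ≤ t ^ 2 * |x| := by gcongr; exact le_abs_self x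
      _ ≤ s * c := by gcongr
  have bA := hb hA
  have bA' := hb hA'
  have bB := hb hB
  have br := hb hr
  have hss : 0 ≤ s ^ 2 := sq_nonneg s
  have e1 : Real.exp (t ^ 2 / 2 * (A + A' + 2 * B))
      = Real.exp (t ^ 2 / 2 * (A + A')) * Real.exp (t ^ 2 * B) := by
    rw [← Real.exp_add]; congr 1; ring
  have e2 : Real.exp (t ^ 2 / 2 * (A + A'))
      = Real.exp (t ^ 2 / 2 * A) * Real.exp (t ^ 2 / 2 * A') := by
    rw [← Real.exp_add]; congr 1; ring
  have f1 : Real.exp (t ^ 2 / 2 * (A + A')) ≤ Real.exp (4 * s ^ 2) :=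
    Real.exp_le_exp.2 (by nlinarith)
  have f2 : |Real.exp (t ^ 2 * B) - 1| ≤ Real.exp (4 * s ^ 2) * (s * |B|) := by
    have := abs_exp_sub_exp_le (x := t ^ 2 * B) (y := 0) (C := 4 * s ^ 2) (by nlinarith)
      (by positivity)
    rw [Real.exp_zero, sub_zero, abs_mul, abs_of_nonneg ht0] at this
    exact this.trans (by gcongr)
  have f3 : |Real.exp (t ^ 2 / 2 * A) - Real.exp (t ^ 2 / 2 * r)|
      ≤ Real.exp (2 * s ^ 2) * (s / 2 * |A - r|) := by
    have := abs_exp_sub_exp_le (x := t ^ 2 / 2 * A) (y := t ^ 2 / 2 * r) (C := 2 * s ^ 2)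
      (by nlinarith) (by nlinarith)
    rw [← mul_sub, abs_mul, abs_of_nonneg (by positivity : 0 ≤ t ^ 2 / 2)] at this
    exact this.trans (by gcongr)
  have f4 : |Real.exp (t ^ 2 / 2 * A') - Real.exp (t ^ 2 / 2 * r)| ≤ 2 * Real.exp (2 * s ^ 2) := by
    refine (abs_sub _ _).trans ?_
    rw [Real.abs_exp, Real.abs_exp]
    have g1 : Real.exp (t ^ 2 / 2 * A') ≤ Real.exp (2 * s ^ 2) :=
      Real.exp_le_exp.2 (by nlinarith)
    have g2 : Real.exp (t ^ 2 / 2 * r) ≤ Real.exp (2 * s ^ 2) :=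
      Real.exp_le_exp.2 (by nlinarith)
    linarith
  have e3 : Real.exp (t ^ 2 / 2 * (A + A' + 2 * B))
        - Real.exp (t ^ 2 / 2 * r) * Real.exp (t ^ 2 / 2 * A)
        - Real.exp (t ^ 2 / 2 * r) * Real.exp (t ^ 2 / 2 * A') + Real.exp (t ^ 2 / 2 * r) ^ 2
      = Real.exp (t ^ 2 / 2 * (A + A')) * (Real.exp (t ^ 2 * B) - 1)
        + (Real.exp (t ^ 2 / 2 * A) - Real.exp (t ^ 2 / 2 * r))
          * (Real.exp (t ^ 2 / 2 * A') - Real.exp (t ^ 2 / 2 * r)) := by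
    rw [e1, e2]; ring
  have e8 : Real.exp (8 * s ^ 2) = Real.exp (4 * s ^ 2) * Real.exp (4 * s ^ 2) := by
    rw [← Real.exp_add]; congr 1; ring
  have e4 : Real.exp (4 * s ^ 2) = Real.exp (2 * s ^ 2) * Real.exp (2 * s ^ 2) := by
    rw [← Real.exp_add]; congr 1; ring
  have h48 : Real.exp (4 * s ^ 2) ≤ Real.exp (8 * s ^ 2) := Real.exp_le_exp.2 (by linarith)
  rw [e3]
  calc _ ≤ |Real.exp (t ^ 2 / 2 * (A + A')) * (Real.exp (t ^ 2 * B) - 1)|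
        + |(Real.exp (t ^ 2 / 2 * A) - Real.exp (t ^ 2 / 2 * r))
          * (Real.exp (t ^ 2 / 2 * A') - Real.exp (t ^ 2 / 2 * r))| :=
        add_le_add (le_abs_self _) (le_abs_self _)
    _ ≤ Real.exp (4 * s ^ 2) * (Real.exp (4 * s ^ 2) * (s * |B|))
        + Real.exp (2 * s ^ 2) * (s / 2 * |A - r|) * (2 * Real.exp (2 * s ^ 2)) := by
        rw [abs_mul, abs_mul, Real.abs_exp]
        gcongr
    _ = Real.exp (8 * s ^ 2) * (s * |B|) + Real.exp (4 * s ^ 2) * (s * |A - r|) := by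
        rw [e8, e4]; ring
    _ ≤ Real.exp (8 * s ^ 2) * (s * |B|) + Real.exp (8 * s ^ 2) * (s * |A - r|) := by gcongr
    _ = _ := by ring

/-- The same for the integrand of the two-replica formula for the tilted mean. -/
lemma tiltedMean_integrand_le {s t A A' B r : ℝ} (ht : t ^ 2 ≤ s) (hA : |A| ≤ 4 * s)
    (hA' : |A'| ≤ 4 * s) (hB : |B| ≤ 4 * s) (hr : |r| ≤ 2 * s) :
    (B + t ^ 2 * (A + B - r) * (A' + B - r)) * Real.exp (t ^ 2 / 2 * (A + A' + 2 * B))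
      ≤ (1 + 10 * s ^ 2) * Real.exp (8 * s ^ 2) * (|B| + |A - r|) := by
  have ht0 := sq_nonneg t
  have hs : 0 ≤ s := ht0.trans ht
  have h1 : |A + B - r| ≤ |B| + |A - r| := by
    have : A + B - r = B + (A - r) := by ring
    rw [this]; exact abs_add_le _ _
  have h2 : |A' + B - r| ≤ 10 * s := by
    refine (abs_sub _ _).trans ?_
    have := abs_add_le A' B
    linarith
  have h3 : t ^ 2 / 2 * (A + A' + 2 * B) ≤ 8 * s ^ 2 := by
    have : A + A' + 2 * B ≤ 16 * s := by
      linarith [le_abs_self A, le_abs_self A', le_abs_self B]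
    calc t ^ 2 / 2 * (A + A' + 2 * B) ≤ t ^ 2 / 2 * (16 * s) := by gcongr
      _ ≤ s / 2 * (16 * s) := by gcongr
      _ = _ := by ring
  calc _ ≤ |B + t ^ 2 * (A + B - r) * (A' + B - r)|
        * Real.exp (t ^ 2 / 2 * (A + A' + 2 * B)) := by gcongr; exact le_abs_self _
    _ ≤ ((|B| + |A - r|) + s * (|B| + |A - r|) * (10 * s)) * Real.exp (8 * s ^ 2) := by
        gcongr
        refine (abs_add_le _ _).trans (add_le_add (by linarith [abs_nonneg (A - r)]) ?_)
        rw [abs_mul, abs_mul, abs_of_nonneg ht0]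
        gcongr
    _ = _ := by ring

end Cavity

/-! ### Fluctuations of the field on the last spin -/

section CavitySpins

variable {S n : ℕ}

/-- The centred configuration, normalized by `√N`. -/
def centredSpin (N : ℝ) (H : Config S n → ℝ) (σ : Config S n) (i : Fin n) : ℝ :=
  (spin i σ - gibbs H (spin i)) / √N

/-- The inner product of two centred configurations is the doubly centred overlap; the constant
`N q` cancels. -/
lemma dot_centredSpin {N : ℝ} (hN : 0 < N) (H : Config S n → ℝ) (q : ℝ) (σ τ : Config S n) :
    dot (centredSpin N H σ) (centredSpin N H τ)
      = (overlap σ τ - N * q) / N - gibbs H (fun ρ => (overlap σ ρ - N * q) / N)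
        - gibbs H (fun ρ => (overlap τ ρ - N * q) / N)
        + gibbs H (fun ρ => gibbs H (fun ρ' => (overlap ρ ρ' - N * q) / N)) := by
  have hb : ∀ c : Fin n → ℝ, gibbs H (fun ρ => (∑ i, c i * spin i ρ - N * q) / N)
      = (∑ i, c i * gibbs H (spin i) - N * q) / N := by
    intro c
    simp only [div_eq_mul_inv]
    rw [gibbs_mul_const, gibbs_sub, gibbs_const, gibbs_sum]
    simp only [gibbs_const_mul]
  have h1 : ∀ σ : Config S n, gibbs H (fun ρ => (overlap σ ρ - N * q) / N)
      = (∑ i, spin i σ * gibbs H (spin i) - N * q) / N := fun σ => hb _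
  have h2 : gibbs H (fun ρ => (∑ i, spin i ρ * gibbs H (spin i) - N * q) / N)
      = (∑ i, gibbs H (spin i) * gibbs H (spin i) - N * q) / N := by
    have := hb fun i => gibbs H (spin i)
    simpa only [mul_comm (spin _ _)] using this
  simp only [h1, h2]
  have h3 : dot (centredSpin N H σ) (centredSpin N H τ)
      = (overlap σ τ - ∑ i, spin i σ * gibbs H (spin i) - ∑ i, spin i τ * gibbs H (spin i)
        + ∑ i, gibbs H (spin i) * gibbs H (spin i)) / N := by
    rw [dot, overlap, ← Finset.sum_sub_distrib, ← Finset.sum_sub_distrib,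
      ← Finset.sum_add_distrib, Finset.sum_div]
    refine Finset.sum_congr rfl fun i _ => ?_
    rw [centredSpin, centredSpin, div_mul_div_comm, Real.mul_self_sqrt hN.le]
    congr 1
    ring
  rw [h3]
  field_simp
  ring

lemma abs_div_le {N : ℝ} (hN : 0 < N) (x : ℝ) : |x / N| ≤ (x ^ 2 / N + 1) / (2 * √N) := by
  have hs := Real.sqrt_pos.2 hN
  have hsq := Real.mul_self_sqrt hN.le
  rw [abs_div, abs_of_pos hN, div_le_div_iff₀ hN (by positivity)]
  have e : (x ^ 2 / N + 1) * N = x ^ 2 + N := by field_simp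
  rw [e, ← sq_abs]
  nlinarith [sq_nonneg (|x| - √N)]

/-- How far the centred configurations are from being orthogonal with squared length `r`. -/
def projDefect (N r : ℝ) (H : Config S n → ℝ) : ℝ :=
  gibbs (pairEnergy H H) (fun x => |dot (centredSpin N H x.1) (centredSpin N H x.2)|
    + |dot (centredSpin N H x.1) (centredSpin N H x.1) - r|)

/-- Concentration of the overlaps makes the defect small. -/
lemma projDefect_le {N : ℝ} (hN : 0 < N) (p q : ℝ) (H : Config S n → ℝ) :
    projDefect N (p - q) H
      ≤ (7 / 2 * (gibbs (pairEnergy H H) (deviation N p q) / N) + 4) / √N := by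
  set X : Config S n → Config S n → ℝ := fun σ τ => (overlap σ τ - N * q) / N with hX
  set Y : Config S n → ℝ := fun σ => gibbs H (X σ) with hY
  set Z := gibbs H Y with hZ
  set ξ := gibbs (pairEnergy H H) (fun x => |X x.1 x.2|) with hξ
  set η := gibbs H (fun σ => |(overlap σ σ - N * p) / N|) with hη
  have hYξ : gibbs H (fun σ => |Y σ|) ≤ ξ := by
    rw [hξ, gibbs_pair]
    exact gibbs_mono _ fun σ => abs_gibbs_le_gibbs_abs _ _
  have hZξ : |Z| ≤ ξ := (abs_gibbs_le_gibbs_abs _ _).trans hYξ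
  have h1 : projDefect N (p - q) H ≤ 7 * ξ + η := by
    have hp : projDefect N (p - q) H ≤ gibbs (pairEnergy H H) (fun x =>
        |X x.1 x.2| + 3 * |Y x.1| + |Y x.2| + 2 * |Z| + |(overlap x.1 x.1 - N * p) / N|) := by
      refine gibbs_mono _ fun x => ?_
      rw [dot_centredSpin hN H q, dot_centredSpin hN H q]
      have e : (overlap x.1 x.1 - N * q) / N - Y x.1 - Y x.1 + Z - (p - q)
          = (overlap x.1 x.1 - N * p) / N - 2 * Y x.1 + Z := by
        field_simp; ring
      have b1 : |X x.1 x.2 - Y x.1 - Y x.2 + Z| ≤ |X x.1 x.2| + |Y x.1| + |Y x.2| + |Z| :=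
        (abs_add_le _ _).trans (add_le_add ((abs_sub _ _).trans
          (add_le_add (abs_sub _ _) le_rfl)) le_rfl)
      have b2 : |(overlap x.1 x.1 - N * p) / N - 2 * Y x.1 + Z|
          ≤ |(overlap x.1 x.1 - N * p) / N| + 2 * |Y x.1| + |Z| := by
        refine (abs_add_le _ _).trans (add_le_add ((abs_sub _ _).trans
          (add_le_add le_rfl ?_)) le_rfl)
        rw [abs_mul, abs_two]
      change |X x.1 x.2 - Y x.1 - Y x.2 + Z|
        + |(overlap x.1 x.1 - N * q) / N - Y x.1 - Y x.1 + Z - (p - q)| ≤ _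
      rw [e]
      linarith
    rw [gibbs_add, gibbs_add, gibbs_add, gibbs_add, gibbs_const, gibbs_const_mul,
      gibbs_pair_fst H H (fun σ => |Y σ|), gibbs_pair_snd H H (fun σ => |Y σ|),
      gibbs_pair_fst H H (fun σ => |(overlap σ σ - N * p) / N|)] at hp
    linarith
  have h2 : 7 * ξ + η ≤ gibbs (pairEnergy H H) (fun x =>
      7 / 2 * (1 / N * (1 / √N)) * deviation N p q x + 4 * (1 / √N)) := by
    rw [hη, ← gibbs_pair_fst H H (fun σ => |(overlap σ σ - N * p) / N|), hξ, ← gibbs_const_mul,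
      ← gibbs_add]
    refine gibbs_mono _ fun x => ?_
    have b1 := abs_div_le hN (overlap x.1 x.2 - N * q)
    have b2 := abs_div_le hN (overlap x.1 x.1 - N * p)
    have e : ∀ y : ℝ, (y ^ 2 / N + 1) / (2 * √N)
        = 1 / 2 * (1 / N * (1 / √N)) * y ^ 2 + 1 / 2 * (1 / √N) := fun y => by
      field_simp
    rw [e] at b1 b2
    have hc : 0 ≤ 1 / N * (1 / √N) := by positivity
    have hd : 7 * (1 / 2 * (1 / N * (1 / √N)) * (overlap x.1 x.2 - N * q) ^ 2)
        + 1 / 2 * (1 / N * (1 / √N)) * (overlap x.1 x.1 - N * p) ^ 2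
        ≤ 7 / 2 * (1 / N * (1 / √N)) * deviation N p q x := by
      unfold deviation
      nlinarith [mul_nonneg hc (sq_nonneg (overlap x.1 x.1 - N * p)),
        mul_nonneg hc (sq_nonneg (overlap x.2 x.2 - N * p))]
    linarith
  refine h1.trans (h2.trans (le_of_eq ?_))
  rw [gibbs_add, gibbs_const_mul, gibbs_const]
  ring

lemma abs_dot_centredSpin_le {N : ℝ} (hN : 0 < N) (hnN : (n : ℝ) ≤ N) (H : Config S n → ℝ)
    (σ τ : Config S n) :
    |dot (centredSpin N H σ) (centredSpin N H τ)| ≤ 4 * (S : ℝ) ^ 2 := by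
  have hc : ∀ (σ : Config S n) i, |spin i σ - gibbs H (spin i)| ≤ 2 * S := fun σ i => by
    refine (abs_sub _ _).trans ?_
    have := abs_spin_le i σ
    have := abs_gibbs_le H (f := spin i) (abs_spin_le i)
    linarith
  calc |dot (centredSpin N H σ) (centredSpin N H τ)|
      ≤ ∑ i, |centredSpin N H σ i * centredSpin N H τ i| := Finset.abs_sum_le_sum_abs _ _
    _ ≤ ∑ _i : Fin n, 4 * (S : ℝ) ^ 2 / N := by
        refine Finset.sum_le_sum fun i _ => ?_
        rw [centredSpin, centredSpin, div_mul_div_comm, Real.mul_self_sqrt hN.le, abs_div,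
          abs_of_pos hN, abs_mul]
        refine div_le_div_of_nonneg_right ?_ hN.le
        have := mul_le_mul (hc σ i) (hc τ i) (abs_nonneg _) (by positivity)
        linarith
    _ = n / N * (4 * (S : ℝ) ^ 2) := by
        rw [Finset.sum_const, Finset.card_univ, Fintype.card_fin, nsmul_eq_mul]; ring
    _ ≤ 1 * (4 * (S : ℝ) ^ 2) := by
        gcongr
        rw [div_le_one hN]; exact hnN
    _ = _ := one_mul _

/-- A constant, depending on the spin size only, in the Gaussian estimates. -/
def projConst (S : ℕ) : ℝ := 11 * (S : ℝ) ^ 4 * Real.exp (8 * ((S : ℝ) ^ 2) ^ 2)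

lemma projConst_pos (hS : 1 ≤ S) : 0 < projConst S := by
  have : (0 : ℝ) < S := by exact_mod_cast hS
  unfold projConst
  positivity

lemma integral_expMoment_centredSpin_le (hS : 1 ≤ S) {N t r : ℝ} (hN : 0 < N)
    (hnN : (n : ℝ) ≤ N) (H : Config S n → ℝ) (ht : |t| ≤ S) (hr : |r| ≤ 2 * (S : ℝ) ^ 2) :
    ∫ g, (expMoment H (centredSpin N H) t g - Real.exp (t ^ 2 / 2 * r)) ^ 2 ∂gaussianPi (Fin n)
      ≤ projConst S * projDefect N r H := by
  have hS1 : (1 : ℝ) ≤ S := by exact_mod_cast hS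
  rw [(integral_expMoment_sub_sq H (centredSpin N H) t _).2, projDefect, ← gibbs_const_mul]
  refine gibbs_mono _ fun x => ?_
  have hd := abs_dot_centredSpin_le hN hnN H
  have ht2 : t ^ 2 ≤ (S : ℝ) ^ 2 := by
    rw [← sq_abs t]; exact pow_le_pow_left₀ (abs_nonneg _) ht 2
  refine (expMoment_integrand_le ht2 (hd x.1 x.1) (hd x.2 x.2) (hd x.1 x.2) hr).trans ?_
  unfold projConst
  have h24 : (S : ℝ) ^ 2 ≤ (S : ℝ) ^ 4 := pow_le_pow_right₀ hS1 (by norm_num)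
  have h4 : 0 ≤ (S : ℝ) ^ 4 := by positivity
  gcongr
  linarith

lemma integral_tiltedMean_centredSpin_le (hS : 1 ≤ S) {N t r : ℝ} (hN : 0 < N)
    (hnN : (n : ℝ) ≤ N) (H : Config S n → ℝ) (ht : |t| ≤ S) (hr : |r| ≤ 2 * (S : ℝ) ^ 2) :
    ∫ g, (tiltedMean H (centredSpin N H) t g - t * r * expMoment H (centredSpin N H) t g) ^ 2
      ∂gaussianPi (Fin n) ≤ projConst S * projDefect N r H := by
  have hS1 : (1 : ℝ) ≤ S := by exact_mod_cast hS
  rw [(integral_tiltedMean_sub_sq H (centredSpin N H) t r).2, projDefect, ← gibbs_const_mul]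
  refine gibbs_mono _ fun x => ?_
  have hd := abs_dot_centredSpin_le hN hnN H
  have ht2 : t ^ 2 ≤ (S : ℝ) ^ 2 := by
    rw [← sq_abs t]; exact pow_le_pow_left₀ (abs_nonneg _) ht 2
  refine (tiltedMean_integrand_le ht2 (hd x.1 x.1) (hd x.2 x.2) (hd x.1 x.2) hr).trans ?_
  unfold projConst
  have h4 : 1 ≤ (S : ℝ) ^ 4 := one_le_pow₀ hS1
  gcongr
  nlinarith

/-! ### Adding the last spin -/

/-- Summing out the second component of an interacting pair. -/
lemma gibbs_interaction {α β : Type*} [Fintype α] [Fintype β] [Nonempty β] (w : α → ℝ)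
    (H : β → ℝ) (k : α → β → ℝ) (F : α → β → ℝ) :
    gibbs (fun x : α × β => w x.1 + k x.1 x.2 + H x.2) (fun x => F x.1 x.2)
      = gibbs (fun a => w a + Real.log (gibbs H (fun b => Real.exp (k a b))))
          (fun a => gibbs H (fun b => F a b * Real.exp (k a b))
            / gibbs H (fun b => Real.exp (k a b))) := by
  have hU : ∀ a, 0 < gibbs H (fun b => Real.exp (k a b)) := fun a =>
    (Real.exp_pos _).trans_le (exp_gibbs_le _ _)
  have hZ := sum_exp_pos H
  have e : ∀ a, Real.exp (w a + Real.log (gibbs H (fun b => Real.exp (k a b))))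
      = Real.exp (w a) * gibbs H (fun b => Real.exp (k a b)) := fun a => by
    rw [Real.exp_add, Real.exp_log (hU a)]
  have e1 : ∀ a, gibbs H (fun b => F a b * Real.exp (k a b))
      / gibbs H (fun b => Real.exp (k a b)) * Real.exp (w a
        + Real.log (gibbs H (fun b => Real.exp (k a b))))
      = (∑ b, F a b * Real.exp (w a + k a b + H b)) / ∑ b, Real.exp (H b) := fun a => by
    rw [e, mul_left_comm, div_mul_cancel₀ _ (hU a).ne', gibbs, ← mul_div_assoc, Finset.mul_sum]
    congr 1
    refine Finset.sum_congr rfl fun b _ => ?_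
    rw [Real.exp_add, Real.exp_add]; ring
  have e2 : ∀ a, Real.exp (w a + Real.log (gibbs H (fun b => Real.exp (k a b))))
      = (∑ b, Real.exp (w a + k a b + H b)) / ∑ b, Real.exp (H b) := fun a => by
    rw [e, gibbs, ← mul_div_assoc, Finset.mul_sum]
    congr 1
    refine Finset.sum_congr rfl fun b _ => ?_
    rw [Real.exp_add, Real.exp_add]; ring
  conv_rhs => rw [gibbs]
  simp only [e1]
  simp only [e2, ← Finset.sum_div]
  rw [div_div_div_cancel_right₀ hZ.ne', gibbs, Fintype.sum_prod_type, Fintype.sum_prod_type]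

/-- Two reweightings of a finite set by positive factors, the first at least one, have nearby
averages. -/
lemma abs_gibbs_log_sub_le {α : Type*} [Fintype α] [Nonempty α] (w U V f : α → ℝ) {C : ℝ}
    (hU : ∀ a, 1 ≤ U a) (hV : ∀ a, 0 < V a) (hf : ∀ a, |f a| ≤ C) :
    |gibbs (fun a => w a + Real.log (U a)) f - gibbs (fun a => w a + Real.log (V a)) f|
      ≤ 2 * C * ∑ a, |U a - V a| := by
  have hU0 : ∀ a, 0 < U a := fun a => one_pos.trans_le (hU a)
  set m := gibbs (fun a => w a + Real.log (V a)) f with hm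
  have hmC : |m| ≤ C := abs_gibbs_le _ hf
  have eU : ∀ a, Real.exp (w a + Real.log (U a)) = Real.exp (w a) * U a := fun a => by
    rw [Real.exp_add, Real.exp_log (hU0 a)]
  have eV : ∀ a, Real.exp (w a + Real.log (V a)) = Real.exp (w a) * V a := fun a => by
    rw [Real.exp_add, Real.exp_log (hV a)]
  have h0 : ∑ a, (f a - m) * (Real.exp (w a) * V a) = 0 := by
    have hs := sum_exp_pos fun a => w a + Real.log (V a)
    have : gibbs (fun a => w a + Real.log (V a)) (fun a => f a - m) = 0 := by
      rw [gibbs_sub, gibbs_const, ← hm, sub_self]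
    rw [gibbs, div_eq_zero_iff] at this
    simpa only [eV] using this.resolve_right hs.ne'
  have h1 : gibbs (fun a => w a + Real.log (U a)) f - m
      = gibbs (fun a => w a + Real.log (U a)) (fun a => (f a - m) * ((U a - V a) / U a)) := by
    have : gibbs (fun a => w a + Real.log (U a)) f - m
        = gibbs (fun a => w a + Real.log (U a)) (fun a => f a - m) := by
      rw [gibbs_sub, gibbs_const]
    rw [this, gibbs, gibbs]
    congr 1
    simp only [eU]
    rw [← sub_zero (∑ a, (f a - m) * (Real.exp (w a) * U a)), ← h0, ← Finset.sum_sub_distrib]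
    refine Finset.sum_congr rfl fun a _ => ?_
    have := (hU0 a).ne'
    field_simp
  rw [h1]
  refine abs_gibbs_le _ fun a => ?_
  rw [abs_mul, abs_div, abs_of_pos (hU0 a)]
  have b1 : |f a - m| ≤ 2 * C := (abs_sub _ _).trans (by linarith [hf a])
  have b2 : |U a - V a| / U a ≤ ∑ a, |U a - V a| :=
    (div_le_self (abs_nonneg _) (hU a)).trans
      (Finset.single_le_sum (f := fun a => |U a - V a|) (fun _ _ => abs_nonneg _)
        (Finset.mem_univ a))
  have hC : 0 ≤ C := (abs_nonneg _).trans hmC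
  have := (hU0 a).le
  gcongr

end CavitySpins

section LastSpin

variable {S n : ℕ}

/-- The energy of the first `n` spins: couplings of strength `β / √N`, where `N` need not be the
number of spins. -/
def cavityEnergy (N β D h : ℝ) (a : Edge n → ℝ) (σ : Config S n) : ℝ :=
  β / √N * ∑ e : Edge n, a e * spin e.1.1 σ * spin e.1.2 σ
    + D * ∑ i, spin i σ ^ 2 + h * ∑ i, spin i σ

lemma continuous_cavityEnergy (N β D h : ℝ) (σ : Config S n) :
    Continuous fun a => cavityEnergy N β D h a σ := by
  unfold cavityEnergy
  fun_prop

/-- At the end of the path the random fields have disappeared. -/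
lemma pathEnergy_pi_div_two (N β D h p q : ℝ) (g : Edge n ⊕ Fin n → ℝ) :
    pathEnergy (S := S) N β D h p q (Real.pi / 2) g
      = cavityEnergy N β D h (fun e => g (Sum.inl e)) := by
  funext σ
  simp only [pathEnergy, gaussEnergy, pathCoef, pathField, Fintype.sum_sum_type, Sum.elim_inl,
    Sum.elim_inr, Real.sin_pi_div_two, Real.cos_pi_div_two, zero_mul, Finset.sum_const_zero,
    add_zero, one_mul, cavityEnergy, Finset.mul_sum, ne_eq, OfNat.ofNat_ne_zero, not_false_eq_true,
    zero_pow, add_assoc]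
  congr 1
  exact Finset.sum_congr rfl fun e _ => by ring

lemma sum_Ioi_eq_sum_edge (F : Fin n → Fin n → ℝ) :
    ∑ i, ∑ j ∈ Finset.Ioi i, F i j = ∑ e : Edge n, F e.1.1 e.1.2 := by
  rw [← Finset.sum_subtype (p := fun x : Fin n × Fin n => x.1 < x.2)
      (Finset.univ.filter fun x : Fin n × Fin n => x.1 < x.2) (by simp)
      (fun x : Fin n × Fin n => F x.1 x.2), Finset.sum_filter, Fintype.sum_prod_type]
  refine Finset.sum_congr rfl fun i _ => ?_
  rw [← Finset.sum_filter]
  congr 1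
  ext j
  simp

lemma sum_Ioi_castSucc (F : Fin (n + 1) → Fin (n + 1) → ℝ) :
    ∑ i, ∑ j ∈ Finset.Ioi i, F i j
      = ∑ i : Fin n, ∑ j ∈ Finset.Ioi i, F i.castSucc j.castSucc
        + ∑ i : Fin n, F i.castSucc (Fin.last n) := by
  have h : ∀ (m : ℕ) (F : Fin m → Fin m → ℝ) (i : Fin m),
      ∑ j ∈ Finset.Ioi i, F i j = ∑ j, if i < j then F i j else 0 := by
    intro m F i
    rw [← Finset.sum_filter]
    congr 1
    ext j
    simp
  rw [Fin.sum_univ_castSucc, ← Finset.sum_add_distrib]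
  have hl : ∑ j ∈ Finset.Ioi (Fin.last n), F (Fin.last n) j = 0 := by
    rw [h]
    exact Finset.sum_eq_zero fun j _ => if_neg (Fin.le_last j).not_gt
  rw [hl, add_zero]
  refine Finset.sum_congr rfl fun i _ => ?_
  rw [h, h n (fun i j => F i.castSucc j.castSucc), Fin.sum_univ_castSucc]
  simp [Fin.castSucc_lt_last]

/-- The configuration `(ρ, s)` of `n + 1` spins. -/
abbrev snocConfig (ρ : Config S n) (s : Spin S) : Config S (n + 1) :=
  Fin.snoc (α := fun _ => Spin S) ρ s

lemma spin_castSucc_snoc (ρ : Config S n) (s : Spin S) (i : Fin n) :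
    spin i.castSucc (snocConfig ρ s) = spin i ρ := by
  simp [spin]

lemma spin_last_snoc (ρ : Config S n) (s : Spin S) :
    spin (Fin.last n) (snocConfig ρ s) = spinVal s := by
  simp [spin, spinVal]

/-- The Hamiltonian splits into the energy of the last spin in the field of the others and the
energy of the first `n` spins. -/
lemma hamiltonian_snoc (β D h : ℝ) (G : Fin (n + 1) → Fin (n + 1) → ℝ) (ρ : Config S n)
    (s : Spin S) :
    hamiltonian β D h G (snocConfig ρ s)
      = siteEnergy D (β / √((n + 1 : ℕ) : ℝ) * ∑ i : Fin n, G i.castSucc (Fin.last n) * spin i ρ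
          + h) s
        + cavityEnergy ((n + 1 : ℕ) : ℝ) β D h
          (fun e => G e.1.1.castSucc e.1.2.castSucc) ρ := by
  unfold hamiltonian cavityEnergy siteEnergy
  rw [sum_Ioi_castSucc, Fin.sum_univ_castSucc, Fin.sum_univ_castSucc]
  simp only [spin_castSucc_snoc, spin_last_snoc]
  rw [sum_Ioi_eq_sum_edge (fun i j => G i.castSucc j.castSucc * spin i ρ * spin j ρ),
    ← Finset.sum_mul]
  ring

lemma gibbsAvg_eq_gibbs (β D h : ℝ) {m : ℕ} (G : Fin m → Fin m → ℝ) (f : Config S m → ℝ) :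
    gibbsAvg β D h G f = gibbs (hamiltonian β D h G) f := by
  simp only [gibbsAvg, gibbs, partitionFunction, ← mul_div_assoc, ← Finset.sum_div]

/-- The mean field acting on the last spin when the other spins follow the cavity measure. -/
def cavityField (N : ℝ) (H : Config S n → ℝ) (g : Fin n → ℝ) : ℝ :=
  (∑ i, g i * gibbs H (spin i)) / √N

lemma sum_mul_spin_div (N : ℝ) (H : Config S n → ℝ) (g : Fin n → ℝ) (ρ : Config S n) :
    (∑ i, g i * spin i ρ) / √N = cavityField N H g + dot (centredSpin N H ρ) g := by
  rw [cavityField, dot, Finset.sum_div, Finset.sum_div, ← Finset.sum_add_distrib]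
  refine Finset.sum_congr rfl fun i _ => ?_
  rw [centredSpin]
  ring

/-- The energy of the last spin once the others have been averaged out. -/
def effEnergy (N β D h : ℝ) (H : Config S n → ℝ) (g : Fin n → ℝ) (s : Spin S) : ℝ :=
  siteEnergy D (β * cavityField N H g + h) s
    + Real.log (expMoment H (centredSpin N H) (β * spinVal s) g)

/-- The average over `n + 1` spins in terms of the cavity measure of the first `n`. -/
lemma gibbsAvg_eq_cavity (β D h : ℝ) (G : Fin (n + 1) → Fin (n + 1) → ℝ)
    (F : Spin S → Config S n → ℝ) (f : Config S (n + 1) → ℝ)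
    (hf : ∀ s ρ, f (snocConfig ρ s) = F s ρ) {N : ℝ} (hN : N = ((n + 1 : ℕ) : ℝ))
    {H : Config S n → ℝ}
    (hH : H = cavityEnergy N β D h (fun e => G e.1.1.castSucc e.1.2.castSucc))
    {g : Fin n → ℝ} (hg : g = fun i => G i.castSucc (Fin.last n)) :
    gibbsAvg β D h G f = gibbs (effEnergy N β D h H g)
      (fun s => gibbs H (fun ρ => F s ρ * Real.exp (β * spinVal s * dot (centredSpin N H ρ) g))
        / expMoment H (centredSpin N H) (β * spinVal s) g) := by
  unfold effEnergy expMoment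
  rw [gibbsAvg_eq_gibbs, ← gibbs_interaction (fun s => siteEnergy D (β * cavityField N H g + h) s)
    H (fun s ρ => β * spinVal s * dot (centredSpin N H ρ) g) F,
    ← gibbs_equiv (Fin.snocEquiv fun _ => Spin S)]
  congr 1
  · funext x
    refine (hamiltonian_snoc β D h G x.2 x.1).trans ?_
    have e := sum_mul_spin_div N H g x.2
    rw [← hN, ← hH]
    congr 1
    have e2 : β / √N * ∑ i : Fin n, G i.castSucc (Fin.last n) * spin i x.2
        = β * ((∑ i, g i * spin i x.2) / √N) := by rw [hg]; ring
    rw [e2, e]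
    unfold siteEnergy
    ring
  · funext x
    exact hf x.1 x.2

/-- By Jensen's inequality, as the projections are centred. -/
lemma one_le_expMoment {N : ℝ} (H : Config S n → ℝ) (t : ℝ) (g : Fin n → ℝ) :
    1 ≤ expMoment H (centredSpin N H) t g := by
  have h0 : gibbs H (fun ρ => t * dot (centredSpin N H ρ) g) = 0 := by
    have hc : ∀ i, gibbs H (fun ρ => centredSpin N H ρ i * g i) = 0 := fun i => by
      unfold centredSpin
      simp only [div_eq_mul_inv]
      rw [gibbs_mul_const, gibbs_mul_const, gibbs_sub, gibbs_const, sub_self, zero_mul, zero_mul]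
    rw [gibbs_const_mul]
    unfold dot
    rw [gibbs_sum]
    simp only [hc, Finset.sum_const_zero, mul_zero]
  have := exp_gibbs_le H (fun ρ => t * dot (centredSpin N H ρ) g)
  rwa [h0, Real.exp_zero] at this

/-- The last spin under the full measure, in terms of the cavity measure. -/
lemma gibbsAvg_last (β D h : ℝ) (G : Fin (n + 1) → Fin (n + 1) → ℝ) (φ : ℝ → ℝ)
    {N : ℝ} (hN : N = ((n + 1 : ℕ) : ℝ)) {H : Config S n → ℝ}
    (hH : H = cavityEnergy N β D h (fun e => G e.1.1.castSucc e.1.2.castSucc))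
    {g : Fin n → ℝ} (hg : g = fun i => G i.castSucc (Fin.last n)) :
    gibbsAvg (S := S) β D h G (fun σ => φ (spin (Fin.last n) σ))
      = gibbs (effEnergy N β D h H g) (fun s => φ (spinVal s)) := by
  rw [gibbsAvg_eq_cavity β D h G (fun s _ => φ (spinVal s)) _
    (fun s ρ => by rw [spin_last_snoc]) hN hH hg]
  congr 1
  funext s
  have hU := one_le_expMoment (N := N) H (β * spinVal s) g
  rw [gibbs_const_mul, ← expMoment, mul_div_assoc, div_self (by linarith), mul_one]

/-- The local field differs from the cavity field by an average of the defects of the tilted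
means. -/
lemma localField_eq (β D h p q : ℝ) (G : Fin (n + 1) → Fin (n + 1) → ℝ)
    {N : ℝ} (hN : N = ((n + 1 : ℕ) : ℝ)) {H : Config S n → ℝ}
    (hH : H = cavityEnergy N β D h (fun e => G e.1.1.castSucc e.1.2.castSucc))
    {g : Fin n → ℝ} (hg : g = fun i => G i.castSucc (Fin.last n)) :
    localField S β D h p q G = cavityField N H g + gibbs (effEnergy N β D h H g) (fun s =>
      (tiltedMean H (centredSpin N H) (β * spinVal s) g - β * spinVal s * (p - q)
        * expMoment H (centredSpin N H) (β * spinVal s) g)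
      / expMoment H (centredSpin N H) (β * spinVal s) g) := by
  have hlast := gibbsAvg_last (S := S) β D h G (fun x => x) hN hH hg
  have hsum : 1 / √((n + 1 : ℕ) : ℝ) *
      ∑ i : Fin n, G i.castSucc (Fin.last n) * gibbsAvg (S := S) β D h G (spin i.castSucc)
      = gibbsAvg (S := S) β D h G (fun σ => (∑ i, g i * spin i.castSucc σ) / √N) := by
    simp only [gibbsAvg_eq_gibbs, div_eq_mul_inv]
    rw [gibbs_mul_const, gibbs_sum, ← hN]
    simp only [gibbs_const_mul, hg]
    ring
  have hfield := gibbsAvg_eq_cavity (S := S) β D h G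
    (fun _ ρ => cavityField N H g + dot (centredSpin N H ρ) g)
    (fun σ => (∑ i, g i * spin i.castSucc σ) / √N)
    (fun s ρ => by
      simp only [spin_castSucc_snoc]
      exact sum_mul_spin_div N H g ρ) hN hH hg
  unfold localField
  rw [hsum, hfield, hlast, ← gibbs_const_mul, ← gibbs_sub]
  have hc : cavityField N H g = gibbs (effEnergy N β D h H g) (fun _ => cavityField N H g) :=
    (gibbs_const _ _).symm
  conv_rhs => rw [hc]
  rw [← gibbs_add]
  congr 1
  funext s
  have hU : expMoment H (centredSpin N H) (β * spinVal s) g ≠ 0 := by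
    have := one_le_expMoment (N := N) H (β * spinVal s) g
    linarith
  simp only [add_mul]
  rw [gibbs_add, gibbs_const_mul, ← expMoment, ← tiltedMean]
  field_simp
  ring

/-- The total squared defect of the Gaussian approximations. -/
def residual (N β r : ℝ) (H : Config S n → ℝ) (g : Fin n → ℝ) : ℝ :=
  ∑ s : Spin S,
    ((expMoment H (centredSpin N H) (β * spinVal s) g - Real.exp ((β * spinVal s) ^ 2 / 2 * r)) ^ 2
    + (tiltedMean H (centredSpin N H) (β * spinVal s) g - β * spinVal s * r
        * expMoment H (centredSpin N H) (β * spinVal s) g) ^ 2)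

lemma sq_sum_abs_add_sum_abs_le {κ : Type*} [Fintype κ] (x y : κ → ℝ) :
    (∑ s, |x s| + ∑ s, |y s|) ^ 2 ≤ 2 * Fintype.card κ * ∑ s, (x s ^ 2 + y s ^ 2) := by
  have h1 := sq_sum_le_card_mul_sum_sq (s := (Finset.univ : Finset κ)) (f := fun s => |x s|)
  have h2 := sq_sum_le_card_mul_sum_sq (s := (Finset.univ : Finset κ)) (f := fun s => |y s|)
  simp only [sq_abs, Finset.card_univ] at h1 h2
  rw [Finset.sum_add_distrib]
  nlinarith [sq_nonneg (∑ s, |x s| - ∑ s, |y s|)]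

/-- The errors of both equations are controlled by the residual, for any observable `φ` of the
last spin and its single-spin average `R`. -/
lemma sq_tapError_le (hS : 1 ≤ S) {β : ℝ} (hβ : 0 ≤ β) (hβ1 : β ≤ 1) (D h p q : ℝ)
    (G : Fin (n + 1) → Fin (n + 1) → ℝ) (φ : ℝ → ℝ) (R : ℝ → ℝ → ℝ)
    (hR : ∀ x y, R x y = gibbs (siteEnergy (S := S) x y) (fun s => φ (spinVal s)))
    (hRlip : ∀ x y y', |R x y' - R x y| ≤ 2 * (S : ℝ) ^ 3 * |y' - y|)
    (hφ : ∀ s : Spin S, |φ (spinVal s)| ≤ (S : ℝ) ^ 2)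
    {N : ℝ} (hN : N = ((n + 1 : ℕ) : ℝ)) {H : Config S n → ℝ}
    (hH : H = cavityEnergy N β D h (fun e => G e.1.1.castSucc e.1.2.castSucc))
    {g : Fin n → ℝ} (hg : g = fun i => G i.castSucc (Fin.last n)) :
    (gibbsAvg (S := S) β D h G (fun σ => φ (spin (Fin.last n) σ))
        - R (shift β D p q) (β * localField S β D h p q G + h)) ^ 2
      ≤ 8 * (S : ℝ) ^ 6 * Fintype.card (Spin S) * residual N β (p - q) H g := by
  have hS1 : (1 : ℝ) ≤ S := by exact_mod_cast hS
  set U : Spin S → ℝ := fun s => expMoment H (centredSpin N H) (β * spinVal s) g with hU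
  set V : Spin S → ℝ := fun s => Real.exp ((β * spinVal s) ^ 2 / 2 * (p - q)) with hV
  set W : Spin S → ℝ := fun s => tiltedMean H (centredSpin N H) (β * spinVal s) g
    - β * spinVal s * (p - q) * U s with hW
  set y := β * cavityField N H g + h with hy
  have hU1 : ∀ s, 1 ≤ U s := fun s => one_le_expMoment H _ g
  have e1 : siteEnergy (S := S) (shift β D p q) y
      = fun s => siteEnergy D y s + Real.log (V s) := by
    funext s
    rw [hV]
    simp only [Real.log_exp, siteEnergy, shift]
    ring
  have b1 : |gibbsAvg (S := S) β D h G (fun σ => φ (spin (Fin.last n) σ))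
      - R (shift β D p q) y| ≤ 2 * (S : ℝ) ^ 2 * ∑ s, |U s - V s| := by
    rw [gibbsAvg_last β D h G φ hN hH hg, hR, e1]
    exact abs_gibbs_log_sub_le (fun s => siteEnergy D y s) U V _ hU1
      (fun s => Real.exp_pos _) hφ
  have b2 : |(β * localField S β D h p q G + h) - y| ≤ ∑ s, |W s| := by
    rw [localField_eq β D h p q G hN hH hg]
    have : β * (cavityField N H g + gibbs (effEnergy N β D h H g) (fun s => W s / U s)) + h - y
        = β * gibbs (effEnergy N β D h H g) (fun s => W s / U s) := by rw [hy]; ring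
    refine (congrArg abs this).trans_le ?_
    rw [abs_mul, abs_of_nonneg hβ]
    refine (mul_le_of_le_one_left (abs_nonneg _) hβ1).trans (abs_gibbs_le _ fun s => ?_)
    rw [abs_div, abs_of_pos (one_pos.trans_le (hU1 s))]
    exact (div_le_self (abs_nonneg _) (hU1 s)).trans
      (Finset.single_le_sum (f := fun s => |W s|) (fun _ _ => abs_nonneg _) (Finset.mem_univ s))
  have hU0 : 0 ≤ ∑ s, |U s - V s| := Finset.sum_nonneg fun _ _ => abs_nonneg _
  have hW0 : 0 ≤ ∑ s, |W s| := Finset.sum_nonneg fun _ _ => abs_nonneg _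
  have b3 : |gibbsAvg (S := S) β D h G (fun σ => φ (spin (Fin.last n) σ))
        - R (shift β D p q) (β * localField S β D h p q G + h)|
      ≤ 2 * (S : ℝ) ^ 3 * (∑ s, |U s - V s| + ∑ s, |W s|) := by
    refine (abs_sub_le _ (R (shift β D p q) y) _).trans ?_
    have b4 := hRlip (shift β D p q) (β * localField S β D h p q G + h) y
    rw [abs_sub_comm y] at b4
    have h23 : (S : ℝ) ^ 2 ≤ (S : ℝ) ^ 3 := pow_le_pow_right₀ hS1 (by norm_num)
    have b5 : 2 * (S : ℝ) ^ 2 * ∑ s, |U s - V s| ≤ 2 * (S : ℝ) ^ 3 * ∑ s, |U s - V s| := by gcongr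
    have b6 : 2 * (S : ℝ) ^ 3 * |(β * localField S β D h p q G + h) - y|
        ≤ 2 * (S : ℝ) ^ 3 * ∑ s, |W s| := by gcongr
    rw [mul_add]
    linarith
  rw [← sq_abs]
  calc _ ≤ (2 * (S : ℝ) ^ 3 * (∑ s, |U s - V s| + ∑ s, |W s|)) ^ 2 :=
        pow_le_pow_left₀ (abs_nonneg _) b3 2
    _ = 4 * (S : ℝ) ^ 6 * (∑ s, |U s - V s| + ∑ s, |W s|) ^ 2 := by ring
    _ ≤ 4 * (S : ℝ) ^ 6 * (2 * Fintype.card (Spin S) * ∑ s, ((U s - V s) ^ 2 + W s ^ 2)) := by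
        gcongr
        exact sq_sum_abs_add_sum_abs_le _ _
    _ = 8 * (S : ℝ) ^ 6 * Fintype.card (Spin S) * ∑ s, ((U s - V s) ^ 2 + W s ^ 2) := by ring
    _ = _ := rfl

end LastSpin

/-! ### Averaging over the disorder -/

section Disorder

variable {S n : ℕ}

lemma continuous_dot_centredSpin (N β D h : ℝ) (ρ : Config S n) :
    Continuous fun z : (Edge n → ℝ) × (Fin n → ℝ) =>
      dot (centredSpin N (cavityEnergy N β D h z.1) ρ) z.2 := by
  unfold dot centredSpin
  refine continuous_finsetSum _ fun i _ => Continuous.mul (Continuous.div_const ?_ _)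
    ((continuous_apply i).comp continuous_snd)
  exact continuous_const.sub (continuous_gibbs (f := fun _ => spin i)
    (fun σ => (continuous_cavityEnergy N β D h σ).comp continuous_fst) fun _ => continuous_const)

lemma continuous_residual (N β D h r : ℝ) :
    Continuous fun z : (Edge n → ℝ) × (Fin n → ℝ) =>
      residual (S := S) N β r (cavityEnergy N β D h z.1) z.2 := by
  have hE : ∀ t, Continuous fun z : (Edge n → ℝ) × (Fin n → ℝ) =>
      expMoment (cavityEnergy (S := S) N β D h z.1) (centredSpin N (cavityEnergy N β D h z.1))
        t z.2 := fun t =>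
    continuous_gibbs (fun σ => (continuous_cavityEnergy N β D h σ).comp continuous_fst)
      fun σ => ((continuous_dot_centredSpin N β D h σ).const_mul t).rexp
  have hT : ∀ t, Continuous fun z : (Edge n → ℝ) × (Fin n → ℝ) =>
      tiltedMean (cavityEnergy (S := S) N β D h z.1) (centredSpin N (cavityEnergy N β D h z.1))
        t z.2 := fun t =>
    continuous_gibbs (fun σ => (continuous_cavityEnergy N β D h σ).comp continuous_fst)
      fun σ => (continuous_dot_centredSpin N β D h σ).mul
        ((continuous_dot_centredSpin N β D h σ).const_mul t).rexp
  unfold residual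
  exact continuous_finsetSum _ fun s _ => (((hE _).sub continuous_const).pow 2).add
    (((hT _).sub (continuous_const.mul (hE _))).pow 2)

lemma residual_nonneg (N β r : ℝ) (H : Config S n → ℝ) (g : Fin n → ℝ) :
    0 ≤ residual N β r H g :=
  Finset.sum_nonneg fun _ _ => by positivity

/-- The Gaussian average of the residual over the couplings of the last spin. -/
lemma integral_residual_le (hS : 1 ≤ S) {N β r : ℝ} (hN : 0 < N) (hnN : (n : ℝ) ≤ N)
    (hβ : 0 ≤ β) (hβ1 : β ≤ 1) (hr : |r| ≤ 2 * (S : ℝ) ^ 2) (H : Config S n → ℝ) :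
    Integrable (residual N β r H) (gaussianPi (Fin n)) ∧
    ∫ g, residual N β r H g ∂gaussianPi (Fin n)
      ≤ Fintype.card (Spin S) * (2 * projConst S) * projDefect N r H := by
  have ht : ∀ s : Spin S, |β * spinVal s| ≤ S := fun s => by
    rw [abs_mul, abs_of_nonneg hβ]
    exact (mul_le_of_le_one_left (abs_nonneg _) hβ1).trans (abs_spinVal_le s)
  have i1 := fun s : Spin S => (integral_expMoment_sub_sq H (centredSpin N H) (β * spinVal s)
    (Real.exp ((β * spinVal s) ^ 2 / 2 * r))).1
  have i2 := fun s : Spin S =>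
    (integral_tiltedMean_sub_sq H (centredSpin N H) (β * spinVal s) r).1
  refine ⟨integrable_finsetSum _ fun s _ => (i1 s).add (i2 s), ?_⟩
  calc _ = _ := integral_finsetSum _ fun s _ => (i1 s).add (i2 s)
    _ ≤ ∑ _s : Spin S, 2 * projConst S * projDefect N r H := by
        refine Finset.sum_le_sum fun s _ => ?_
        refine (integral_add (i1 s) (i2 s)).trans_le ?_
        have h1 := integral_expMoment_centredSpin_le hS hN hnN H (ht s) hr
        have h2 := integral_tiltedMean_centredSpin_le hS hN hnN H (ht s) hr
        linarith
    _ = _ := by rw [Finset.sum_const, nsmul_eq_mul, Finset.card_univ]; ring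

/-- The mean residual over all couplings is of order `1 / √N`. -/
lemma integral_residual_disorder_le (hS : 1 ≤ S) {N β D h p q : ℝ} (hN : N = n + 1)
    (hβ : 0 ≤ β) (hβ1 : β ≤ 1) (hβS : β ^ 2 ≤ 1 / (96 * (S : ℝ) ^ 4))
    (hpq : IsFixedPoint S β D h p q) :
    Integrable (fun z : Edge n ⊕ Fin n → ℝ => residual (S := S) N β (p - q)
        (cavityEnergy N β D h (fun e => z (Sum.inl e))) (fun i => z (Sum.inr i)))
      (gaussianPi (Edge n ⊕ Fin n)) ∧
    ∫ z, residual (S := S) N β (p - q) (cavityEnergy N β D h (fun e => z (Sum.inl e)))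
        (fun i => z (Sum.inr i)) ∂gaussianPi (Edge n ⊕ Fin n)
      ≤ Fintype.card (Spin S) * (2 * projConst S) *
        ((7 / 2 * (576 * (S : ℝ) ^ 4 * (6 + 2 * (S : ℝ) ^ 4)) + 4) / √N) := by
  have hn0 : (0 : ℝ) ≤ n := Nat.cast_nonneg n
  have hN0 : 0 < N := by rw [hN]; linarith
  have hnN : (n : ℝ) ≤ N := by rw [hN]; linarith
  have hr : |p - q| ≤ 2 * (S : ℝ) ^ 2 :=
    (abs_sub _ _).trans (by linarith [hpq.abs_le.1, hpq.abs_le.2])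
  set C := Fintype.card (Spin S) * (2 * projConst S) with hC
  have hC0 : 0 ≤ C := by
    have := projConst_pos hS
    positivity
  set Hc : (Edge n → ℝ) → Config S n → ℝ := cavityEnergy N β D h with hHc
  have hin := fun a => integral_residual_le (n := n) hS hN0 hnN hβ hβ1 hr (Hc a)
  -- A bound for the inner average which is explicit in the cavity couplings.
  set bound : (Edge n → ℝ) → ℝ := fun a => C * ((7 / 2 *
    (gibbs (pairEnergy (Hc a) (Hc a)) (deviation N p q) / N) + 4) / √N) with hbound
  have hinb : ∀ a, ∫ g, residual N β (p - q) (Hc a) g ∂gaussianPi (Fin n) ≤ bound a := fun a =>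
    (hin a).2.trans (mul_le_mul_of_nonneg_left (projDefect_le hN0 p q (Hc a)) hC0)
  have hcg : Continuous fun a => gibbs (pairEnergy (Hc a) (Hc a)) (deviation N p q) :=
    continuous_gibbs (f := fun _ => deviation N p q)
      (fun x => (continuous_cavityEnergy N β D h x.1).add (continuous_cavityEnergy N β D h x.2))
      fun _ => continuous_const
  have hig : Integrable (fun a => gibbs (pairEnergy (Hc a) (Hc a)) (deviation N p q))
      (gaussianPi (Edge n)) :=
    integrable_of_continuous_of_bounded hcg _ fun a => abs_gibbs_le_sum _ _
  have hib : Integrable bound (gaussianPi (Edge n)) :=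
    ((((hig.div_const N).const_mul _).add (integrable_const _)).div_const _).const_mul _
  have mp := measurePreserving_sumPiEquivProdPi (X := fun _ : Edge n ⊕ Fin n => ℝ)
    (fun _ => stdGaussian)
  have hmeas : AEStronglyMeasurable (fun z : (Edge n → ℝ) × (Fin n → ℝ) =>
      residual N β (p - q) (Hc z.1) z.2) ((gaussianPi (Edge n)).prod (gaussianPi (Fin n))) :=
    (continuous_residual N β D h (p - q)).measurable.aestronglyMeasurable
  have hprod : Integrable (fun z : (Edge n → ℝ) × (Fin n → ℝ) =>
      residual N β (p - q) (Hc z.1) z.2) ((gaussianPi (Edge n)).prod (gaussianPi (Fin n))) := by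
    rw [integrable_prod_iff hmeas]
    refine ⟨Filter.Eventually.of_forall fun a => (hin a).1, ?_⟩
    refine hib.mono' hmeas.norm.integral_prod_right' (Filter.Eventually.of_forall fun a => ?_)
    simp only [Real.norm_eq_abs, abs_of_nonneg (residual_nonneg _ _ _ _ _)]
    rw [abs_of_nonneg (integral_nonneg fun g => residual_nonneg _ _ _ _ _)]
    exact hinb a
  have hmean : ∫ a, gibbs (pairEnergy (Hc a) (Hc a)) (deviation N p q) ∂gaussianPi (Edge n)
      = meanDeviation S n N β D h p q (Real.pi / 2) := by
    have mp1 : MeasurePreserving (fun z : Edge n ⊕ Fin n → ℝ => fun e => z (Sum.inl e))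
        (gaussianPi (Edge n ⊕ Fin n)) (gaussianPi (Edge n)) := measurePreserving_fst.comp mp
    unfold meanDeviation
    simp only [pathEnergy_pi_div_two]
    rw [← mp1.map_eq, integral_map mp1.measurable.aemeasurable hcg.aestronglyMeasurable]
  refine ⟨mp.integrable_comp_of_integrable hprod, ?_⟩
  have hcomp := mp.integral_comp' (fun z : (Edge n → ℝ) × (Fin n → ℝ) =>
      residual N β (p - q) (Hc z.1) z.2)
  refine (Eq.trans_le hcomp ?_)
  refine (integral_prod _ hprod).trans_le ?_
  refine (integral_mono hprod.integral_prod_left hib hinb).trans ?_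
  rw [hbound, integral_const_mul, integral_div,
    integral_add ((hig.div_const N).const_mul _) (integrable_const _), integral_const_mul,
    integral_div, hmean]
  have hm := meanDeviation_pi_div_two_le (n := n) hS hN hβS hpq
  rw [← div_le_iff₀ hN0] at hm
  refine mul_le_mul_of_nonneg_left ?_ hC0
  refine div_le_div_of_nonneg_right ?_ (Real.sqrt_nonneg _)
  simp only [integral_const, probReal_univ, smul_eq_mul, one_mul]
  gcongr

/-- The pairs of sites among `n + 1`, sorted by whether they involve the last site. -/
def splitEdge : Edge n ⊕ Fin n → Edge (n + 1) :=
  Sum.elim (fun e => ⟨(e.1.1.castSucc, e.1.2.castSucc), Fin.castSucc_lt_castSucc_iff.2 e.2⟩)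
    (fun i => ⟨(i.castSucc, Fin.last n), Fin.castSucc_lt_last i⟩)

lemma splitEdge_injective : Function.Injective (splitEdge (n := n)) := by
  intro x y hxy
  have h1 := congrArg (fun e : Edge (n + 1) => e.1.1) hxy
  have h2 := congrArg (fun e : Edge (n + 1) => e.1.2) hxy
  rcases x with e | i <;> rcases y with e' | i' <;>
    simp only [splitEdge, Sum.elim_inl, Sum.elim_inr, Fin.castSucc_inj] at h1 h2
  · exact congrArg Sum.inl (Subtype.ext (Prod.ext h1 h2))
  · exact absurd h2 (Fin.castSucc_lt_last _).ne
  · exact absurd h2.symm (Fin.castSucc_lt_last _).ne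
  · rw [h1]

/-- The couplings with the index split according to the last site. -/
def splitDisorder (G : Fin (n + 1) → Fin (n + 1) → ℝ) (x : Edge n ⊕ Fin n) : ℝ :=
  G (splitEdge x).1.1 (splitEdge x).1.2

variable {Ω : Type*} [MeasurableSpace Ω] {P : Measure Ω} [IsProbabilityMeasure P]
  {g : Ω → Fin (n + 1) → Fin (n + 1) → ℝ}

/-- Gaussian disorder, split according to the last site, is a standard Gaussian vector. -/
lemma IsGaussianDisorder.measurePreserving (hg : IsGaussianDisorder P g) :
    AEMeasurable (fun ω => splitDisorder (g ω)) P ∧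
      P.map (fun ω => splitDisorder (g ω)) = gaussianPi (Edge n ⊕ Fin n) := by
  have hm : ∀ x : Edge n ⊕ Fin n, AEMeasurable (fun ω => splitDisorder (g ω) x) P := fun x =>
    (hg.1 _ _ (splitEdge x).2).aemeasurable
  refine ⟨aemeasurable_pi_lambda _ hm, ?_⟩
  have hind : iIndepFun (fun (x : Edge n ⊕ Fin n) (ω : Ω) => splitDisorder (g ω) x) P :=
    hg.2.precomp splitEdge_injective
  rw [(iIndepFun_iff_map_fun_eq_pi_map hm).1 hind]
  congr 1
  funext x
  exact (hg.1 _ _ (splitEdge x).2).map_eq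

/-- The couplings with the entries `i ≥ j` set to zero. No measurability of those entries is
assumed, and they do not affect the errors. -/
def upperDisorder {m : ℕ} (G : Fin m → Fin m → ℝ) (i j : Fin m) : ℝ := if i < j then G i j else 0

lemma gibbsAvg_upperDisorder (β D h : ℝ) {m : ℕ} (G : Fin m → Fin m → ℝ) (f : Config S m → ℝ) :
    gibbsAvg β D h (upperDisorder G) f = gibbsAvg β D h G f := by
  have : hamiltonian (S := S) β D h (upperDisorder G) = hamiltonian β D h G := by
    funext σ
    unfold hamiltonian
    congr 3
    refine Finset.sum_congr rfl fun i _ => Finset.sum_congr rfl fun j hj => ?_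
    rw [upperDisorder, if_pos (Finset.mem_Ioi.1 hj)]
  rw [gibbsAvg_eq_gibbs, gibbsAvg_eq_gibbs, this]

lemma localField_upperDisorder (β D h p q : ℝ) (G : Fin (n + 1) → Fin (n + 1) → ℝ) :
    localField S β D h p q (upperDisorder G) = localField S β D h p q G := by
  unfold localField
  simp only [gibbsAvg_upperDisorder, upperDisorder, Fin.castSucc_lt_last, if_true]

lemma continuous_gibbsAvg (β D h : ℝ) {m : ℕ} (f : Config S m → ℝ) :
    Continuous fun G : Fin m → Fin m → ℝ => gibbsAvg β D h G f := by
  simp only [gibbsAvg_eq_gibbs]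
  refine continuous_gibbs (f := fun _ => f) (fun σ => ?_) fun _ => continuous_const
  unfold hamiltonian
  fun_prop

lemma continuous_localField (β D h p q : ℝ) :
    Continuous fun G : Fin (n + 1) → Fin (n + 1) → ℝ => localField S β D h p q G := by
  unfold localField
  refine Continuous.sub (continuous_const.mul (continuous_finsetSum _ fun i _ => ?_))
    (continuous_const.mul (continuous_gibbsAvg _ _ _ _))
  have hG : Continuous fun G : Fin (n + 1) → Fin (n + 1) → ℝ => G i.castSucc (Fin.last n) := by
    fun_prop
  exact hG.mul (continuous_gibbsAvg β D h (spin i.castSucc))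

/-- The estimate for an observable `φ` of the last spin with single-spin average `R`. -/
lemma integral_sq_tapError_le (hS : 1 ≤ S) {β D h p q : ℝ} (hβ : 0 ≤ β) (hβ1 : β ≤ 1)
    (hβS : β ^ 2 ≤ 1 / (96 * (S : ℝ) ^ 4)) (hpq : IsFixedPoint S β D h p q)
    (hg : IsGaussianDisorder P g) (φ : ℝ → ℝ) (R : ℝ → ℝ → ℝ)
    (hR : ∀ x y, R x y = gibbs (siteEnergy (S := S) x y) (fun s => φ (spinVal s)))
    (hRc : Continuous fun z : ℝ × ℝ => R z.1 z.2)
    (hRlip : ∀ x y y', |R x y' - R x y| ≤ 2 * (S : ℝ) ^ 3 * |y' - y|)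
    (hφ : ∀ s : Spin S, |φ (spinVal s)| ≤ (S : ℝ) ^ 2) :
    Integrable (fun ω => (gibbsAvg (S := S) β D h (g ω) (fun σ => φ (spin (Fin.last n) σ))
        - R (shift β D p q) (β * localField S β D h p q (g ω) + h)) ^ 2) P ∧
    ∫ ω, (gibbsAvg (S := S) β D h (g ω) (fun σ => φ (spin (Fin.last n) σ))
        - R (shift β D p q) (β * localField S β D h p q (g ω) + h)) ^ 2 ∂P
      ≤ 8 * (S : ℝ) ^ 6 * Fintype.card (Spin S) * (Fintype.card (Spin S) * (2 * projConst S) *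
        (7 / 2 * (576 * (S : ℝ) ^ 4 * (6 + 2 * (S : ℝ) ^ 4)) + 4)) / √((n + 1 : ℕ) : ℝ) := by
  set err : (Fin (n + 1) → Fin (n + 1) → ℝ) → ℝ := fun G =>
    (gibbsAvg (S := S) β D h G (fun σ => φ (spin (Fin.last n) σ))
        - R (shift β D p q) (β * localField S β D h p q G + h)) ^ 2 with herr
  have hN : ((n + 1 : ℕ) : ℝ) = n + 1 := by push_cast; rfl
  obtain ⟨hZm, hZ⟩ := hg.measurePreserving
  obtain ⟨hi, hle⟩ := integral_residual_disorder_le hS hN hβ hβ1 hβS hpq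
  set res : (Edge n ⊕ Fin n → ℝ) → ℝ := fun z => residual (S := S) ((n + 1 : ℕ) : ℝ) β (p - q)
    (cavityEnergy ((n + 1 : ℕ) : ℝ) β D h (fun e => z (Sum.inl e))) (fun i => z (Sum.inr i))
    with hres
  have hpoint : ∀ ω, err (g ω)
      ≤ 8 * (S : ℝ) ^ 6 * Fintype.card (Spin S) * res (splitDisorder (g ω)) := fun ω =>
    sq_tapError_le hS hβ hβ1 D h p q (g ω) φ R hR hRlip hφ rfl rfl rfl
  have hi' : Integrable (fun ω => res (splitDisorder (g ω))) P := by
    rw [← hZ] at hi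
    exact hi.comp_aemeasurable hZm
  have hle' : ∫ ω, res (splitDisorder (g ω)) ∂P = ∫ z, res z ∂gaussianPi (Edge n ⊕ Fin n) := by
    rw [← hZ] at hi ⊢
    exact (integral_map hZm hi.aestronglyMeasurable).symm
  have hcont : Continuous err := by
    refine ((continuous_gibbsAvg _ _ _ _).sub ?_).pow 2
    exact continuous_comp_uncurry hRc continuous_const
      ((continuous_const.mul (continuous_localField β D h p q)).add continuous_const)
  have hup : ∀ ω, err (g ω) = err (upperDisorder (g ω)) := fun ω => by
    simp only [herr, gibbsAvg_upperDisorder, localField_upperDisorder]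
  have hum : AEMeasurable (fun ω => upperDisorder (g ω)) P := by
    refine aemeasurable_pi_lambda _ fun i => aemeasurable_pi_lambda _ fun j => ?_
    by_cases hij : i < j
    · simpa only [upperDisorder, if_pos hij] using (hg.1 i j hij).aemeasurable
    · simp only [upperDisorder, if_neg hij]
      exact aemeasurable_const
  have hem : AEStronglyMeasurable (fun ω => err (g ω)) P := by
    simp only [hup]
    exact (hcont.measurable.comp_aemeasurable hum).aestronglyMeasurable
  have hint : Integrable (fun ω => err (g ω)) P :=
    (hi'.const_mul _).mono' hem (Filter.Eventually.of_forall fun ω => by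
      rw [Real.norm_eq_abs, abs_of_nonneg (sq_nonneg _)]
      exact hpoint ω)
  refine ⟨hint, (integral_mono hint (hi'.const_mul _) hpoint).trans ?_⟩
  rw [integral_const_mul, hle', mul_div_assoc]
  refine mul_le_mul_of_nonneg_left ?_ (by positivity)
  refine hle.trans (le_of_eq ?_)
  ring

end Disorder

end GhatakSherrington

end

/-- The number of spins is `N = n + 1`, so that `n : ℕ` ranges over all `N ≥ 1`. -/
theorem theorem2 (S : ℕ) (hS : 1 ≤ S) :
    ∃ K βhat : ℝ, 0 < K ∧ 0 < βhat ∧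
      ∀ β h D : ℝ, 0 ≤ β → β < βhat → 0 ≤ h →
        (∃! pq : ℝ × ℝ, GhatakSherrington.IsFixedPoint S β D h pq.1 pq.2) ∧
        ∀ p q : ℝ, GhatakSherrington.IsFixedPoint S β D h p q →
          ∀ (n : ℕ) (Ω : Type*) [MeasurableSpace Ω] (P : Measure Ω) [IsProbabilityMeasure P]
            (g : Ω → Fin (n + 1) → Fin (n + 1) → ℝ),
            GhatakSherrington.IsGaussianDisorder P g →
              (Integrable (fun ω => GhatakSherrington.tapError₁ S β D h p q (g ω) ^ 2) P ∧
                ∫ ω, GhatakSherrington.tapError₁ S β D h p q (g ω) ^ 2 ∂P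
                  ≤ K / √((n + 1 : ℕ) : ℝ)) ∧
              (Integrable (fun ω => GhatakSherrington.tapError₂ S β D h p q (g ω) ^ 2) P ∧
                ∫ ω, GhatakSherrington.tapError₂ S β D h p q (g ω) ^ 2 ∂P
                  ≤ K / √((n + 1 : ℕ) : ℝ)) := by
  have hS1 : (1 : ℝ) ≤ S := by exact_mod_cast hS
  have hS0 : (0 : ℝ) < S := by linarith
  have hproj := GhatakSherrington.projConst_pos hS
  have hcard : 0 < (Fintype.card (GhatakSherrington.Spin S) : ℝ) := by
    exact_mod_cast Fintype.card_pos
  refine ⟨8 * (S : ℝ) ^ 6 * Fintype.card (GhatakSherrington.Spin S) *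
    (Fintype.card (GhatakSherrington.Spin S) * (2 * GhatakSherrington.projConst S) *
      (7 / 2 * (576 * (S : ℝ) ^ 4 * (6 + 2 * (S : ℝ) ^ 4)) + 4)), 1 / (10 * (S : ℝ) ^ 2),
    by positivity, by positivity, fun β h D hβ hβ' _ => ?_⟩
  -- The bound on `β` needed for the concentration of the overlaps is stronger than the one for the
  -- contraction.
  have hβS : β ^ 2 ≤ 1 / (96 * (S : ℝ) ^ 4) := by
    calc β ^ 2 ≤ (1 / (10 * (S : ℝ) ^ 2)) ^ 2 := by gcongr
      _ = 1 / (100 * (S : ℝ) ^ 4) := by field_simp; norm_num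
      _ ≤ _ := by gcongr; norm_num
  have hβ1 : β ≤ 1 := by
    refine hβ'.le.trans ?_
    rw [div_le_one (by positivity)]
    nlinarith
  have hfix : 20 * (S : ℝ) ^ 4 * β ^ 2 ≤ 1 / 4 := by
    calc 20 * (S : ℝ) ^ 4 * β ^ 2 ≤ 20 * (S : ℝ) ^ 4 * (1 / (96 * (S : ℝ) ^ 4)) := by gcongr
      _ = 20 / 96 := by field_simp
      _ ≤ 1 / 4 := by norm_num
  refine ⟨GhatakSherrington.existsUnique_isFixedPoint hS hfix D h, ?_⟩
  intro p q hpq n Ω _ P _ g hg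
  have h12 : (S : ℝ) ≤ (S : ℝ) ^ 2 := by nlinarith
  have h23 : (S : ℝ) ^ 2 ≤ (S : ℝ) ^ 3 := pow_le_pow_right₀ hS1 (by norm_num)
  constructor
  · exact GhatakSherrington.integral_sq_tapError_le hS hβ hβ1 hβS hpq hg (fun x => x)
      (GhatakSherrington.shRatio S) (fun x y => GhatakSherrington.shRatio_eq_gibbs x y)
      GhatakSherrington.continuous_shRatio
      (fun x y y' => (GhatakSherrington.abs_shRatio_sub_le x y y').trans (by gcongr))
      (fun s => (GhatakSherrington.abs_spinVal_le s).trans h12)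
  · exact GhatakSherrington.integral_sq_tapError_le hS hβ hβ1 hβS hpq hg (fun x => x ^ 2)
      (GhatakSherrington.chRatio S) (fun x y => GhatakSherrington.chRatio_eq_gibbs x y)
      GhatakSherrington.continuous_chRatio
      (fun x y y' => GhatakSherrington.abs_chRatio_sub_le x y y')
      (fun s => by
        rw [abs_pow]
        exact pow_le_pow_left₀ (abs_nonneg _) (GhatakSherrington.abs_spinVal_le s) 2)
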